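/- **Setting.** Let $H=(V,E)$ be a finite $k$-uniform hypergraph. Its line graph $L(H)$ has vertex set $E$, and distinct edges are adjacent when they intersect; $N(f)$ is the set of neighbours of $f$ in $L(H)$, and $\Delta=\max_f|N(f)|$. For $S\subseteq E$ let $V(S)=\bigcup S$ and $N^+(S)=S\cup\bigcup_{f\in S}N(f)$. Let $\alpha\le 1/3$ be such that $\alpha k$ is an integer, and assume $2\mathrm e(\Delta+1)<2^{\alpha k}$ and $\Delta\le\frac1{192}2^{k/3}$. **The algorithm.** Every vertex has a status, initially *uncolored*. When an uncolored vertex is processed, a color from a two-element set is sampled for it, and it is marked *troubled* if it lies in an edge that is bad at this moment, and *accepted* otherwise. These marks and sampled colors form the record of the shattering phase; later the algorithm may accept a troubled vertex, with its sampled color or with a new one, without changing the record. An edge is *safe* if it has accepted vertices of both colors. It is *bad* if it is not safe and at least $(1-\alpha)k$ of its vertices were marked accepted when processed, all with the same sampled color. It is *unsafe* if all its vertices are colored and it is neither safe nor bad. Bad-components are the connected components formed by bad edges. Write $f|_a,f|_t$ for the sets of accepted and troubled vertices of $f$, and $V_t(S)$ for the troubled vertices in $V(S)$. *Determining* an edge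 means processing its uncolored vertices until it is safe or has no uncolored vertex. All orders of processing are arbitrary, and edges visited in one query are flagged as explored. *Expanding a bad-component* from a bad edge $e$ (which is flagged as explored): repeatedly take a bad edge already reached, and determine and flag all its unexplored neighbours; those that are bad are reached, and those that are unsafe are collected as surrounding unsafe edges. *Expanding via* $f$: determine the unexplored neighbours of $f$, and expand a bad-component from each of them that is bad. *Query* $v$: if $v$ is uncolored, process it. If it is then troubled, build a final component and color it. *Building.* $B$ starts as the bad-component of a bad edge containing $v$, $U$ as the set of its surrounding unsafe edges, and $U_s=\emptyset$. While $U\ne\emptyset$, remove some $f$ from $U$. If $f$ has at least $\alpha k$ vertices in $V_t(B)$, nothing more is done. Otherwise, if (r1) $f$ intersects two disjoint bad edges outside $B$, or (r2) $f\setminus V_t(B)$ is monochromatic, expand via $f$, enlarging $B$ and $U$. Otherwise, if $f$ has fewer than $\alpha k$ troubled vertices outside $V(B)$, put $f$ into $U_s$. When $U=\emptyset$, remove some $f$ from $U_s$; (r3) if it has fewer than $\alpha k$ vertices in $V_t(B)$, run a search from $f$, which returns two sets to be added to $B$ and $U$. Repeat until $U=U_s=\emptyset$; then $B$ is the set of bad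 edges of the *final component*. (The neighbours of an edge are determined as far as needed to decide the conditions; before an edge is found to violate (r1), all of them are determined. The same applies to (e3) below.) *Search from $e$.* Start with $A=U_A=\emptyset$ and $Q=\{e\}$. While $Q\neq\emptyset$, remove some $f$ from $Q$ and expand via $f$; let $C$ be the set of bad edges reached and $U_C$ the set of surrounding unsafe edges collected in this step; add them to $A$ and $U_A$. (e1) If $C$ contains a monochromatic edge, stop and return $(A,U_A)$. Otherwise, if some $g\in U_C$ (e2) is monochromatic or (e3) intersects two disjoint bad edges outside $C$, expand via such a $g$, enlarging $A$ and $U_A$, stop and return $(A,U_A)$. Otherwise add to $Q$ all $g\in U_C$ for which $g|_a\cup(g|_t\cap V(C))$ is monochromatic and $g$ has fewer than $\alpha k$ troubled vertices outside $V(C)$. If $Q$ becomes empty, accept the colors of all vertices of $V_t(A)$ and return $(\emptyset,\emptyset)$. In each case, the set $A$ at the end of the exploration is the set of bad edges of the *search area*. *Coloring a final component $B$.* Recolor $V_t(B)$ in such a way that every nonempty set $e\cap V_t(B)$, for $e\in B$ and for unsafe $e$ with $|e\cap V_t(B)|\ge\alpha k$, is not monochromatic, and accept these vertices. Failures caused by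 components that are too large are disregarded: every component is built completely. **Witness structures.** A witness structure $\tau$ consists of a finite tree $T$, a homomorphism $x\mapsto f_x$ from $T$ to $L(H)$, a label from $\{M,B,B_{in},B_{out},U,E\}$ for every node, and an orientation of the edges of $T$. Its size $|\tau|$ is the number of nodes. Nodes not labelled $E$ are active. The depth $d(x)$ is the maximum length of a directed path from $x$ to a node without outgoing arcs. Let $W_{<d}=V(N^+(\{f_x: x\text{ active},\,d(x)<d\}))$. The structure $\tau$ is *proper* if $2\#M+\#B+\#B_{in}+\#B_{out}-\#E\ge0$ (numbers of nodes with the given labels) and the edges $f_x$ assigned to distinct active nodes are distinct and disjoint. It is *satisfied* if, with respect to the record of the shattering phase (marks and sampled colors), every active node $x$ fulfils the condition given by its label: - $M$: $f_x$ is colored and monochromatic; - $B$: $f_x$ is bad, i.e. at least $(1-\alpha)k$ of its vertices are marked accepted, and these have the same color; - $B_{in}$: $f_x$ is unsafe (all its vertices are colored, fewer than $(1-\alpha)k$ of them are marked accepted, and these have the same color), and $f_x|_a\cup(f_x|_t\cap W_{<d(x)})$ is monochromatic of size at least $(1-\alpha)k$; - $B_{out}$: $f_x$ is unsafe, and $f_x|_a\cup(f_x|_t\setminus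 W_{<d(x)})$ is monochromatic of size at least $(1-\alpha)k$; - $U$: $f_x$ is unsafe and has fewer than $2\alpha k$ troubled vertices. **Proposition.** For every sequence of queries, every outcome of the random choices and all arbitrary choices of the algorithm, and for every component (final component or search area) constructed during its work, with set of bad edges $C$: at the moment when this component is complete, there exists a satisfied proper witness structure $\tau$ with $$|\tau|\ \ge\ \frac{|C|}{\Delta+1}.$$ -/

import Mathlib

namespace LocalColoring

/-! ### Hypergraphs and line graphs -/

/-- The edges of `H` as a type. -/
abbrev Edge {V : Type*} (H : Hypergraph V) : Type _ := {e : Set V // e ∈ H.edgeSet}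

/-- The line graph of `H`: distinct edges are adjacent when they intersect. -/
def lineGraph {V : Type*} (H : Hypergraph V) : SimpleGraph (Edge H) where
  Adj e f := e ≠ f ∧ (e.1 ∩ f.1).Nonempty
  symm := ⟨fun e f h => ⟨h.1.symm, by rw [Set.inter_comm]; exact h.2⟩⟩
  loopless := ⟨fun _ h => h.1 rfl⟩

/-- `N(f)`: the edges (other than `f`) that intersect `f`. -/
def nbrs {V : Type*} {H : Hypergraph V} (f : Edge H) : Set (Edge H) :=
  (lineGraph H).neighborSet f

/-- Every edge has exactly `k` vertices. -/
def IsUniform {V : Type*} (H : Hypergraph V) (k : ℕ) : Prop :=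
  ∀ e : Edge H, e.1.ncard = k

/-- The maximum edge degree of a (finite) hypergraph: the maximum of `|N(f)|`. -/
noncomputable def maxEdgeDegree {V : Type*} (H : Hypergraph V) : ℕ :=
  ⨆ f : Edge H, (nbrs f).ncard

/-- `V(S)`: the vertices covered by the edges from `S`. -/
def verts {V : Type*} {H : Hypergraph V} (S : Set (Edge H)) : Set V :=
  {v | ∃ e ∈ S, v ∈ e.1}

/-- `N⁺(S)`: the edges that belong to `S` or are adjacent to an element of `S`. -/
def coveredBy {V : Type*} {H : Hypergraph V} (S : Set (Edge H)) : Set (Edge H) :=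
  {g | g ∈ S ∨ ∃ f ∈ S, g ∈ nbrs f}

/-- `S` is monochromatic under `c`. -/
def Mono {V : Type*} (c : V → Bool) (S : Set V) : Prop :=
  ∀ x ∈ S, ∀ y ∈ S, c x = c y

/-! ### The memory of the algorithm

Throughout, `k` is the size of the edges and `a` stands for the integer `α k`. -/

/-- The three statuses of a vertex. -/
inductive Status where
  | uncolored
  | accepted
  | troubled

/-- The record of the shattering phase: for every vertex whether it was marked accepted or troubled
at the moment when its color was sampled, and which color was sampled. -/
structure Record (V : Type*) where
  mark : V → Status
  sample : V → Bool

/-- `e|_a`, with respect to the shattering phase. -/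
def Record.acc {V : Type*} (R : Record V) (e : Set V) : Set V :=
  {v | v ∈ e ∧ R.mark v = Status.accepted}

/-- `e|_t`, with respect to the shattering phase. -/
def Record.trb {V : Type*} (R : Record V) (e : Set V) : Set V :=
  {v | v ∈ e ∧ R.mark v = Status.troubled}

/-- All vertices of `e` have been colored. -/
def Record.Colored {V : Type*} (R : Record V) (e : Set V) : Prop :=
  ∀ v ∈ e, R.mark v ≠ Status.uncolored

/-- `e` became bad in the shattering phase: it has (at least) `(1 - α) k` accepted vertices,
all of the same color. -/
def Record.IsBad {V : Type*} (k a : ℕ) (R : Record V) (e : Set V) : Prop :=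
  k ≤ (R.acc e).ncard + a ∧ Mono R.sample (R.acc e)

/-- `e` is unsafe: all its vertices are colored, its accepted vertices have the same color,
and there are fewer than `(1 - α) k` of them. -/
def Record.IsUnsafe {V : Type*} (k a : ℕ) (R : Record V) (e : Set V) : Prop :=
  R.Colored e ∧ (R.acc e).ncard + a < k ∧ Mono R.sample (R.acc e)

/-- The memory preserved between queries: the current status and the current color of every vertex,
and the record of the shattering phase. The status of a troubled vertex can later become `accepted`,
and its color can be changed in the final coloring phase; the record is never altered afterwards. -/
structure Memory (V : Type*) where
  status : V → Status
  color : V → Bool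
  record : Record V

/-- The currently accepted vertices of `e`. -/
def Memory.acc {V : Type*} (M : Memory V) (e : Set V) : Set V :=
  {v | v ∈ e ∧ M.status v = Status.accepted}

/-- The currently troubled vertices of `e`. -/
def Memory.trb {V : Type*} (M : Memory V) (e : Set V) : Set V :=
  {v | v ∈ e ∧ M.status v = Status.troubled}

/-- `e` is properly colored by accepted vertices. -/
def Memory.IsSafe {V : Type*} (M : Memory V) (e : Set V) : Prop :=
  ¬ Mono M.color (M.acc e)

/-- `e` is bad: it became bad in the shattering phase and it is not safe yet. -/
def Memory.IsBad {V : Type*} (k a : ℕ) (M : Memory V) (e : Set V) : Prop :=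
  M.record.IsBad k a e ∧ ¬ M.IsSafe e

/-- `e` is unsafe: all its vertices are colored, and it is neither safe nor bad. -/
def Memory.IsUnsafe {V : Type*} (k a : ℕ) (M : Memory V) (e : Set V) : Prop :=
  (∀ v ∈ e, M.status v ≠ Status.uncolored) ∧ ¬ M.IsSafe e ∧ ¬ M.IsBad k a e

/-- The status of the edge `e` is determined: it is safe, or all its vertices are colored. -/
def Memory.Determined {V : Type*} (M : Memory V) (e : Set V) : Prop :=
  M.IsSafe e ∨ ∀ v ∈ e, M.status v ≠ Status.uncolored

/-- `f` intersects at least two disjoint bad edges outside `S`. -/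
def Memory.TwoDisjointBad {V : Type*} {H : Hypergraph V} (k a : ℕ) (M : Memory V)
    (f : Edge H) (S : Set (Edge H)) : Prop :=
  ∃ g ∈ nbrs f, ∃ h ∈ nbrs f, g ∉ S ∧ h ∉ S ∧ M.IsBad k a g.1 ∧ M.IsBad k a h.1 ∧
    Disjoint g.1 h.1

/-- The initial memory: nothing is colored. -/
def Memory.initial (V : Type*) : Memory V where
  status _ := Status.uncolored
  color _ := false
  record := ⟨fun _ => Status.uncolored, fun _ => false⟩

open Classical in
/-- The mark that an uncolored vertex receives: troubled if it belongs to a bad edge,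
accepted otherwise. -/
noncomputable def Memory.markFor {V : Type*} (H : Hypergraph V) (k a : ℕ) (M : Memory V) (w : V) :
    Status :=
  if ∃ e : Edge H, w ∈ e.1 ∧ M.IsBad k a e.1 then Status.troubled else Status.accepted

open Classical in
/-- Coloring an uncolored vertex `w`, where `c` is the sampled color. -/
noncomputable def Memory.colorVertex {V : Type*} (H : Hypergraph V) (k a : ℕ) (M : Memory V)
    (w : V) (c : Bool) : Memory V where
  status := Function.update M.status w (M.markFor H k a w)
  color := Function.update M.color w c
  record := ⟨Function.update M.record.mark w (M.markFor H k a w),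
    Function.update M.record.sample w c⟩

open Classical in
/-- Accepting the colors of all troubled vertices in `S`. -/
noncomputable def Memory.accept {V : Type*} (M : Memory V) (S : Set V) : Memory V where
  status v := if v ∈ M.trb S then Status.accepted else M.status v
  color := M.color
  record := M.record

/-! ### The procedures

The procedures are relations between the data before and after a call. All arbitrary choices
(the sampled colors, the order in which vertices and edges are taken) are left free. The bound on the
sizes of components, whose violation is a failure, is not imposed: the procedures continue
until a complete component is built. -/

/-- `determine_edge_status(g)`: uncolored vertices of `g` are colored until `g` is safe or
all its vertices are colored. -/
inductive DetermineEdge {V : Type*} (H : Hypergraph V) (k a : ℕ) (g : Edge H) :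
    Memory V → Memory V → Prop
  | done {M : Memory V} (h : M.Determined g.1) : DetermineEdge H k a g M M
  | step {M M' : Memory V} (w : V) (c : Bool) (hs : ¬ M.IsSafe g.1) (hw : w ∈ g.1)
      (hu : M.status w = Status.uncolored)
      (h : DetermineEdge H k a g (M.colorVertex H k a w c) M') : DetermineEdge H k a g M M'

/-- Determining the statuses of some edges that intersect elements of `S`, which is needed to
look for bad edges intersected by elements of `S`. -/
def Inspect {V : Type*} {H : Hypergraph V} (k a : ℕ) (S : Set (Edge H)) :
    Memory V → Memory V → Prop :=
  Relation.ReflTransGen fun M M' => ∃ f ∈ S, ∃ g ∈ nbrs f, DetermineEdge H k a g M M'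

/-- The statuses of all edges that intersect elements of `S` are determined. -/
def Inspected {V : Type*} {H : Hypergraph V} (S : Set (Edge H)) (M : Memory V) : Prop :=
  ∀ f ∈ S, ∀ g ∈ nbrs f, M.Determined g.1

/-- The data used by the exploring procedures: the memory, the edges flagged as explored in the
current query, a set of bad edges, and a set of unsafe edges around them. -/
structure Work {V : Type*} (H : Hypergraph V) where
  mem : Memory V
  explored : Set (Edge H)
  bad : Set (Edge H)
  uns : Set (Edge H)

/-- `l` lists the elements of `S`, each exactly once. -/
def Enumerates {E : Type*} (l : List E) (S : Set E) : Prop :=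
  l.Nodup ∧ ∀ g, g ∈ l ↔ g ∈ S

/-- The inner loop of `expand_bad_component`, over a list of edges. The second and fourth argument
are the values, before and after the loop, of the set `Q` of bad edges to be taken. -/
inductive ScanBad {V : Type*} {H : Hypergraph V} (k a : ℕ) :
    List (Edge H) → Work H → Set (Edge H) → Work H → Set (Edge H) → Prop
  | nil (W : Work H) (Q : Set (Edge H)) : ScanBad k a [] W Q W Q
  | skip {g : Edge H} {l : List (Edge H)} {W W' : Work H} {Q Q' : Set (Edge H)}
      (hg : g ∈ W.explored) (h : ScanBad k a l W Q W' Q') : ScanBad k a (g :: l) W Q W' Q'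
  | visit {g : Edge H} {l : List (Edge H)} {W W' : Work H} {Q Q' : Set (Edge H)} {M : Memory V}
      (hg : g ∉ W.explored) (hd : DetermineEdge H k a g W.mem M)
      (h : ScanBad k a l
        ⟨M, insert g W.explored, W.bad, W.uns ∪ {x | x = g ∧ M.IsUnsafe k a g.1}⟩
        (Q ∪ {x | x = g ∧ M.IsBad k a g.1}) W' Q') :
      ScanBad k a (g :: l) W Q W' Q'

/-- The main loop of `expand_bad_component`; the first argument is the set `Q` of bad edges
to be taken. -/
inductive ExpandBadLoop {V : Type*} {H : Hypergraph V} (k a : ℕ) :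
    Set (Edge H) → Work H → Work H → Prop
  | done (W : Work H) : ExpandBadLoop k a ∅ W W
  | step {f : Edge H} {l : List (Edge H)} {Q Q₁ : Set (Edge H)} {W W₁ W₂ : Work H}
      (hf : f ∈ Q) (hl : Enumerates l (nbrs f))
      (hs : ScanBad k a l ⟨W.mem, W.explored, insert f W.bad, W.uns⟩ (Q \ {f}) W₁ Q₁)
      (h : ExpandBadLoop k a Q₁ W₁ W₂) : ExpandBadLoop k a Q W W₂

/-- Mark `e` as explored and run `expand_bad_component(e)`. -/
def ExpandBad {V : Type*} {H : Hypergraph V} (k a : ℕ) (e : Edge H) (W W' : Work H) : Prop :=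
  ExpandBadLoop k a {e} ⟨W.mem, insert e W.explored, W.bad, W.uns⟩ W'

/-- The loop of `expand_via_unsafe`, over a list of edges. -/
inductive ScanVia {V : Type*} {H : Hypergraph V} (k a : ℕ) :
    List (Edge H) → Work H → Work H → Prop
  | nil (W : Work H) : ScanVia k a [] W W
  | skip {g : Edge H} {l : List (Edge H)} {W W' : Work H}
      (hg : g ∈ W.explored) (h : ScanVia k a l W W') : ScanVia k a (g :: l) W W'
  | notBad {g : Edge H} {l : List (Edge H)} {W W' : Work H} {M : Memory V}
      (hg : g ∉ W.explored) (hd : DetermineEdge H k a g W.mem M) (hb : ¬ M.IsBad k a g.1)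
      (h : ScanVia k a l ⟨M, W.explored, W.bad, W.uns⟩ W') : ScanVia k a (g :: l) W W'
  | bad {g : Edge H} {l : List (Edge H)} {W W₁ W' : Work H} {M : Memory V}
      (hg : g ∉ W.explored) (hd : DetermineEdge H k a g W.mem M) (hb : M.IsBad k a g.1)
      (he : ExpandBad k a g ⟨M, W.explored, W.bad, W.uns⟩ W₁)
      (h : ScanVia k a l W₁ W') : ScanVia k a (g :: l) W W'

/-- `expand_via_unsafe(f)`. -/
def ExpandVia {V : Type*} {H : Hypergraph V} (k a : ℕ) (f : Edge H) (W W' : Work H) : Prop :=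
  ∃ l, Enumerates l (nbrs f) ∧ ScanVia k a l W W'

/-- `W'` is the outcome of expanding, from the data `W`, the external bad-component to which `f`
leads, collecting its bad edges `C = W'.bad` and the unsafe edges `U_C = W'.uns` anew. -/
def ExpandFresh {V : Type*} {H : Hypergraph V} (k a : ℕ) (f : Edge H) (W W' : Work H) : Prop :=
  ExpandVia k a f ⟨W.mem, W.explored, ∅, ∅⟩ W'

/-- The edges of `U_C` that may cause an activation of `C` and have fewer than `α k` troubled
vertices outside `V(C)`. -/
def activating {V : Type*} {H : Hypergraph V} (a : ℕ) (M : Memory V) (C UC : Set (Edge H)) :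
    Set (Edge H) :=
  {g | g ∈ UC ∧ Mono M.color (M.acc g.1 ∪ (M.trb g.1 ∩ verts C)) ∧
    (M.trb g.1 \ verts C).ncard < a}

/-- The loop of `expand_or_accept`. In `SearchLoop k a Q W W' b`, the set `Q` consists of the unsafe
edges to be processed, `W.bad` and `W.uns` are the current values of the search area `A` and of
the surrounding unsafe edges `U_A`, `W'` is the outcome, and `b` tells whether an
amortizing configuration was found. -/
inductive SearchLoop {V : Type*} {H : Hypergraph V} (k a : ℕ) :
    Set (Edge H) → Work H → Work H → Bool → Prop
  | exhausted (W : Work H) : SearchLoop k a ∅ W W false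
  /- configuration (e1): a monochromatic edge in `C` -/
  | monoBad {f g : Edge H} {Q : Set (Edge H)} {W W₁ : Work H}
      (hf : f ∈ Q) (hx : ExpandFresh k a f W W₁)
      (hg : g ∈ W₁.bad) (h₁ : Mono W₁.mem.color g.1) :
      SearchLoop k a Q W ⟨W₁.mem, W₁.explored, W.bad ∪ W₁.bad, W.uns ∪ W₁.uns⟩ true
  /- configurations (e2) and (e3): a monochromatic edge in `U_C`, or an edge in `U_C` that
  intersects two disjoint bad edges outside `C` -/
  | viaUnsafe {f g : Edge H} {Q : Set (Edge H)} {W W₁ W₂ : Work H} {M : Memory V}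
      (hf : f ∈ Q) (hx : ExpandFresh k a f W W₁)
      (h₁ : ∀ e ∈ W₁.bad, ¬ Mono W₁.mem.color e.1)
      (hi : Inspect k a W₁.uns W₁.mem M)
      (hg : g ∈ W₁.uns) (h₂ : Mono M.color g.1 ∨ M.TwoDisjointBad k a g W₁.bad)
      (hv : ExpandVia k a g ⟨M, W₁.explored, W.bad ∪ W₁.bad, W.uns ∪ W₁.uns⟩ W₂) :
      SearchLoop k a Q W W₂ true
  /- no amortizing configuration: the search continues -/
  | next {f : Edge H} {Q : Set (Edge H)} {W W₁ W' : Work H} {M : Memory V} {b : Bool}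
      (hf : f ∈ Q) (hx : ExpandFresh k a f W W₁)
      (h₁ : ∀ e ∈ W₁.bad, ¬ Mono W₁.mem.color e.1)
      (hi : Inspect k a W₁.uns W₁.mem M) (hd : Inspected W₁.uns M)
      (h₂ : ∀ g ∈ W₁.uns, ¬ Mono M.color g.1 ∧ ¬ M.TwoDisjointBad k a g W₁.bad)
      (h : SearchLoop k a ((Q \ {f}) ∪ activating a M W₁.bad W₁.uns)
        ⟨M, W₁.explored, W.bad ∪ W₁.bad, W.uns ∪ W₁.uns⟩ W' b) :
      SearchLoop k a Q W W' b

/-- A complete exploration of a search area by `expand_or_accept(e)`, called with the data `W`.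
The search area is `W'.bad`. -/
def Search {V : Type*} {H : Hypergraph V} (k a : ℕ) (e : Edge H) (W W' : Work H) (b : Bool) :
    Prop :=
  SearchLoop k a {e} ⟨W.mem, W.explored, ∅, ∅⟩ W' b

/-- `f` has fewer than `α k` troubled vertices in `V(B)`. -/
def FewInside {V : Type*} {H : Hypergraph V} (a : ℕ) (M : Memory V) (B : Set (Edge H))
    (f : Edge H) : Prop :=
  (M.trb f.1 ∩ verts B).ncard < a

/-- `f` has fewer than `α k` troubled vertices outside `V(B)`. -/
def FewOutside {V : Type*} {H : Hypergraph V} (a : ℕ) (M : Memory V) (B : Set (Edge H))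
    (f : Edge H) : Prop :=
  (M.trb f.1 \ verts B).ncard < a

/-- The rules (r1) and (r2): `f` intersects two disjoint bad edges outside `B`, or
`f` is monochromatic outside `V_t(B)`. -/
def ExpandRule {V : Type*} {H : Hypergraph V} (k a : ℕ) (M : Memory V) (B : Set (Edge H))
    (f : Edge H) : Prop :=
  M.TwoDisjointBad k a f B ∨ Mono M.color (f.1 \ M.trb (verts B))

/-- The states of the main loop of `build_final_component(v)`, started with the memory `M₀`.
In `BuildState k a M₀ v W Us`, the sets `W.bad`, `W.uns` and `Us` are the current values of `B`, `U`
and `U_s` (the unsafe edges able to launch a search). -/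
inductive BuildState {V : Type*} {H : Hypergraph V} (k a : ℕ) (M₀ : Memory V) (v : V) :
    Work H → Set (Edge H) → Prop
  | start {e : Edge H} {W : Work H} (hv : v ∈ e.1) (he : M₀.IsBad k a e.1)
      (h : ExpandBad k a e ⟨M₀, ∅, ∅, ∅⟩ W) : BuildState k a M₀ v W ∅
  /- an edge of `U` is trimmed to `V(B)` -/
  | trim {f : Edge H} {W : Work H} {Us : Set (Edge H)} (h : BuildState k a M₀ v W Us)
      (hf : f ∈ W.uns) (ht : ¬ FewInside a W.mem W.bad f) :
      BuildState k a M₀ v ⟨W.mem, W.explored, W.bad, W.uns \ {f}⟩ Us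
  /- rules (r1) and (r2) -/
  | expand {f : Edge H} {W W' : Work H} {Us : Set (Edge H)} {M : Memory V}
      (h : BuildState k a M₀ v W Us)
      (hf : f ∈ W.uns) (ht : FewInside a W.mem W.bad f) (hi : Inspect k a {f} W.mem M)
      (hr : ExpandRule k a M W.bad f)
      (hv : ExpandVia k a f ⟨M, W.explored, W.bad, W.uns \ {f}⟩ W') :
      BuildState k a M₀ v W' Us
  /- the edge can be used later by the rule (r3) -/
  | defer {f : Edge H} {W : Work H} {Us : Set (Edge H)} {M : Memory V}
      (h : BuildState k a M₀ v W Us)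
      (hf : f ∈ W.uns) (ht : FewInside a W.mem W.bad f) (hi : Inspect k a {f} W.mem M)
      (hd : Inspected {f} M) (hr : ¬ ExpandRule k a M W.bad f) (ho : FewOutside a M W.bad f) :
      BuildState k a M₀ v ⟨M, W.explored, W.bad, W.uns \ {f}⟩ (insert f Us)
  /- the edge is trimmed to an external bad-component -/
  | drop {f : Edge H} {W : Work H} {Us : Set (Edge H)} {M : Memory V}
      (h : BuildState k a M₀ v W Us)
      (hf : f ∈ W.uns) (ht : FewInside a W.mem W.bad f) (hi : Inspect k a {f} W.mem M)
      (hd : Inspected {f} M) (hr : ¬ ExpandRule k a M W.bad f) (ho : ¬ FewOutside a M W.bad f) :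
      BuildState k a M₀ v ⟨M, W.explored, W.bad, W.uns \ {f}⟩ Us
  /- an edge of `U_s` is trimmed to `V(B)` -/
  | trimDeferred {f : Edge H} {W : Work H} {Us : Set (Edge H)} (h : BuildState k a M₀ v W Us)
      (hU : W.uns = ∅) (hf : f ∈ Us) (ht : ¬ FewInside a W.mem W.bad f) :
      BuildState k a M₀ v W (Us \ {f})
  /- rule (r3), an amortizing configuration is found: the search area joins `B` -/
  | searchFound {f : Edge H} {W A : Work H} {Us : Set (Edge H)} (h : BuildState k a M₀ v W Us)
      (hU : W.uns = ∅) (hf : f ∈ Us) (ht : FewInside a W.mem W.bad f)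
      (hs : Search k a f W A true) :
      BuildState k a M₀ v ⟨A.mem, A.explored, W.bad ∪ A.bad, W.uns ∪ A.uns⟩ (Us \ {f})
  /- rule (r3), activation exclusion: the colors in the search area are accepted -/
  | searchExcluded {f : Edge H} {W A : Work H} {Us : Set (Edge H)} (h : BuildState k a M₀ v W Us)
      (hU : W.uns = ∅) (hf : f ∈ Us) (ht : FewInside a W.mem W.bad f)
      (hs : Search k a f W A false) :
      BuildState k a M₀ v ⟨A.mem.accept (verts A.bad), A.explored, W.bad, W.uns⟩ (Us \ {f})

/-- The outcome of `color_final_component` for the final component with the set of bad edges `B`: the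
troubled vertices in `V(B)` receive new colors, such that all bad edges from `B`, and all unsafe edges
with at least `α k` troubled vertices in `V(B)`, are properly colored after restricting them to
these vertices, and then the new colors are accepted. -/
def FinalColoring {V : Type*} {H : Hypergraph V} (k a : ℕ) (B : Set (Edge H)) (M M' : Memory V) :
    Prop :=
  ∃ c : V → Bool,
    (∀ v, v ∉ M.trb (verts B) → c v = M.color v) ∧
    (∀ e ∈ B, (e.1 ∩ M.trb (verts B)).Nonempty → ¬ Mono c (e.1 ∩ M.trb (verts B))) ∧
    (∀ f : Edge H, M.IsUnsafe k a f.1 → ¬ FewInside a M B f →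
      (f.1 ∩ M.trb (verts B)).Nonempty → ¬ Mono c (f.1 ∩ M.trb (verts B))) ∧
    M' = { M.accept (verts B) with color := c }

/-- The first part of `query(v)`: if `v` is uncolored, then it is marked and colored. -/
def Touch {V : Type*} (H : Hypergraph V) (k a : ℕ) (M : Memory V) (v : V) (M' : Memory V) : Prop :=
  (M.status v = Status.uncolored ∧ ∃ c, M' = M.colorVertex H k a v c) ∨
    (M.status v ≠ Status.uncolored ∧ M' = M)

/-- The memory contents that can occur after a sequence of answered queries. -/
inductive Reachable {V : Type*} (H : Hypergraph V) (k a : ℕ) : Memory V → Prop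
  | init : Reachable H k a (Memory.initial V)
  | accepted {M M₁ : Memory V} {v : V} (h : Reachable H k a M) (hv : v ∈ H.vertexSet)
      (ht : Touch H k a M v M₁) (hs : M₁.status v ≠ Status.troubled) : Reachable H k a M₁
  | troubled {M M₁ M₂ : Memory V} {v : V} {W : Work H} (h : Reachable H k a M)
      (hv : v ∈ H.vertexSet) (ht : Touch H k a M v M₁) (hs : M₁.status v = Status.troubled)
      (hb : BuildState k a M₁ v W ∅) (hU : W.uns = ∅)
      (hc : FinalColoring k a W.bad W.mem M₂) : Reachable H k a M₂

/-- `build_final_component(v)`, started with the memory `M₁`, constructs a component (the final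
component, or a search area explored on the way) with the set of bad edges `C`, and `M` is the memory
at the moment when this component is complete. -/
inductive Builds {V : Type*} {H : Hypergraph V} (k a : ℕ) (M₁ : Memory V) (v : V) :
    Set (Edge H) → Memory V → Prop
  | finalComponent {W : Work H} (h : BuildState k a M₁ v W ∅) (hU : W.uns = ∅) :
      Builds k a M₁ v W.bad W.mem
  | searchArea {f : Edge H} {W A : Work H} {Us : Set (Edge H)} {b : Bool}
      (h : BuildState k a M₁ v W Us) (hU : W.uns = ∅) (hf : f ∈ Us)
      (ht : FewInside a W.mem W.bad f) (hs : Search k a f W A b) :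
      Builds k a M₁ v A.bad A.mem

/-- In some run of the algorithm, for some sequence of queries, a component with
the set of bad edges `C` is constructed, and `M` is the memory at that moment. -/
def ComponentBuilt {V : Type*} (H : Hypergraph V) (k a : ℕ) (C : Set (Edge H)) (M : Memory V) :
    Prop :=
  ∃ (M₀ M₁ : Memory V) (v : V), Reachable H k a M₀ ∧ v ∈ H.vertexSet ∧ Touch H k a M₀ v M₁ ∧
    M₁.status v = Status.troubled ∧ Builds k a M₁ v C M

/-! ### Witness structures -/

/-- The labels of nodes: monochromatic, bad, bad "inside", bad "outside", unsafe, empty. -/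
inductive Label where
  | M
  | B
  | Bin
  | Bout
  | U
  | E

/-- A finite tree with a homomorphism to the line graph, labels of nodes, and an orientation
(`arc x y` means that the arc between `x` and `y` is directed from `x` to `y`). -/
structure WitnessStructure {V : Type*} (H : Hypergraph V) where
  Node : Type
  finite : Finite Node
  tree : SimpleGraph Node
  isTree : tree.IsTree
  hom : tree →g lineGraph H
  label : Node → Label
  arc : Node → Node → Prop
  adj_of_arc : ∀ x y, arc x y → tree.Adj x y
  arc_iff_not : ∀ x y, tree.Adj x y → (arc x y ↔ ¬ arc y x)

namespace WitnessStructure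

/-- The number of nodes. -/
noncomputable def size {V : Type*} {H : Hypergraph V} (τ : WitnessStructure H) : ℕ :=
  Nat.card τ.Node

/-- The set of vertices of the edge assigned to the node `x`. -/
def edge {V : Type*} {H : Hypergraph V} (τ : WitnessStructure H) (x : τ.Node) : Set V :=
  (τ.hom x).1

/-- Active nodes are those with a label other than `E`. -/
def Active {V : Type*} {H : Hypergraph V} (τ : WitnessStructure H) (x : τ.Node) : Prop :=
  τ.label x ≠ Label.E

/-- Roots are nodes without outgoing arcs. -/
def IsRoot {V : Type*} {H : Hypergraph V} (τ : WitnessStructure H) (x : τ.Node) : Prop :=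
  ∀ y, ¬ τ.arc x y

/-- There is a directed path of length `n` from `x` to `y` (in an oriented tree, all directed walks
are paths). -/
def DirPath {V : Type*} {H : Hypergraph V} (τ : WitnessStructure H) (n : ℕ) (x y : τ.Node) : Prop :=
  ∃ p : ℕ → τ.Node, p 0 = x ∧ p n = y ∧ ∀ i < n, τ.arc (p i) (p (i + 1))

/-- The depth: the maximum length of a directed path from `x` to a root. -/
noncomputable def depth {V : Type*} {H : Hypergraph V} (τ : WitnessStructure H) (x : τ.Node) : ℕ :=
  sSup {n | ∃ r, τ.IsRoot r ∧ τ.DirPath n x r}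

/-- `A_{<d}(τ)`: the edges assigned to active nodes of depth smaller than `d`. -/
def activeBelow {V : Type*} {H : Hypergraph V} (τ : WitnessStructure H) (d : ℕ) : Set (Edge H) :=
  {e | ∃ x, τ.Active x ∧ τ.depth x < d ∧ τ.hom x = e}

/-- The vertices of the edges covered by `A_{<d}(τ)`. -/
def coverBelow {V : Type*} {H : Hypergraph V} (τ : WitnessStructure H) (d : ℕ) : Set V :=
  verts (coveredBy (τ.activeBelow d))

/-- The basic event of the node `x`, for the record `R` of the shattering phase
(no requirement for an empty node). -/
def BasicEvent {V : Type*} {H : Hypergraph V} (τ : WitnessStructure H) (k a : ℕ) (R : Record V)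
    (x : τ.Node) : Prop :=
  match τ.label x with
  | Label.M => R.Colored (τ.edge x) ∧ Mono R.sample (τ.edge x)
  | Label.B => R.IsBad k a (τ.edge x)
  | Label.Bin => R.IsUnsafe k a (τ.edge x) ∧
      Mono R.sample (R.acc (τ.edge x) ∪ (R.trb (τ.edge x) ∩ τ.coverBelow (τ.depth x))) ∧
      k ≤ (R.acc (τ.edge x) ∪ (R.trb (τ.edge x) ∩ τ.coverBelow (τ.depth x))).ncard + a
  | Label.Bout => R.IsUnsafe k a (τ.edge x) ∧
      Mono R.sample (R.acc (τ.edge x) ∪ (R.trb (τ.edge x) \ τ.coverBelow (τ.depth x))) ∧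
      k ≤ (R.acc (τ.edge x) ∪ (R.trb (τ.edge x) \ τ.coverBelow (τ.depth x))).ncard + a
  | Label.U => R.IsUnsafe k a (τ.edge x) ∧ (R.trb (τ.edge x)).ncard < 2 * a
  | Label.E => True

/-- `τ` is satisfied: all basic events of its active nodes hold. -/
def Satisfied {V : Type*} {H : Hypergraph V} (τ : WitnessStructure H) (k a : ℕ) (R : Record V) :
    Prop :=
  ∀ x, τ.Active x → τ.BasicEvent k a R x

/-- The number of nodes with the label `L`. -/
noncomputable def count {V : Type*} {H : Hypergraph V} (τ : WitnessStructure H) (L : Label) : ℕ :=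
  {x | τ.label x = L}.ncard

/-- The balance of `τ`. -/
noncomputable def balance {V : Type*} {H : Hypergraph V} (τ : WitnessStructure H) : ℤ :=
  2 * (τ.count Label.M : ℤ) + (τ.count Label.B + τ.count Label.Bin + τ.count Label.Bout : ℤ) -
    (τ.count Label.E : ℤ)

/-- `τ` is proper: its balance is nonnegative, and the edges assigned to distinct active nodes are
disjoint and distinct. -/
def Proper {V : Type*} {H : Hypergraph V} (τ : WitnessStructure H) : Prop :=
  0 ≤ τ.balance ∧
    ∀ x y, τ.Active x → τ.Active y → x ≠ y → τ.hom x ≠ τ.hom y ∧ Disjoint (τ.edge x) (τ.edge y)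

end WitnessStructure

end LocalColoring

namespace LocalColoring

variable {V : Type*} {H : Hypergraph V} {k a : ℕ}

/-! ### Neighbourhoods -/

/-! The witness is grown greedily along the exploration. A bad edge becomes an active node only if
it is not yet covered, that is, neither equal nor adjacent to an active edge. Active edges are then
pairwise disjoint, and since each covers at most Δ + 1 edges, a tree whose active edges cover C has
at least |C| / (Δ + 1) nodes. An uncovered bad edge adjacent to a covered one is at distance two
from an active edge in the line graph, so it is attached behind one empty node: the label B earns
what the empty node costs, and the balance stays nonnegative.

Passing through an unsafe edge f may need a further empty node, and each rule supplies a
compensation. Under (r1), two disjoint bad edges are gained behind f (`Good.attach_fork`). Under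
(r2), and between the bad-components of a search area, f itself becomes a node labelled B_out or
B_in, unless a shorter connection exists (`Good.cross`, `Region.cover`). Under (r3), the search area
contains a configuration worth two units: a monochromatic edge, or three disjoint bad edges around
one empty node. It starts a second tree, which is joined to the old one through f, labelled U, and
two empty nodes (`Gain.cover`, `Good.join_via`). The cost of this joint is reserved in advance, and
trees that come close to each other earlier are joined earlier.

Depths enter through the covered vertices in the events B_in and B_out. A new node is placed behind
the deepest active node near it; thus it sees all covered vertices of its edge, and the events of
older nodes are not disturbed (`events_insert`).

The events speak about the record, while the rules consult current statuses. Both agree on edges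
whose troubled vertices have not been accepted later. The invariant `Sound` says that every other
unsafe edge is inert or has at least α k troubled vertices in V(B). Such edges need no witness: the
bad neighbours of an inert edge lie in one bad-component, and a component containing it swallows all
troubled vertices of the edge. The invariant survives acceptance in a search area
(`Building.excluded`) and the final coloring (`Building.finalColoring`). `Building` carries the tree
through the construction, and `Good.exists_witnessStructure` turns it into a witness structure. -/

theorem nbrs_symm {e f : Edge H} (h : f ∈ nbrs e) : e ∈ nbrs f :=
  (lineGraph H).symm.symm _ _ h

theorem mem_nbrs_of_mem {e f : Edge H} {w : V} (hne : e ≠ f) (he : w ∈ e.1) (hf : w ∈ f.1) :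
    f ∈ nbrs e := ⟨hne, w, he, hf⟩

theorem Mono.subset {c : V → Bool} {S T : Set V} (h : Mono c T) (hST : S ⊆ T) : Mono c S :=
  fun x hx y hy => h x (hST hx) y (hST hy)

theorem Mono.congr {c c' : V → Bool} {S : Set V} (h : Mono c S) (hc : ∀ w ∈ S, c' w = c w) :
    Mono c' S :=
  fun x hx y hy => by rw [hc x hx, hc y hy]; exact h x hx y hy

theorem mono_congr {c c' : V → Bool} {S : Set V} (hc : ∀ w ∈ S, c' w = c w) :
    Mono c' S ↔ Mono c S :=
  ⟨fun h => h.congr fun w hw => (hc w hw).symm, fun h => h.congr hc⟩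

/-! ### Growth of the memory while vertices are being colored -/

/-- An edge whose status can no longer become bad. -/
def Memory.Settled (k a : ℕ) (M : Memory V) (e : Set V) : Prop :=
  M.Determined e ∧ ¬ M.IsBad k a e

/-- All vertices of `e` have been colored. -/
def Memory.Full (M : Memory V) (e : Set V) : Prop :=
  ∀ w ∈ e, M.status w ≠ Status.uncolored

/-- The statuses of the vertices of `e` are those assigned in the shattering phase. -/
def Memory.Untouched (M : Memory V) (e : Set V) : Prop :=
  ∀ w ∈ e, M.status w = M.record.mark w

/-- `M'` extends `M`: colored vertices are left unchanged, and bad edges remain bad. -/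
structure Later (H : Hypergraph V) (k a : ℕ) (M M' : Memory V) : Prop where
  status : ∀ w, M.status w ≠ Status.uncolored → M'.status w = M.status w
  color : ∀ w, M.status w ≠ Status.uncolored → M'.color w = M.color w
  mark : ∀ w, M.record.mark w ≠ Status.uncolored → M'.record.mark w = M.record.mark w
  sample : ∀ w, M.record.mark w ≠ Status.uncolored → M'.record.sample w = M.record.sample w
  marked : ∀ w, M.status w ≠ Status.uncolored → M.record.mark w ≠ Status.uncolored
  bad : ∀ e : Edge H, M.IsBad k a e.1 → M'.IsBad k a e.1

theorem Memory.Full.acc_union_trb {M : Memory V} {e : Set V} (h : M.Full e) :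
    M.acc e ∪ M.trb e = e := by
  ext w
  constructor
  · rintro (h | h) <;> exact h.1
  · intro hw
    cases hs : M.status w
    · exact absurd hs (h w hw)
    · exact Or.inl ⟨hw, hs⟩
    · exact Or.inr ⟨hw, hs⟩

theorem Memory.acc_subset (M : Memory V) (e : Set V) : M.acc e ⊆ e := fun _ h => h.1

theorem Memory.Determined.full_of_not_safe {M : Memory V} {e : Set V} (h : M.Determined e)
    (hs : ¬ M.IsSafe e) : M.Full e := h.resolve_left hs

theorem Memory.IsUnsafe.settled {M : Memory V} {e : Set V} (h : M.IsUnsafe k a e) :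
    M.Settled k a e := ⟨Or.inr h.1, h.2.2⟩

/-! ### Properties that persist while further vertices are processed -/

namespace Later

variable {M M' M'' : Memory V}

theorem full (h : Later H k a M M') {e : Set V} (he : M.Full e) : M'.Full e :=
  fun w hw => by rw [h.status w (he w hw)]; exact he w hw

theorem acc_sub (h : Later H k a M M') (e : Set V) : M.acc e ⊆ M'.acc e := by
  intro w hw
  refine ⟨hw.1, ?_⟩
  rw [h.status w (by rw [hw.2]; simp), hw.2]

theorem trb_sub (h : Later H k a M M') (e : Set V) : M.trb e ⊆ M'.trb e := by
  intro w hw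
  refine ⟨hw.1, ?_⟩
  rw [h.status w (by rw [hw.2]; simp), hw.2]

theorem acc_eq (h : Later H k a M M') {e : Set V} (he : M.Full e) : M'.acc e = M.acc e := by
  refine Set.Subset.antisymm ?_ (h.acc_sub e)
  intro w hw
  exact ⟨hw.1, by rw [← h.status w (he w hw.1)]; exact hw.2⟩

theorem trb_eq (h : Later H k a M M') {e : Set V} (he : M.Full e) : M'.trb e = M.trb e := by
  refine Set.Subset.antisymm ?_ (h.trb_sub e)
  intro w hw
  exact ⟨hw.1, by rw [← h.status w (he w hw.1)]; exact hw.2⟩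

theorem mono_iff (h : Later H k a M M') {e S : Set V} (he : M.Full e) (hS : S ⊆ e) :
    Mono M'.color S ↔ Mono M.color S :=
  mono_congr fun w hw => h.color w (he w (hS hw))

theorem safe (h : Later H k a M M') {e : Set V} (he : M.IsSafe e) : M'.IsSafe e := by
  intro hm
  refine he ((hm.subset (h.acc_sub e)).congr fun w hw => ?_)
  exact (h.color w (by rw [hw.2]; simp)).symm

theorem determined (h : Later H k a M M') {e : Set V} (he : M.Determined e) : M'.Determined e :=
  he.imp h.safe h.full

theorem safe_iff (h : Later H k a M M') {e : Set V} (he : M.Full e) :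
    M'.IsSafe e ↔ M.IsSafe e := by
  unfold Memory.IsSafe
  rw [h.acc_eq he, h.mono_iff he (M.acc_subset e)]

theorem record_acc_eq (h : Later H k a M M') {e : Set V} (he : M.record.Colored e) :
    M'.record.acc e = M.record.acc e := by
  ext w
  constructor <;> intro hw <;> refine ⟨hw.1, ?_⟩
  · rw [← h.mark w (he w hw.1)]; exact hw.2
  · rw [h.mark w (he w hw.1)]; exact hw.2

theorem record_trb_eq (h : Later H k a M M') {e : Set V} (he : M.record.Colored e) :
    M'.record.trb e = M.record.trb e := by
  ext w
  constructor <;> intro hw <;> refine ⟨hw.1, ?_⟩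
  · rw [← h.mark w (he w hw.1)]; exact hw.2
  · rw [h.mark w (he w hw.1)]; exact hw.2

theorem record_colored (h : Later H k a M M') {e : Set V} (he : M.record.Colored e) :
    M'.record.Colored e :=
  fun w hw => by rw [h.mark w (he w hw)]; exact he w hw

theorem record_mono_iff (h : Later H k a M M') {e S : Set V} (he : M.record.Colored e)
    (hS : S ⊆ e) : Mono M'.record.sample S ↔ Mono M.record.sample S :=
  mono_congr fun w hw => h.sample w (he w (hS hw))

theorem colored_of_full (h : Later H k a M M') {e : Set V} (he : M.Full e) :
    M.record.Colored e := fun w hw => h.marked w (he w hw)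

theorem record_bad_iff (h : Later H k a M M') {e : Set V} (he : M.record.Colored e) :
    M'.record.IsBad k a e ↔ M.record.IsBad k a e := by
  unfold Record.IsBad
  rw [h.record_acc_eq he, h.record_mono_iff he fun _ hw => hw.1]

theorem record_unsafe (h : Later H k a M M') {e : Set V} (he : M.record.IsUnsafe k a e) :
    M'.record.IsUnsafe k a e := by
  refine ⟨h.record_colored he.1, ?_, ?_⟩
  · rw [h.record_acc_eq he.1]; exact he.2.1
  · rw [h.record_acc_eq he.1, h.record_mono_iff he.1 fun _ hw => hw.1]; exact he.2.2

theorem bad_iff (h : Later H k a M M') {e : Set V} (he : M.Full e) :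
    M'.IsBad k a e ↔ M.IsBad k a e := by
  unfold Memory.IsBad
  rw [h.safe_iff he, h.record_bad_iff (h.colored_of_full he)]

/-- A determined edge that is not safe has no uncolored vertex left, so nothing that decides its
badness can change; a safe one stays safe. -/
theorem bad_of_determined (h : Later H k a M M') {e : Set V} (he : M.Determined e)
    (hb : M'.IsBad k a e) : M.IsBad k a e :=
  (h.bad_iff (he.full_of_not_safe fun hs => hb.2 (h.safe hs))).1 hb

theorem settled (h : Later H k a M M') {e : Set V} (he : M.Settled k a e) : M'.Settled k a e :=
  ⟨h.determined he.1, fun hb => he.2 (h.bad_of_determined he.1 hb)⟩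

theorem unsafe_iff (h : Later H k a M M') {e : Set V} (he : M.Full e) :
    M'.IsUnsafe k a e ↔ M.IsUnsafe k a e := by
  unfold Memory.IsUnsafe
  rw [h.safe_iff he, h.bad_iff he]
  exact and_congr_left fun _ => ⟨fun _ => he, fun _ => h.full he⟩

theorem isUnsafe (h : Later H k a M M') {e : Set V} (he : M.IsUnsafe k a e) :
    M'.IsUnsafe k a e := (h.unsafe_iff he.1).2 he

theorem unsafe_of_settled (h : Later H k a M M') {e : Set V} (he : M.Settled k a e)
    (hu : M'.IsUnsafe k a e) : M.IsUnsafe k a e :=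
  (h.unsafe_iff (he.1.full_of_not_safe fun hs => hu.2.1 (h.safe hs))).1 hu

theorem untouched (h : Later H k a M M') {e : Set V} (he : M.Full e) (hu : M.Untouched e) :
    M'.Untouched e := fun w hw => by
  rw [h.status w (he w hw), h.mark w (h.marked w (he w hw))]; exact hu w hw

theorem twoDisjointBad (h : Later H k a M M') {f : Edge H} {S : Set (Edge H)}
    (hd : ∀ g ∈ nbrs f, M.Determined g.1) (ht : M'.TwoDisjointBad k a f S) :
    M.TwoDisjointBad k a f S := by
  obtain ⟨g, hg, g', hg', h1, h2, h3, h4, h5⟩ := ht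
  exact ⟨g, hg, g', hg', h1, h2, h.bad_of_determined (hd g hg) h3,
    h.bad_of_determined (hd g' hg') h4, h5⟩

theorem trb_diff_sub (h : Later H k a M M') {f : Edge H} {S : Set V} (hf : M.Full f.1) :
    f.1 \ M'.trb S = f.1 \ M.trb S := by
  ext w
  constructor
  · exact fun hw => ⟨hw.1, fun ht => hw.2 (h.trb_sub _ ht)⟩
  · exact fun hw => ⟨hw.1, fun ht => hw.2 ⟨ht.1, by
      rw [← h.status w (hf w hw.1)]; exact ht.2⟩⟩

theorem fewInside_iff (h : Later H k a M M') {f : Edge H} {S : Set (Edge H)} (hf : M.Full f.1) :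
    FewInside a M' S f ↔ FewInside a M S f := by
  unfold FewInside; rw [h.trb_eq hf]

theorem fewOutside_iff (h : Later H k a M M') {f : Edge H} {S : Set (Edge H)} (hf : M.Full f.1) :
    FewOutside a M' S f ↔ FewOutside a M S f := by
  unfold FewOutside; rw [h.trb_eq hf]

theorem trans (h : Later H k a M M') (h' : Later H k a M' M'') : Later H k a M M'' where
  status w hw := by
    rw [h'.status w (by rw [h.status w hw]; exact hw), h.status w hw]
  color w hw := by
    rw [h'.color w (by rw [h.status w hw]; exact hw), h.color w hw]
  mark w hw := by
    rw [h'.mark w (by rw [h.mark w hw]; exact hw), h.mark w hw]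
  sample w hw := by
    rw [h'.sample w (by rw [h.mark w hw]; exact hw), h.sample w hw]
  marked := h.marked
  bad e he := h'.bad e (h.bad e he)

end Later

/-! ### The invariants of the memory -/

/-- An unsafe edge that cannot be used by the exploring procedures: its bad neighbours pairwise
intersect, it is not monochromatic, and it still has many troubled vertices. -/
structure Inert (k a : ℕ) (M : Memory V) (f : Edge H) : Prop where
  determined : ∀ g ∈ nbrs f, M.Determined g.1
  meet : ¬ M.TwoDisjointBad k a f ∅
  not_mono : ¬ Mono M.color f.1
  many : a ≤ (M.trb f.1).ncard

/-- The invariants of the memory; `B` is the set of bad edges of the final component that is being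
built. -/
structure Sound (H : Hypergraph V) (k a : ℕ) (B : Set (Edge H)) (M : Memory V) : Prop where
  mark_uncolored : ∀ w, M.status w = Status.uncolored ↔ M.record.mark w = Status.uncolored
  accepted_of_mark : ∀ w, M.record.mark w = Status.accepted → M.status w = Status.accepted
  color_eq : ∀ w, M.status w = M.record.mark w → M.color w = M.record.sample w
  troubled_bad : ∀ w, M.status w = Status.troubled → ∃ e : Edge H, w ∈ e.1 ∧ M.IsBad k a e.1
  -- An edge that is not safe becomes bad as soon as `k - a` of its vertices are marked accepted,
  -- and from then on its vertices are marked troubled.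
  acc_card : ∀ e : Edge H, ¬ M.IsSafe e.1 → (M.record.acc e.1).ncard + a ≤ k
  bad_untouched : ∀ e : Edge H, M.IsBad k a e.1 → M.Untouched e.1
  touched_determined : ∀ e : Edge H, ¬ M.Untouched e.1 → M.Determined e.1
  -- The third case is void for `B = ∅` and `0 < a`, the situation between queries. During a query
  -- it describes edges that are left to the final coloring.
  unsafe_cases : ∀ f : Edge H, M.IsUnsafe k a f.1 →
    M.Untouched f.1 ∨ Inert k a M f ∨ ¬ FewInside a M B f

/-- Some uncolored vertices are processed. -/
def Progress (H : Hypergraph V) (k a : ℕ) : Memory V → Memory V → Prop :=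
  Relation.ReflTransGen fun M M' =>
    ∃ w c, M.status w = Status.uncolored ∧ M' = M.colorVertex H k a w c

theorem Inert.later {M M' : Memory V} {f : Edge H} (h : Inert k a M f) (hL : Later H k a M M')
    (hf : M.Full f.1) : Inert k a M' f where
  determined g hg := hL.determined (h.determined g hg)
  meet ht := h.meet (hL.twoDisjointBad h.determined ht)
  not_mono hm := h.not_mono ((hL.mono_iff hf subset_rfl).1 hm)
  many := by rw [hL.trb_eq hf]; exact h.many

theorem verts_mono {S T : Set (Edge H)} (h : S ⊆ T) : verts S ⊆ verts T :=
  fun _ ⟨e, he, hw⟩ => ⟨e, h he, hw⟩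

theorem FewInside.anti [Finite V] {M : Memory V} {S T : Set (Edge H)} {f : Edge H} (h : S ⊆ T)
    (hf : FewInside a M T f) : FewInside a M S f :=
  lt_of_le_of_lt (Set.ncard_le_ncard (Set.inter_subset_inter_right _ (verts_mono h))
    (Set.toFinite _)) hf

theorem FewOutside.mono [Finite V] {M : Memory V} {S T : Set (Edge H)} {f : Edge H} (h : S ⊆ T)
    (hf : FewOutside a M S f) : FewOutside a M T f :=
  lt_of_le_of_lt (Set.ncard_le_ncard (Set.sdiff_subset_sdiff_right (verts_mono h))
    (Set.toFinite _)) hf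

theorem Sound.mono [Finite V] {B B' : Set (Edge H)} {M : Memory V} (h : Sound H k a B M)
    (hB : B ⊆ B') : Sound H k a B' M :=
  { h with
    unsafe_cases := fun f hf =>
      (h.unsafe_cases f hf).imp_right (Or.imp_right fun hn hf' => hn (hf'.anti hB)) }

theorem Sound.later_refl {B : Set (Edge H)} {M : Memory V} (h : Sound H k a B M) :
    Later H k a M M :=
  ⟨fun _ _ => rfl, fun _ _ => rfl, fun _ _ => rfl, fun _ _ => rfl,
    fun w hw hm => hw ((h.mark_uncolored w).2 hm), fun _ he => he⟩

/-- Vertices marked accepted keep this status and their sampled color, so in an edge that is not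
safe they are monochromatic in the record as well; too many of them would make the edge bad. -/
theorem Sound.unsafe_record {B : Set (Edge H)} {M : Memory V} (h : Sound H k a B M) {e : Set V}
    (he : M.IsUnsafe k a e) : M.record.IsUnsafe k a e := by
  have hm : Mono M.record.sample (M.record.acc e) := by
    have h1 : Mono M.color (M.acc e) := not_not.1 he.2.1
    have h2 : M.record.acc e ⊆ M.acc e := fun w hw => ⟨hw.1, h.accepted_of_mark w hw.2⟩
    refine (h1.subset h2).congr fun w hw => (h.color_eq w ?_).symm
    rw [hw.2]; exact (h2 hw).2
  refine ⟨fun w hw hu => he.1 w hw ((h.mark_uncolored w).2 hu), ?_, hm⟩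
  by_contra hc
  exact he.2.2 ⟨⟨not_lt.1 hc, hm⟩, he.2.1⟩

/-! ### Processing a single vertex -/

section Step

variable {B : Set (Edge H)} {M : Memory V} {w : V}

theorem colorVertex_status_ne (c : Bool) {x : V} (hx : x ≠ w) :
    (M.colorVertex H k a w c).status x = M.status x := by
  simp [Memory.colorVertex, hx]

theorem colorVertex_status (c : Bool) :
    (M.colorVertex H k a w c).status w = M.markFor H k a w := by
  simp [Memory.colorVertex]

theorem colorVertex_mark_ne (c : Bool) {x : V} (hx : x ≠ w) :
    (M.colorVertex H k a w c).record.mark x = M.record.mark x := by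
  simp [Memory.colorVertex, hx]

theorem colorVertex_mark (c : Bool) :
    (M.colorVertex H k a w c).record.mark w = M.markFor H k a w := by
  simp [Memory.colorVertex]

theorem colorVertex_color_ne (c : Bool) {x : V} (hx : x ≠ w) :
    (M.colorVertex H k a w c).color x = M.color x := by
  simp [Memory.colorVertex, hx]

theorem colorVertex_sample_ne (c : Bool) {x : V} (hx : x ≠ w) :
    (M.colorVertex H k a w c).record.sample x = M.record.sample x := by
  simp [Memory.colorVertex, hx]

theorem markFor_of_bad {e : Edge H} (hw : w ∈ e.1) (he : M.IsBad k a e.1) :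
    M.markFor H k a w = Status.troubled := by
  unfold Memory.markFor; rw [if_pos ⟨e, hw, he⟩]

/-- An uncolored vertex of a bad edge is marked troubled, so processing it does not alter the
accepted vertices of this edge. -/
theorem Sound.later_step (h : Sound H k a B M) (hw : M.status w = Status.uncolored) (c : Bool) :
    Later H k a M (M.colorVertex H k a w c) := by
  have hne : ∀ x, M.status x ≠ Status.uncolored → x ≠ w := by rintro x hx rfl; exact hx hw
  have hne' : ∀ x, M.record.mark x ≠ Status.uncolored → x ≠ w := by
    rintro x hx rfl; exact hx ((h.mark_uncolored x).1 hw)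
  refine ⟨fun x hx => colorVertex_status_ne c (hne x hx),
    fun x hx => colorVertex_color_ne c (hne x hx), fun x hx => colorVertex_mark_ne c (hne' x hx),
    fun x hx => colorVertex_sample_ne c (hne' x hx),
    fun x hx hm => hx ((h.mark_uncolored x).2 hm), fun e he => ?_⟩
  have hm : w ∈ e.1 → M.markFor H k a w = Status.troubled := fun hwe => markFor_of_bad hwe he
  have h1 : (M.colorVertex H k a w c).record.acc e.1 = M.record.acc e.1 := by
    ext x
    by_cases hx : x = w
    · subst hx
      constructor <;> rintro ⟨h1, h2⟩
      · rw [colorVertex_mark, hm h1] at h2; cases h2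
      · rw [(h.mark_uncolored x).1 hw] at h2; cases h2
    · simp [Record.acc, colorVertex_mark_ne c hx]
  have h2 : (M.colorVertex H k a w c).acc e.1 = M.acc e.1 := by
    ext x
    by_cases hx : x = w
    · subst hx
      constructor <;> rintro ⟨h1, h2⟩
      · rw [colorVertex_status, hm h1] at h2; cases h2
      · rw [hw] at h2; cases h2
    · simp [Memory.acc, colorVertex_status_ne c hx]
  refine ⟨⟨by rw [h1]; exact he.1.1, ?_⟩, ?_⟩
  · rw [h1]
    refine he.1.2.congr fun x hx => colorVertex_sample_ne c ?_
    rintro rfl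
    have := hx.2
    rw [(h.mark_uncolored x).1 hw] at this; cases this
  · unfold Memory.IsSafe
    rw [h2, not_not]
    refine (not_not.1 he.2).congr fun x hx => colorVertex_color_ne c ?_
    rintro rfl
    have := hx.2
    rw [hw] at this; cases this

theorem Sound.step [Finite V] (h : Sound H k a B M) (hw : M.status w = Status.uncolored)
    (c : Bool) :
    Sound H k a B (M.colorVertex H k a w c) := by
  have hL := h.later_step hw c
  have hT : ∀ e : Edge H, M.Untouched e.1 → (M.colorVertex H k a w c).Untouched e.1 := by
    intro e he x hx
    by_cases hxw : x = w
    · subst hxw; rw [colorVertex_status, colorVertex_mark]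
    · rw [colorVertex_status_ne c hxw, colorVertex_mark_ne c hxw]; exact he x hx
  -- An undetermined edge still carries its recorded statuses, and processing `w` writes the same
  -- mark in both places.
  have hU : ∀ e : Edge H, ¬ M.Determined e.1 → M.Untouched e.1 := fun e he => by
    by_contra hn; exact he (h.touched_determined e hn)
  refine ⟨?_, ?_, ?_, ?_, ?_, ?_, ?_, ?_⟩
  · intro x
    by_cases hx : x = w
    · subst hx; rw [colorVertex_status, colorVertex_mark]
    · rw [colorVertex_status_ne c hx, colorVertex_mark_ne c hx]; exact h.mark_uncolored x
  · intro x
    by_cases hx : x = w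
    · subst hx; rw [colorVertex_status, colorVertex_mark]; exact id
    · rw [colorVertex_status_ne c hx, colorVertex_mark_ne c hx]; exact h.accepted_of_mark x
  · intro x
    by_cases hx : x = w
    · subst hx; intro; simp [Memory.colorVertex]
    · rw [colorVertex_status_ne c hx, colorVertex_mark_ne c hx, colorVertex_color_ne c hx,
        colorVertex_sample_ne c hx]; exact h.color_eq x
  · intro x
    by_cases hx : x = w
    · subst hx
      rw [colorVertex_status]
      unfold Memory.markFor
      split_ifs with hb
      · obtain ⟨e, he, hb⟩ := hb
        exact fun _ => ⟨e, he, hL.bad e hb⟩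
      · intro h; cases h
    · rw [colorVertex_status_ne c hx]
      intro ht
      obtain ⟨e, he, hb⟩ := h.troubled_bad x ht
      exact ⟨e, he, hL.bad e hb⟩
  · intro e he
    have hs : ¬ M.IsSafe e.1 := fun hs => he (hL.safe hs)
    by_cases hwe : w ∈ e.1 ∧ M.markFor H k a w = Status.accepted
    · have hnb : ¬ M.IsBad k a e.1 := fun hb => by
        rw [markFor_of_bad hwe.1 hb] at hwe; cases hwe.2
      -- With `k - a` accepted marks the edge would already be bad and `w` would be troubled, so one
      -- more accepted vertex respects the bound.
      have hlt : (M.record.acc e.1).ncard + a < k := by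
        by_contra hc
        refine hnb ⟨⟨not_lt.1 hc, ?_⟩, hs⟩
        have h2 : M.record.acc e.1 ⊆ M.acc e.1 := fun w hw => ⟨hw.1, h.accepted_of_mark w hw.2⟩
        refine ((not_not.1 hs).subset h2).congr fun w hw => (h.color_eq w ?_).symm
        rw [hw.2]; exact (h2 hw).2
      have hsub : (M.colorVertex H k a w c).record.acc e.1 ⊆ insert w (M.record.acc e.1) := by
        intro x hx
        by_cases hxw : x = w
        · exact Or.inl hxw
        · exact Or.inr ⟨hx.1, by rw [← colorVertex_mark_ne c hxw]; exact hx.2⟩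
      have := (Set.ncard_le_ncard hsub (Set.toFinite _)).trans (Set.ncard_insert_le _ _)
      omega
    · have hsub : (M.colorVertex H k a w c).record.acc e.1 ⊆ M.record.acc e.1 := by
        intro x hx
        by_cases hxw : x = w
        · subst hxw
          exact absurd ⟨hx.1, by rw [← colorVertex_mark c]; exact hx.2⟩ hwe
        · exact ⟨hx.1, by rw [← colorVertex_mark_ne c hxw]; exact hx.2⟩
      have := Set.ncard_le_ncard hsub (Set.toFinite _)
      have := h.acc_card e hs
      omega
  · intro e he
    by_cases hd : M.Determined e.1
    · exact hT e (h.bad_untouched e (hL.bad_of_determined hd he))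
    · exact hT e (hU e hd)
  · intro e he
    exact hL.determined (h.touched_determined e fun hu => he (hT e hu))
  · intro f hf
    by_cases hd : M.Determined f.1
    · have hfull := hd.full_of_not_safe fun hs => hf.2.1 (hL.safe hs)
      rcases h.unsafe_cases f ((hL.unsafe_iff hfull).1 hf) with h1 | h1 | h1
      · exact Or.inl (hT f h1)
      · exact Or.inr (Or.inl (h1.later hL hfull))
      · exact Or.inr (Or.inr fun h2 => h1 ((hL.fewInside_iff hfull).1 h2))
    · exact Or.inl (hT f (hU f hd))

theorem Progress.sound_later [Finite V] {M M' : Memory V} (h : Progress H k a M M')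
    (hS : Sound H k a B M) :
    Sound H k a B M' ∧ Later H k a M M' := by
  induction h with
  | refl => exact ⟨hS, hS.later_refl⟩
  | tail _ h ih =>
    obtain ⟨w, c, hw, rfl⟩ := h
    exact ⟨ih.1.step hw c, ih.2.trans (ih.1.later_step hw c)⟩

end Step

theorem DetermineEdge.progress {g : Edge H} {M M' : Memory V} (h : DetermineEdge H k a g M M') :
    Progress H k a M M' ∧ M'.Determined g.1 := by
  induction h with
  | done h => exact ⟨Relation.ReflTransGen.refl, h⟩
  | step w c hs hw hu _ ih => exact ⟨Relation.ReflTransGen.head ⟨w, c, hu, rfl⟩ ih.1, ih.2⟩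

theorem Inspect.progress {S : Set (Edge H)} {M M' : Memory V} (h : Inspect k a S M M') :
    Progress H k a M M' := by
  induction h with
  | refl => exact Relation.ReflTransGen.refl
  | tail _ h ih =>
    obtain ⟨_, _, _, _, hd⟩ := h
    exact ih.trans hd.progress.1

/-! ### Exploration of bad-components -/

/-- `X` is the set of explored edges, `S` is a set of bad edges whose neighbours are explored, `Q` is
a set of further bad edges, and the remaining explored edges are settled. -/
structure Explo (k a : ℕ) (M : Memory V) (X S Q : Set (Edge H)) : Prop where
  sub : S ∪ Q ⊆ X
  bad : ∀ s ∈ S ∪ Q, M.IsBad k a s.1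
  nbrs : ∀ s ∈ S, nbrs s ⊆ X
  known : ∀ g ∈ X, g ∈ S ∪ Q ∨ M.Settled k a g.1

theorem Explo.later {M M' : Memory V} {X S Q : Set (Edge H)} (h : Explo k a M X S Q)
    (hL : Later H k a M M') : Explo k a M' X S Q :=
  ⟨h.sub, fun s hs => hL.bad s (h.bad s hs), h.nbrs, fun g hg => (h.known g hg).imp_right hL.settled⟩

/-- The closure of `T₀` under adjacency in `T` contains `T`. -/
def Fed (T₀ T : Set (Edge H)) : Prop :=
  ∀ Y : Set (Edge H), T₀ ⊆ Y → (∀ s ∈ Y, s ∈ T → ∀ t ∈ T, t ∈ nbrs s → t ∈ Y) → T ⊆ Y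

/-- What an exploring procedure changes; `Q` is the set of bad edges it starts from. -/
structure Trace (k a : ℕ) (Q : Set (Edge H)) (W W' : Work H) : Prop where
  progress : Progress H k a W.mem W'.mem
  explored : W.explored ⊆ W'.explored
  bad : W.bad ⊆ W'.bad
  bad_new : ∀ g ∈ W'.bad, g ∈ W.bad ∨ g ∈ Q ∨ (g ∉ W.explored ∧ W'.mem.Determined g.1)
  uns : W.uns ⊆ W'.uns
  uns_new : ∀ g ∈ W'.uns, g ∈ W.uns ∨ (g ∉ W.explored ∧ g ∈ W'.explored ∧
    W'.mem.IsUnsafe k a g.1 ∧ ∃ c ∈ W'.bad, g ∈ nbrs c)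
  uns_all : ∀ g ∈ W'.explored, g ∈ W.explored ∨ (W'.mem.IsUnsafe k a g.1 → g ∈ W'.uns)

theorem Explo.not_isUnsafe {M : Memory V} {X S Q : Set (Edge H)} (h : Explo k a M X S Q)
    {g : Edge H}
    (hg : g ∈ S ∪ Q) : ¬ M.IsUnsafe k a g.1 := fun hu => hu.2.2 (h.bad g hg)

theorem Explo.unsafe_of_later {M M' : Memory V} {X S Q : Set (Edge H)} (h : Explo k a M X S Q)
    (hL : Later H k a M M') {g : Edge H} (hg : g ∈ X) (hu : M'.IsUnsafe k a g.1) :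
    M.IsUnsafe k a g.1 := by
  rcases h.known g hg with h1 | h1
  · exact absurd hu ((h.later hL).not_isUnsafe h1)
  · exact hL.unsafe_of_settled h1 hu

theorem Trace.refl (W : Work H) (Q : Set (Edge H)) : Trace k a Q W W :=
  ⟨Relation.ReflTransGen.refl, subset_rfl, subset_rfl, fun _ h => Or.inl h, subset_rfl,
    fun _ h => Or.inl h, fun _ h => Or.inl h⟩

section

variable {B : Set (Edge H)}

/-- `Explo` at the intermediate state makes `uns_all` compose: an edge explored by then and unsafe
at the end was already unsafe at that state, hence collected. -/
theorem Trace.trans [Finite V] {Q Q₁ S P : Set (Edge H)} {W W₁ W₂ : Work H} (h₁ : Trace k a Q W W₁)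
    (h₂ : Trace k a Q₁ W₁ W₂) (hS : Sound H k a B W₁.mem)
    (hE : Explo k a W₁.mem W₁.explored S P)
    (hQ : ∀ q ∈ Q₁, q ∈ Q ∨ (q ∉ W.explored ∧ W₁.mem.Determined q.1)) : Trace k a Q W W₂ where
  progress := h₁.progress.trans h₂.progress
  explored := h₁.explored.trans h₂.explored
  bad := h₁.bad.trans h₂.bad
  bad_new g hg := by
    have hL := (h₂.progress.sound_later hS).2
    rcases h₂.bad_new g hg with h | h | h
    · exact (h₁.bad_new g h).imp_right (Or.imp_right fun h => ⟨h.1, hL.determined h.2⟩)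
    · exact Or.inr ((hQ g h).imp_right fun h => ⟨h.1, hL.determined h.2⟩)
    · exact Or.inr (Or.inr ⟨fun h' => h.1 (h₁.explored h'), h.2⟩)
  uns := h₁.uns.trans h₂.uns
  uns_new g hg := by
    have hL := (h₂.progress.sound_later hS).2
    rcases h₂.uns_new g hg with h | h
    · refine (h₁.uns_new g h).imp_right fun ⟨h1, h2, h3, c, hc, h4⟩ =>
        ⟨h1, h₂.explored h2, hL.isUnsafe h3, c, h₂.bad hc, h4⟩
    · exact Or.inr ⟨fun h' => h.1 (h₁.explored h'), h.2⟩
  uns_all g hg := by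
    have hL := (h₂.progress.sound_later hS).2
    rcases h₂.uns_all g hg with h | h
    · refine (h₁.uns_all g h).imp_right fun h1 hu => h₂.uns (h1 (hE.unsafe_of_later hL h hu))
    · exact Or.inr h

/-- The edge `f` under scan stays among the pending edges of `Explo`, since its neighbourhood is
explored only when the whole list has been processed. -/
theorem ScanBad.spec [Finite V] {l : List (Edge H)} {W W' : Work H} {Q Q' : Set (Edge H)}
    (h : ScanBad k a l W Q W' Q') {f : Edge H} {S : Set (Edge H)} (hf : f ∈ W.bad)
    (hl : ∀ g ∈ l, g ∈ nbrs f) (hS : Sound H k a B W.mem)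
    (hE : Explo k a W.mem W.explored S (insert f Q)) :
    Sound H k a B W'.mem ∧ Explo k a W'.mem W'.explored S (insert f Q') ∧ W'.bad = W.bad ∧
      Trace k a ∅ W W' ∧ Q ⊆ Q' ∧
      (∀ q ∈ Q', q ∈ Q ∨ (q ∈ nbrs f ∧ q ∉ W.explored ∧ W'.mem.Determined q.1)) ∧
      ∀ g ∈ l, g ∈ W'.explored := by
  induction h with
  | nil W Q => exact ⟨hS, hE, rfl, Trace.refl W _, subset_rfl, fun q h => Or.inl h, by simp⟩
  | @skip g l W W' Q Q' hg h ih =>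
    obtain ⟨h1, h2, h3, h4, h5, h6, h7⟩ := ih hf (fun g hg => hl g (List.mem_cons_of_mem _ hg)) hS hE
    refine ⟨h1, h2, h3, h4, h5, h6, fun x hx => ?_⟩
    rcases List.mem_cons.1 hx with rfl | hx
    · exact h4.explored hg
    · exact h7 x hx
  | @visit g l W W' Q Q' M hg hd h ih =>
    have hP := hd.progress
    obtain ⟨hS₁, hL₁⟩ := hP.1.sound_later hS
    have hE₁ : Explo k a M (insert g W.explored) S
        (insert f (Q ∪ {x | x = g ∧ M.IsBad k a g.1})) := by
      have hE' := hE.later hL₁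
      refine ⟨?_, ?_, fun s hs => (hE'.nbrs s hs).trans (Set.subset_insert _ _), ?_⟩
      · rintro x (hx | rfl | hx | ⟨rfl, hx⟩)
        · exact Or.inr (hE'.sub (Or.inl hx))
        · exact Or.inr (hE'.sub (Or.inr (Or.inl rfl)))
        · exact Or.inr (hE'.sub (Or.inr (Or.inr hx)))
        · exact Or.inl rfl
      · rintro x (hx | rfl | hx | ⟨rfl, hx⟩)
        · exact hE'.bad x (Or.inl hx)
        · exact hE'.bad x (Or.inr (Or.inl rfl))
        · exact hE'.bad x (Or.inr (Or.inr hx))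
        · exact hx
      · rintro x (rfl | hx)
        · by_cases hb : M.IsBad k a x.1
          · exact Or.inl (Or.inr (Or.inr (Or.inr ⟨rfl, hb⟩)))
          · exact Or.inr ⟨hP.2, hb⟩
        · rcases hE'.known x hx with (h1 | h1 | h1) | h1
          · exact Or.inl (Or.inl h1)
          · exact Or.inl (Or.inr (Or.inl h1))
          · exact Or.inl (Or.inr (Or.inr (Or.inl h1)))
          · exact Or.inr h1
    obtain ⟨h1, h2, h3, h4, h5, h6, h7⟩ :=
      ih hf (fun g hg => hl g (List.mem_cons_of_mem _ hg)) hS₁ hE₁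
    have hL₂ := (h4.progress.sound_later hS₁).2
    have hT : Trace k a ∅ W ⟨M, insert g W.explored, W.bad,
        W.uns ∪ {x | x = g ∧ M.IsUnsafe k a g.1}⟩ := by
      refine ⟨hP.1, Set.subset_insert _ _, subset_rfl, fun _ h => Or.inl h,
        Set.subset_union_left, ?_, ?_⟩
      · rintro x (hx | ⟨rfl, hx⟩)
        · exact Or.inl hx
        · exact Or.inr ⟨hg, Or.inl rfl, hx, f, hf, hl _ List.mem_cons_self⟩
      · rintro x (rfl | hx)
        · exact Or.inr fun hu => Or.inr ⟨rfl, hu⟩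
        · exact Or.inl hx
    refine ⟨h1, h2, h3, hT.trans h4 hS₁ hE₁ (by simp), Set.subset_union_left.trans h5, ?_, ?_⟩
    · intro q hq
      rcases h6 q hq with (h | ⟨rfl, h⟩) | ⟨h8, h9, h10⟩
      · exact Or.inl h
      · exact Or.inr ⟨hl _ List.mem_cons_self, hg, hL₂.determined hP.2⟩
      · exact Or.inr ⟨h8, fun h' => h9 (Or.inr h'), h10⟩
    · intro x hx
      rcases List.mem_cons.1 hx with rfl | hx
      · exact h4.explored (Or.inl rfl)
      · exact h7 x hx

/-- The parameter `S₀` stands for bad edges that were expanded before and are kept outside `W.bad`;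
a search needs it because it collects the result of each expansion in empty sets. -/
theorem ExpandBadLoop.spec [Finite V] {W W' : Work H} {Q : Set (Edge H)}
    (h : ExpandBadLoop k a Q W W')
    {S₀ : Set (Edge H)} (hS : Sound H k a B W.mem)
    (hE : Explo k a W.mem W.explored (S₀ ∪ W.bad) Q) :
    Sound H k a B W'.mem ∧ Explo k a W'.mem W'.explored (S₀ ∪ W'.bad) ∅ ∧ Trace k a Q W W' ∧
      Q ⊆ W'.bad ∧ Fed (W.bad ∪ Q) W'.bad := by
  induction h with
  | done W =>
    exact ⟨hS, hE, Trace.refl W _, Set.empty_subset _, fun Y hY _ => Set.subset_union_left.trans hY⟩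
  | @step f l Q Q₁ W W₁ W₂ hf hl hs h ih =>
    have hE₀ : Explo k a W.mem W.explored (S₀ ∪ W.bad) (insert f (Q \ {f})) := by
      rwa [Set.insert_sdiff_singleton, Set.insert_eq_of_mem hf]
    obtain ⟨h1, h2, h3, h4, h5, h6, h7⟩ := hs.spec (S := S₀ ∪ W.bad) (Or.inl rfl)
      (fun g hg => (hl.2 g).1 hg) hS hE₀
    simp only at h3 h4 h6
    have hE₁ : Explo k a W₁.mem W₁.explored (S₀ ∪ W₁.bad) Q₁ := by
      have hu : S₀ ∪ W₁.bad ∪ Q₁ = S₀ ∪ W.bad ∪ insert f Q₁ := by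
        rw [h3]; ext x; simp only [Set.mem_union, Set.mem_insert_iff]; tauto
      refine ⟨hu ▸ h2.sub, hu ▸ h2.bad, ?_, hu ▸ h2.known⟩
      rintro s (hs | hs)
      · exact h2.nbrs s (Or.inl hs)
      · rw [h3] at hs
        rcases hs with rfl | hs
        · exact fun g hg => h7 g ((hl.2 g).2 hg)
        · exact h2.nbrs s (Or.inr hs)
    obtain ⟨g1, g2, g3, g4, g5⟩ := ih h1 hE₁
    have hT : Trace k a Q W W₁ := by
      refine ⟨h4.progress, h4.explored, (Set.subset_insert _ _).trans h4.bad, ?_, h4.uns, h4.uns_new,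
        h4.uns_all⟩
      intro g hg
      rw [h3] at hg
      rcases hg with rfl | hg
      · exact Or.inr (Or.inl hf)
      · exact Or.inl hg
    have hbad : insert f W.bad ⊆ W₂.bad := by rw [← h3]; exact g3.bad
    refine ⟨g1, g2, hT.trans g3 h1 hE₁ ?_, ?_, ?_⟩
    · intro q hq
      exact (h6 q hq).imp (fun h => h.1) fun h => h.2
    · intro q hq
      by_cases hqf : q = f
      · subst hqf; exact hbad (Or.inl rfl)
      · exact g4 (h5 ⟨hq, hqf⟩)
    · intro Y hY hc
      refine g5 Y ?_ hc
      have hfY : f ∈ Y := hY (Or.inr hf)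
      rintro x (hx | hx)
      · rw [h3] at hx
        rcases hx with rfl | hx
        · exact hfY
        · exact hY (Or.inl hx)
      · rcases h6 x hx with h | h
        · exact hY (Or.inr h.1)
        · exact hc f hfY (hbad (Or.inl rfl)) x (g4 hx) h.1

theorem ExpandBad.spec [Finite V] {W W' : Work H} {e : Edge H} (h : ExpandBad k a e W W')
    {S₀ : Set (Edge H)} (hS : Sound H k a B W.mem) (he : W.mem.IsBad k a e.1)
    (hE : Explo k a W.mem W.explored (S₀ ∪ W.bad) ∅) :
    Sound H k a B W'.mem ∧ Explo k a W'.mem W'.explored (S₀ ∪ W'.bad) ∅ ∧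
      (∀ g ∈ W'.bad, g ∈ W.bad ∨ g = e ∨ (g ∉ W.explored ∧ W'.mem.Determined g.1)) ∧
      Trace k a {e} ⟨W.mem, insert e W.explored, W.bad, W.uns⟩ W' ∧
      e ∈ W'.bad ∧ Fed (insert e W.bad) W'.bad := by
  have hE' : Explo k a W.mem (insert e W.explored) (S₀ ∪ W.bad) {e} := by
    refine ⟨?_, ?_, fun s hs => (hE.nbrs s hs).trans (Set.subset_insert _ _), ?_⟩
    · rintro x (hx | rfl)
      · exact Or.inr (hE.sub (Or.inl hx))
      · exact Or.inl rfl
    · rintro x (hx | rfl)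
      · exact hE.bad x (Or.inl hx)
      · exact he
    · rintro x (rfl | hx)
      · exact Or.inl (Or.inr rfl)
      · rcases hE.known x hx with (h1 | h1) | h1
        · exact Or.inl (Or.inl h1)
        · exact absurd h1 (Set.notMem_empty _)
        · exact Or.inr h1
  obtain ⟨h1, h2, h3, h4, h5⟩ := ExpandBadLoop.spec h (S₀ := S₀) hS hE'
  refine ⟨h1, h2, fun g hg => ?_, h3, h4 rfl, ?_⟩
  · rcases h3.bad_new g hg with h | h | h
    · exact Or.inl h
    · exact Or.inr (Or.inl h)
    · exact Or.inr (Or.inr ⟨fun h' => h.1 (Or.inr h'), h.2⟩)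
  · intro Y hY hc
    refine h5 Y ?_ hc
    rintro x (hx | rfl)
    · exact hY (Or.inr hx)
    · exact hY (Or.inl rfl)

/-- Edges found not to be bad are not flagged as explored here, so the claim about the members of
`l` cannot be read off from `Explo` at the end. -/
theorem ScanVia.spec [Finite V] {l : List (Edge H)} {W W' : Work H} (h : ScanVia k a l W W')
    {f : Edge H} {S₀ : Set (Edge H)} (hl : ∀ g ∈ l, g ∈ nbrs f) (hS : Sound H k a B W.mem)
    (hE : Explo k a W.mem W.explored (S₀ ∪ W.bad) ∅) :
    Sound H k a B W'.mem ∧ Explo k a W'.mem W'.explored (S₀ ∪ W'.bad) ∅ ∧ Trace k a ∅ W W' ∧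
      (∀ g ∈ l, g ∈ S₀ ∪ W'.bad ∨ W'.mem.Settled k a g.1) ∧
      Fed (W.bad ∪ (nbrs f ∩ W'.bad)) W'.bad := by
  induction h with
  | nil W =>
    exact ⟨hS, hE, Trace.refl W _, by simp, fun Y hY _ => Set.subset_union_left.trans hY⟩
  | @skip g l W W' hg h ih =>
    obtain ⟨h1, h2, h3, h4, h5⟩ := ih (fun g hg => hl g (List.mem_cons_of_mem _ hg)) hS hE
    refine ⟨h1, h2, h3, fun x hx => ?_, h5⟩
    rcases List.mem_cons.1 hx with rfl | hx
    · simpa using h2.known x (h3.explored hg)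
    · exact h4 x hx
  | @notBad g l W W' M hg hd hb h ih =>
    have hP := hd.progress
    obtain ⟨hS₁, hL₁⟩ := hP.1.sound_later hS
    obtain ⟨h1, h2, h3, h4, h5⟩ := ih (fun g hg => hl g (List.mem_cons_of_mem _ hg)) hS₁
      (hE.later hL₁)
    have hL₂ := (h3.progress.sound_later hS₁).2
    refine ⟨h1, h2, ⟨hP.1.trans h3.progress, h3.explored, h3.bad, h3.bad_new, h3.uns, h3.uns_new,
      h3.uns_all⟩, fun x hx => ?_, h5⟩
    rcases List.mem_cons.1 hx with rfl | hx
    · exact Or.inr (hL₂.settled ⟨hP.2, hb⟩)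
    · exact h4 x hx
  | @bad g l W W₁ W' M hg hd hb he h ih =>
    have hP := hd.progress
    obtain ⟨hS₁, hL₁⟩ := hP.1.sound_later hS
    obtain ⟨g1, g2, g3, g4, g5, g6⟩ := he.spec (S₀ := S₀) hS₁ hb (hE.later hL₁)
    obtain ⟨h1, h2, h3, h4, h5⟩ := ih (fun g hg => hl g (List.mem_cons_of_mem _ hg)) g1 g2
    have hL₂ := (g4.progress.sound_later hS₁).2
    have hT : Trace k a ∅ W W₁ := by
      refine ⟨hP.1.trans g4.progress, (Set.subset_insert _ _).trans g4.explored, g4.bad, ?_, g4.uns,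
        ?_, ?_⟩
      · intro x hx
        rcases g3 x hx with h | rfl | h
        · exact Or.inl h
        · exact Or.inr (Or.inr ⟨hg, hL₂.determined hP.2⟩)
        · exact Or.inr (Or.inr h)
      · intro x hx
        exact (g4.uns_new x hx).imp_right fun h => ⟨fun h' => h.1 (Or.inr h'), h.2⟩
      · intro x hx
        rcases g4.uns_all x hx with (rfl | h) | h
        · exact Or.inr fun hu => absurd hu (g2.not_isUnsafe (Or.inl (Or.inr g5)))
        · exact Or.inl h
        · exact Or.inr h
    refine ⟨h1, h2, hT.trans h3 g1 g2 (by simp), fun x hx => ?_, ?_⟩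
    · rcases List.mem_cons.1 hx with rfl | hx
      · exact Or.inl (Or.inr (h3.bad g5))
      · exact h4 x hx
    · intro Y hY hc
      refine h5 Y ?_ hc
      refine Set.union_subset (g6 Y ?_ ?_) (Set.subset_union_right.trans hY)
      · rintro x (rfl | hx)
        · exact hY (Or.inr ⟨hl _ List.mem_cons_self, h3.bad g5⟩)
        · exact hY (Or.inl hx)
      · exact fun s hs hs' t ht hst => hc s hs (h3.bad hs') t (h3.bad ht) hst

theorem ExpandVia.spec [Finite V] {W W' : Work H} {f : Edge H} (h : ExpandVia k a f W W')
    {S₀ : Set (Edge H)} (hS : Sound H k a B W.mem)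
    (hE : Explo k a W.mem W.explored (S₀ ∪ W.bad) ∅) :
    Sound H k a B W'.mem ∧ Explo k a W'.mem W'.explored (S₀ ∪ W'.bad) ∅ ∧ Trace k a ∅ W W' ∧
      (∀ g ∈ nbrs f, g ∈ S₀ ∪ W'.bad ∨ W'.mem.Settled k a g.1) ∧
      Fed (W.bad ∪ (nbrs f ∩ W'.bad)) W'.bad := by
  obtain ⟨l, hl, hs⟩ := h
  obtain ⟨h1, h2, h3, h4, h5⟩ := hs.spec (fun g hg => (hl.2 g).1 hg) hS hE
  exact ⟨h1, h2, h3, fun g hg => h4 g ((hl.2 g).2 hg), h5⟩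

end

/-! ### Construction of witness structures -/

namespace WitnessStructure

/-- The arcs of the structure obtained by joining two structures with an arc. -/
def joinArc {α β : Type} (r : α → α → Prop) (s : β → β → Prop) (x : α) (y : β) :
    α ⊕ β → α ⊕ β → Prop
  | .inl u, .inl v => r u v
  | .inr u, .inr v => s u v
  | .inl u, .inr v => u = x ∧ v = y
  | .inr _, .inl _ => False

/-- Two graphs joined by an edge. -/
def joinGraph {α β : Type} (G : SimpleGraph α) (G' : SimpleGraph β) (x : α) (y : β) :
    SimpleGraph (α ⊕ β) :=
  (G ⊕g G') ⊔ SimpleGraph.edge (Sum.inl x) (Sum.inr y)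

section joinGraph

variable {α β : Type} {G : SimpleGraph α} {G' : SimpleGraph β} {x u v : α} {y u' v' : β}

theorem joinGraph_inl : (joinGraph G G' x y).Adj (.inl u) (.inl v) ↔ G.Adj u v := by
  simp [joinGraph, SimpleGraph.edge_adj]

theorem joinGraph_inr : (joinGraph G G' x y).Adj (.inr u') (.inr v') ↔ G'.Adj u' v' := by
  simp [joinGraph, SimpleGraph.edge_adj]

theorem joinGraph_inl_inr : (joinGraph G G' x y).Adj (.inl u) (.inr v') ↔ u = x ∧ v' = y := by
  simp [joinGraph, SimpleGraph.edge_adj]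

theorem joinGraph_inr_inl : (joinGraph G G' x y).Adj (.inr v') (.inl u) ↔ u = x ∧ v' = y := by
  rw [SimpleGraph.adj_comm, joinGraph_inl_inr]

/-- A finite graph is a tree exactly when it is connected and has one edge fewer than vertices; the
new edge connects the two summands and restores this count. -/
theorem isTree_join [Finite α] [Finite β] (hG : G.IsTree) (hG' : G'.IsTree) (x : α) (y : β) :
    (joinGraph G G' x y).IsTree := by
  unfold joinGraph
  rw [SimpleGraph.isTree_iff_connected_and_card] at *
  refine ⟨hG.1.sum_sup_edge hG'.1, ?_⟩
  have h1 : ((G ⊕g G') ⊔ SimpleGraph.edge (Sum.inl x) (Sum.inr y)).edgeSet =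
      insert s(Sum.inl x, Sum.inr y) (G ⊕g G').edgeSet := by
    ext e
    rw [SimpleGraph.edgeSet_sup, SimpleGraph.edgeSet_edge]
    simp only [Set.mem_union, Set.mem_sdiff, Set.mem_singleton_iff, Sym2.mem_diagSet,
      Set.mem_insert_iff]
    refine ⟨fun h => h.symm.imp_left fun h => h.1, fun h => h.symm.imp_right fun h => ⟨h, ?_⟩⟩
    rw [h]; simp
  have h2 : s(Sum.inl x, Sum.inr y) ∉ (G ⊕g G').edgeSet := by
    rw [SimpleGraph.mem_edgeSet]; simp
  have h3 : Nat.card (G ⊕g G').edgeSet = Nat.card G.edgeSet + Nat.card G'.edgeSet := by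
    rw [Nat.card_congr SimpleGraph.edgeSetSumEquiv, Nat.card_sum]
  rw [Nat.card_coe_set_eq, h1, Set.ncard_insert_of_notMem h2 (Set.toFinite _),
    ← Nat.card_coe_set_eq, h3, Nat.card_sum]
  omega

end joinGraph

/-- Two structures joined by an arc from `x` to `y`. -/
def join (τ σ : WitnessStructure H) (x : τ.Node) (y : σ.Node)
    (hxy : (lineGraph H).Adj (τ.hom x) (σ.hom y)) : WitnessStructure H where
  Node := τ.Node ⊕ σ.Node
  finite := @Finite.instSum _ _ τ.finite σ.finite
  tree := joinGraph τ.tree σ.tree x y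
  isTree := @isTree_join _ _ _ _ τ.finite σ.finite τ.isTree σ.isTree x y
  hom := ⟨Sum.elim τ.hom σ.hom, by
    rintro (u | u) (v | v) huv
    · exact τ.hom.map_rel (joinGraph_inl.1 huv)
    · obtain ⟨rfl, rfl⟩ := joinGraph_inl_inr.1 huv
      exact hxy
    · obtain ⟨rfl, rfl⟩ := joinGraph_inr_inl.1 huv
      exact hxy.symm
    · exact σ.hom.map_rel (joinGraph_inr.1 huv)⟩
  label := Sum.elim τ.label σ.label
  arc := joinArc τ.arc σ.arc x y
  adj_of_arc := by
    rintro (u | u) (v | v) huv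
    · exact joinGraph_inl.2 (τ.adj_of_arc u v huv)
    · exact joinGraph_inl_inr.2 huv
    · exact huv.elim
    · exact joinGraph_inr.2 (σ.adj_of_arc u v huv)
  arc_iff_not := by
    rintro (u | u) (v | v) huv
    · exact τ.arc_iff_not u v (joinGraph_inl.1 huv)
    · exact iff_of_true (joinGraph_inl_inr.1 huv) id
    · exact iff_of_false id (not_not.2 (joinGraph_inr_inl.1 huv))
    · exact σ.arc_iff_not u v (joinGraph_inr.1 huv)

/-- The structure with one node. -/
def single (e : Edge H) (ℓ : Label) : WitnessStructure H where
  Node := Unit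
  finite := inferInstance
  tree := ⊥
  isTree := .of_subsingleton
  hom := ⟨fun _ => e, fun h => h.elim⟩
  label _ := ℓ
  arc _ _ := False
  adj_of_arc _ _ h := h.elim
  arc_iff_not _ _ h := h.elim

/-- `d` satisfies the recursion that determines the depth. -/
structure IsDepth (τ : WitnessStructure H) (d : τ.Node → ℕ) : Prop where
  root : ∀ x, τ.IsRoot x → d x = 0
  lt : ∀ x y, τ.arc x y → d y < d x
  step : ∀ x, ¬ τ.IsRoot x → ∃ z, τ.arc x z ∧ d x = d z + 1

/-- Strict decrease along arcs bounds the length of every directed path from `x` by `d x`, and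
following the arcs supplied by `step` attains this bound. -/
theorem IsDepth.depth_eq {τ : WitnessStructure H} {d : τ.Node → ℕ} (h : τ.IsDepth d)
    (x : τ.Node) : τ.depth x = d x := by
  have h1 : ∀ n x, d x = n → ∃ r, τ.IsRoot r ∧ τ.DirPath n x r := by
    intro n
    induction n with
    | zero =>
      intro x hx
      refine ⟨x, fun y hy => ?_, fun _ => x, rfl, rfl, by simp⟩
      have := h.lt x y hy
      omega
    | succ n ih =>
      intro x hx
      obtain ⟨z, hz, hd⟩ := h.step x fun hr => by rw [h.root x hr] at hx; omega
      obtain ⟨r, hr, p, hp0, hpn, hp⟩ := ih z (by omega)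
      refine ⟨r, hr, fun i => if i = 0 then x else p (i - 1), by simp, by simpa using hpn, ?_⟩
      intro i hi
      rcases i with _ | i
      · simpa [hp0] using hz
      · simpa using hp i (by omega)
  have h2 : ∀ n (x r : τ.Node), τ.DirPath n x r → n ≤ d x := by
    rintro n x r ⟨p, hp0, -, hp⟩
    have : ∀ i ≤ n, i + d (p i) ≤ d x := by
      intro i
      induction i with
      | zero => intro; simp [hp0]
      | succ i ih =>
        intro hi
        have := h.lt _ _ (hp i (by omega))
        have := ih (by omega)
        omega
    have := this n le_rfl
    omega
  refine le_antisymm (csSup_le ⟨_, h1 _ x rfl⟩ ?_) (le_csSup ⟨d x, ?_⟩ (h1 _ x rfl))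
  · rintro n ⟨r, -, hn⟩; exact h2 n x r hn
  · rintro n ⟨r, -, hn⟩; exact h2 n x r hn

theorem isDepth_single (e : Edge H) (ℓ : Label) : (single e ℓ).IsDepth fun _ => 0 :=
  ⟨fun _ _ => rfl, fun _ _ h => h.elim, fun _ h => absurd (fun _ h => h) h⟩

/-- Since `d x` is positive, `x` was not a root, and a path through the new arc is not longer than
`d x`. Hence joining along an arc from a larger value to a smaller one changes no depth on either
side. -/
theorem isDepth_join {τ σ : WitnessStructure H} {x : τ.Node} {y : σ.Node}
    (hxy : (lineGraph H).Adj (τ.hom x) (σ.hom y)) {d : τ.Node → ℕ} {d' : σ.Node → ℕ}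
    (hd : τ.IsDepth d) (hd' : σ.IsDepth d') (hlt : d' y < d x) :
    (join τ σ x y hxy).IsDepth (Sum.elim d d') where
  root := by
    rintro (u | u) hu
    · exact hd.root u fun v hv => hu (.inl v) hv
    · exact hd'.root u fun v hv => hu (.inr v) hv
  lt := by
    rintro (u | u) (v | v) huv
    · exact hd.lt u v huv
    · obtain ⟨rfl, rfl⟩ := huv; exact hlt
    · exact huv.elim
    · exact hd'.lt u v huv
  step := by
    rintro (u | u) hu
    · by_cases hr : τ.IsRoot u
      · refine absurd ?_ hu
        rintro (v | v) huv
        · exact hr v huv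
        · obtain ⟨rfl, rfl⟩ := huv
          rw [hd.root u hr] at hlt
          omega
      · obtain ⟨z, hz, h⟩ := hd.step u hr
        exact ⟨.inl z, hz, h⟩
    · by_cases hr : σ.IsRoot u
      · refine absurd ?_ hu
        rintro (v | v) huv
        · exact huv.elim
        · exact hr v huv
      · obtain ⟨z, hz, h⟩ := hd'.step u hr
        exact ⟨.inr z, hz, h⟩

theorem isDepth_leaf {σ : WitnessStructure H} {e : Edge H} {ℓ : Label} {y : σ.Node}
    (hxy : (lineGraph H).Adj e (σ.hom y)) {d' : σ.Node → ℕ}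
    (hd' : σ.IsDepth d') :
    (join (single e ℓ) σ () y hxy).IsDepth (Sum.elim (fun _ => d' y + 1) d') where
  root := by
    rintro (u | u) hu
    · exact absurd ⟨rfl, rfl⟩ (hu (.inr y))
    · exact hd'.root u fun v hv => hu (.inr v) hv
  lt := by
    rintro (u | u) (v | v) huv
    · exact huv.elim
    · obtain ⟨-, rfl⟩ := huv; exact Nat.lt_succ_self _
    · exact huv.elim
    · exact hd'.lt u v huv
  step := by
    rintro (u | u) hu
    · exact ⟨.inr y, ⟨rfl, rfl⟩, rfl⟩
    · by_cases hr : σ.IsRoot u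
      · refine absurd ?_ hu
        rintro (v | v) huv
        · exact huv.elim
        · exact hr v huv
      · obtain ⟨z, hz, h⟩ := hd'.step u hr
        exact ⟨.inr z, hz, h⟩

end WitnessStructure

/-- The contribution of a node to the balance. -/
def Label.weight : Label → ℤ
  | .M => 2
  | .B => 1
  | .Bin => 1
  | .Bout => 1
  | .U => 0
  | .E => -1

namespace WitnessStructure

theorem count_join {τ σ : WitnessStructure H} {x : τ.Node} {y : σ.Node}
    (hxy : (lineGraph H).Adj (τ.hom x) (σ.hom y)) (ℓ : Label) :
    (join τ σ x y hxy).count ℓ = τ.count ℓ + σ.count ℓ := by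
  have h : {u : τ.Node ⊕ σ.Node | Sum.elim τ.label σ.label u = ℓ} =
      (Sum.inl '' {u | τ.label u = ℓ}) ∪ (Sum.inr '' {u | σ.label u = ℓ}) := by
    ext (u | u) <;> simp
  have := τ.finite
  have := σ.finite
  change {u : τ.Node ⊕ σ.Node | Sum.elim τ.label σ.label u = ℓ}.ncard = _
  rw [h, Set.ncard_union_eq ?_ (Set.toFinite _) (Set.toFinite _),
    Set.ncard_image_of_injective _ Sum.inl_injective,
    Set.ncard_image_of_injective _ Sum.inr_injective]
  · rfl
  · rw [Set.disjoint_left]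
    rintro _ ⟨u, -, rfl⟩ ⟨v, -, h⟩
    cases h

theorem balance_join {τ σ : WitnessStructure H} {x : τ.Node} {y : σ.Node}
    (hxy : (lineGraph H).Adj (τ.hom x) (σ.hom y)) :
    (join τ σ x y hxy).balance = τ.balance + σ.balance := by
  unfold balance
  simp only [count_join]
  push_cast
  ring

theorem count_single (e : Edge H) (ℓ : Label) : (single e ℓ).count ℓ = 1 := by
  change {_x : Unit | ℓ = ℓ}.ncard = 1
  simp

theorem count_single_ne (e : Edge H) {ℓ ℓ' : Label} (h : ℓ ≠ ℓ') : (single e ℓ).count ℓ' = 0 := by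
  change {_x : Unit | ℓ = ℓ'}.ncard = 0
  simp [h]

theorem balance_single (e : Edge H) (ℓ : Label) : (single e ℓ).balance = ℓ.weight := by
  unfold balance
  cases ℓ <;> simp [count_single, count_single_ne, Label.weight]

/-- The active nodes of `τ` are assigned the edges from `A`, each exactly once, with the labels and
depths prescribed by `lab` and `dep`. -/
structure Realizes (τ : WitnessStructure H) (d : τ.Node → ℕ) (lab : Edge H → Label)
    (dep : Edge H → ℕ) (A : Set (Edge H)) (β : ℤ) : Prop where
  isDepth : τ.IsDepth d
  mem : ∀ x, τ.Active x → τ.hom x ∈ A ∧ τ.label x = lab (τ.hom x) ∧ d x = dep (τ.hom x)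
  surj : ∀ e ∈ A, ∃ x, τ.Active x ∧ τ.hom x = e
  inj : ∀ x y, τ.Active x → τ.Active y → τ.hom x = τ.hom y → x = y
  balance : β ≤ τ.balance

theorem Realizes.join {τ σ : WitnessStructure H} {d : τ.Node → ℕ} {d' : σ.Node → ℕ}
    {lab : Edge H → Label} {dep : Edge H → ℕ} {A A' : Set (Edge H)} {β β' : ℤ}
    (h : τ.Realizes d lab dep A β) (h' : σ.Realizes d' lab dep A' β') (hA : Disjoint A A')
    {x : τ.Node} {y : σ.Node} (hxy : (lineGraph H).Adj (τ.hom x) (σ.hom y)) (hlt : d' y < d x) :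
    (τ.join σ x y hxy).Realizes (Sum.elim d d') lab dep (A ∪ A') (β + β') where
  isDepth := isDepth_join hxy h.isDepth h'.isDepth hlt
  mem := by
    rintro (u | u) hu
    · obtain ⟨h1, h2⟩ := h.mem u hu
      exact ⟨Or.inl h1, h2⟩
    · obtain ⟨h1, h2⟩ := h'.mem u hu
      exact ⟨Or.inr h1, h2⟩
  surj := by
    rintro e (he | he)
    · obtain ⟨u, hu⟩ := h.surj e he
      exact ⟨.inl u, hu⟩
    · obtain ⟨u, hu⟩ := h'.surj e he
      exact ⟨.inr u, hu⟩
  inj := by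
    rintro (u | u) (v | v) hu hv huv
    · exact congrArg _ (h.inj u v hu hv huv)
    · exact (Set.disjoint_left.1 hA (h.mem u hu).1 (by
        have : τ.hom u = σ.hom v := huv
        rw [this]; exact (h'.mem v hv).1)).elim
    · exact (Set.disjoint_left.1 hA (h.mem v hv).1 (by
        have : σ.hom u = τ.hom v := huv
        rw [← this]; exact (h'.mem u hu).1)).elim
    · exact congrArg _ (h'.inj u v hu hv huv)
  balance := by rw [balance_join]; exact add_le_add h.balance h'.balance

theorem Realizes.leafE {σ : WitnessStructure H} {d' : σ.Node → ℕ}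
    {lab : Edge H → Label} {dep : Edge H → ℕ} {A : Set (Edge H)} {β : ℤ}
    (h : σ.Realizes d' lab dep A β) {e : Edge H}
    {y : σ.Node} (hxy : (lineGraph H).Adj e (σ.hom y)) :
    ((single e .E).join σ () y hxy).Realizes (Sum.elim (fun _ => d' y + 1) d') lab dep A
      (β - 1) where
  isDepth := isDepth_leaf hxy h.isDepth
  mem := by
    rintro (u | u) hu
    · exact absurd rfl hu
    · exact h.mem u hu
  surj := by
    intro e he
    obtain ⟨u, hu⟩ := h.surj e he
    exact ⟨.inr u, hu⟩
  inj := by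
    rintro (u | u) (v | v) hu hv huv
    · rfl
    · exact absurd rfl hu
    · exact absurd rfl hv
    · exact congrArg _ (h.inj u v hu hv huv)
  balance := by
    refine le_of_le_of_eq ?_ (balance_join (τ := single e .E) (x := ()) hxy).symm
    rw [balance_single]
    have := h.balance
    simp only [Label.weight]
    omega

theorem Realizes.leaf {σ : WitnessStructure H} {d' : σ.Node → ℕ}
    {lab : Edge H → Label} {dep : Edge H → ℕ} {A : Set (Edge H)} {β : ℤ}
    (h : σ.Realizes d' lab dep A β) {e : Edge H} (he : e ∉ A) (hl : lab e ≠ .E)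
    {y : σ.Node} (hd : dep e = d' y + 1) (hxy : (lineGraph H).Adj e (σ.hom y)) :
    ((single e (lab e)).join σ () y hxy).Realizes (Sum.elim (fun _ => d' y + 1) d') lab dep
      (insert e A) (β + (lab e).weight) where
  isDepth := isDepth_leaf hxy h.isDepth
  mem := by
    rintro (u | u) hu
    · exact ⟨Or.inl rfl, rfl, hd.symm⟩
    · obtain ⟨h1, h2⟩ := h.mem u hu
      exact ⟨Or.inr h1, h2⟩
  surj := by
    rintro e' (rfl | he')
    · exact ⟨.inl (), hl, rfl⟩
    · obtain ⟨u, hu⟩ := h.surj e' he'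
      exact ⟨.inr u, hu⟩
  inj := by
    rintro (u | u) (v | v) hu hv huv
    · rfl
    · have : e = σ.hom v := huv
      exact absurd (this ▸ (h.mem v hv).1) he
    · have : σ.hom u = e := huv
      exact absurd (this ▸ (h.mem u hu).1) he
    · exact congrArg _ (h.inj u v hu hv huv)
  balance := by
    refine le_of_le_of_eq ?_ (balance_join (τ := single e (lab e)) (x := ()) hxy).symm
    rw [balance_single]
    have := h.balance
    omega

theorem Realizes.congr {τ : WitnessStructure H} {d : τ.Node → ℕ}
    {lab lab' : Edge H → Label} {dep dep' : Edge H → ℕ} {A : Set (Edge H)} {β β' : ℤ}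
    (h : τ.Realizes d lab dep A β) (hl : ∀ e ∈ A, lab' e = lab e) (hd : ∀ e ∈ A, dep' e = dep e)
    (hβ : β' ≤ β) : τ.Realizes d lab' dep' A β' where
  isDepth := h.isDepth
  mem x hx := by
    obtain ⟨h1, h2, h3⟩ := h.mem x hx
    exact ⟨h1, by rw [h2, hl _ h1], by rw [h3, hd _ h1]⟩
  surj := h.surj
  inj := h.inj
  balance := hβ.trans h.balance

end WitnessStructure

open WitnessStructure

/-- There is a tree whose active nodes are assigned the edges from `A` and whose balance is at least
`β`. -/
def HasTree (lab : Edge H → Label) (dep : Edge H → ℕ) (A : Set (Edge H)) (β : ℤ) : Prop :=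
  ∃ (τ : WitnessStructure H) (d : τ.Node → ℕ), τ.Realizes d lab dep A β

/-- Additionally, some node at depth `n` is assigned the edge `e`. -/
def HasTreeAt (lab : Edge H → Label) (dep : Edge H → ℕ) (A : Set (Edge H)) (β : ℤ)
    (e : Edge H) (n : ℕ) : Prop :=
  ∃ (τ : WitnessStructure H) (d : τ.Node → ℕ), τ.Realizes d lab dep A β ∧
    ∃ x, τ.hom x = e ∧ d x = n

/-! ### Gluing trees with prescribed labels and depths -/

section

variable {lab lab' : Edge H → Label} {dep dep' : Edge H → ℕ} {A A' : Set (Edge H)} {β β' : ℤ}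
  {e f z : Edge H} {n n' : ℕ}

theorem HasTreeAt.hasTree (h : HasTreeAt lab dep A β e n) : HasTree lab dep A β := by
  obtain ⟨τ, d, h, -⟩ := h
  exact ⟨τ, d, h⟩

theorem HasTree.congr (h : HasTree lab dep A β) (hl : ∀ e ∈ A, lab' e = lab e)
    (hd : ∀ e ∈ A, dep' e = dep e) (hβ : β' ≤ β) : HasTree lab' dep' A β' := by
  obtain ⟨τ, d, h⟩ := h
  exact ⟨τ, d, h.congr hl hd hβ⟩

theorem HasTree.weaken (h : HasTree lab dep A β) (hβ : β' ≤ β) : HasTree lab dep A β' :=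
  h.congr (fun _ _ => rfl) (fun _ _ => rfl) hβ

theorem hasTree_single (hl : lab e ≠ .E) (hd : dep e = 0) :
    HasTree lab dep {e} (lab e).weight :=
  ⟨single e (lab e), fun _ => 0, isDepth_single _ _, fun _ _ => ⟨rfl, rfl, hd.symm⟩,
    fun _ he => ⟨(), hl, he.symm⟩, fun _ _ _ _ _ => rfl, (balance_single _ _).ge⟩

theorem HasTree.at_mem (h : HasTree lab dep A β) (he : e ∈ A) :
    HasTreeAt lab dep A β e (dep e) := by
  obtain ⟨τ, d, h⟩ := h
  obtain ⟨x, hx, rfl⟩ := h.surj e he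
  exact ⟨τ, d, h, x, rfl, (h.mem x hx).2.2⟩

theorem HasTreeAt.leafE (h : HasTreeAt lab dep A β e n) (hf : f ∈ nbrs e) :
    HasTreeAt lab dep A (β - 1) f (n + 1) := by
  obtain ⟨τ, d, h, x, rfl, rfl⟩ := h
  exact ⟨_, _, h.leafE (nbrs_symm hf), .inl (), rfl, rfl⟩

theorem HasTreeAt.leaf (h : HasTreeAt lab dep A β e n) (hz : z ∈ nbrs e) (hzA : z ∉ A)
    (hl : lab z ≠ .E) (hd : dep z = n + 1) :
    HasTreeAt lab dep (insert z A) (β + (lab z).weight) z (n + 1) := by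
  obtain ⟨τ, d, h, x, rfl, rfl⟩ := h
  exact ⟨_, _, h.leaf hzA hl hd (nbrs_symm hz), .inl (), rfl, rfl⟩

/-- A new active leaf is attached, and the designated node is preserved. -/
theorem HasTreeAt.leaf_stay (h : HasTreeAt lab dep A β e n) (hz : z ∈ nbrs e) (hzA : z ∉ A)
    (hl : lab z ≠ .E) (hd : dep z = n + 1) :
    HasTreeAt lab dep (insert z A) (β + (lab z).weight) e n := by
  obtain ⟨τ, d, h, x, rfl, rfl⟩ := h
  exact ⟨_, _, h.leaf hzA hl hd (nbrs_symm hz), .inr x, rfl, rfl⟩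

theorem HasTreeAt.join (h : HasTreeAt lab dep A β e n) (h' : HasTreeAt lab dep A' β' f n')
    (hA : Disjoint A A') (hf : f ∈ nbrs e) (hn : n' < n) :
    HasTree lab dep (A ∪ A') (β + β') := by
  obtain ⟨τ, d, h, x, rfl, rfl⟩ := h
  obtain ⟨σ, d', h', y, rfl, rfl⟩ := h'
  exact ⟨_, _, h.join h' hA hf hn⟩

/-- The intermediate edge `f` becomes an empty node; it costs one unit, and accounts for the
difference two of the depths. -/
theorem HasTree.attach (h : HasTree lab dep A β) (he : e ∈ A) (hf : f ∈ nbrs e) (hz : z ∈ nbrs f)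
    (hzA : z ∉ A) (hl : lab z ≠ .E) (hd : dep z = dep e + 2) :
    HasTree lab dep (insert z A) (β + (lab z).weight - 1) :=
  ((((h.at_mem he).leafE hf).leaf hz hzA hl hd).hasTree).weaken (by omega)

/-- Empty nodes at `f` and `g` flank `z`. The node `z` is hung behind the deeper of `x` and `y`, so
that the closing arc also goes from larger to smaller depth. -/
theorem HasTree.bridge (h : HasTree lab dep A β) (h' : HasTree lab dep A' β')
    (hA : Disjoint A A') {x y g : Edge H} (hx : x ∈ A) (hy : y ∈ A') (hf : f ∈ nbrs x)
    (hzf : z ∈ nbrs f) (hg : g ∈ nbrs y) (hzg : z ∈ nbrs g) (hzA : z ∉ A) (hzA' : z ∉ A')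
    (hl : lab z ≠ .E) (hd : dep z = max (dep x) (dep y) + 2) :
    HasTree lab dep (insert z (A ∪ A')) (β + β' + (lab z).weight - 2) := by
  have hAz : Disjoint (insert z A) A' := by
    rw [Set.disjoint_insert_left]; exact ⟨hzA', hA⟩
  have hAz' : Disjoint (insert z A') A := by
    rw [Set.disjoint_insert_left]; exact ⟨hzA, hA.symm⟩
  rcases le_total (dep y) (dep x) with hle | hle
  · have h1 := ((h.at_mem hx).leafE hf).leaf hzf hzA hl (by omega)
    have h2 := (h'.at_mem hy).leafE hg
    have h3 := h1.join h2 hAz (nbrs_symm hzg) (by omega)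
    rw [Set.insert_union] at h3
    exact h3.weaken (by omega)
  · have h1 := ((h'.at_mem hy).leafE hg).leaf hzg hzA' hl (by omega)
    have h2 := (h.at_mem hx).leafE hf
    have h3 := h1.join h2 hAz' (nbrs_symm hzf) (by omega)
    rw [Set.insert_union, Set.union_comm] at h3
    exact h3.weaken (by omega)

/-- The empty node at `f` is hung on the deeper of the two endpoints, so an arc from it to the other
endpoint decreases the depth. -/
theorem HasTree.join_one (h : HasTree lab dep A β) (h' : HasTree lab dep A' β')
    (hA : Disjoint A A') {x y : Edge H} (hx : x ∈ A) (hy : y ∈ A') (hfx : f ∈ nbrs x)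
    (hfy : f ∈ nbrs y) : HasTree lab dep (A ∪ A') (β + β' - 1) := by
  rcases le_total (dep y) (dep x) with hle | hle
  · exact (((h.at_mem hx).leafE hfx).join (h'.at_mem hy) hA (nbrs_symm hfy) (by omega)).weaken
      (by omega)
  · rw [Set.union_comm]
    exact (((h'.at_mem hy).leafE hfy).join (h.at_mem hx) hA.symm (nbrs_symm hfx) (by omega)).weaken
      (by omega)

theorem HasTree.join_two (h : HasTree lab dep A β) (h' : HasTree lab dep A' β')
    (hA : Disjoint A A') {x y g : Edge H} (hx : x ∈ A) (hy : y ∈ A') (hfx : f ∈ nbrs x)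
    (hfg : g ∈ nbrs f) (hgy : g ∈ nbrs y) : HasTree lab dep (A ∪ A') (β + β' - 2) := by
  rcases le_total (dep y) (dep x) with hle | hle
  · exact ((((h.at_mem hx).leafE hfx).leafE hfg).join (h'.at_mem hy) hA (nbrs_symm hgy)
      (by omega)).weaken (by omega)
  · rw [Set.union_comm]
    exact ((((h'.at_mem hy).leafE hgy).leafE (nbrs_symm hfg)).join (h.at_mem hx) hA.symm
      (nbrs_symm hfx) (by omega)).weaken (by omega)

end

/-! ### Partial witness structures -/

/-- Some edge intersects both `x` and `y`. -/
def Near (x y : Edge H) : Prop := ∃ h, h ∈ nbrs x ∧ h ∈ nbrs y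

theorem Near.symm {x y : Edge H} (h : Near x y) : Near y x :=
  let ⟨g, h1, h2⟩ := h; ⟨g, h2, h1⟩

theorem mem_coveredBy {S : Set (Edge H)} {g : Edge H} :
    g ∈ coveredBy S ↔ ∃ y ∈ S, g = y ∨ g ∈ nbrs y := by
  constructor
  · rintro (h | ⟨f, hf, h⟩)
    · exact ⟨g, h, Or.inl rfl⟩
    · exact ⟨f, hf, Or.inr h⟩
  · rintro ⟨y, hy, rfl | h⟩
    · exact Or.inl hy
    · exact Or.inr ⟨y, hy, h⟩

theorem coveredBy_mono {S T : Set (Edge H)} (h : S ⊆ T) : coveredBy S ⊆ coveredBy T := by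
  intro g hg
  obtain ⟨y, hy, h'⟩ := mem_coveredBy.1 hg
  exact mem_coveredBy.2 ⟨y, h hy, h'⟩

theorem coveredBy_union {S T : Set (Edge H)} : coveredBy (S ∪ T) = coveredBy S ∪ coveredBy T := by
  refine Set.Subset.antisymm ?_ (Set.union_subset (coveredBy_mono Set.subset_union_left)
    (coveredBy_mono Set.subset_union_right))
  intro g hg
  obtain ⟨y, hy | hy, h'⟩ := mem_coveredBy.1 hg
  · exact Or.inl (mem_coveredBy.2 ⟨y, hy, h'⟩)
  · exact Or.inr (mem_coveredBy.2 ⟨y, hy, h'⟩)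

theorem disjoint_of_not_covered {S : Set (Edge H)} {y z : Edge H} (hz : z ∉ coveredBy S)
    (hy : y ∈ S) : y ≠ z ∧ Disjoint y.1 z.1 := by
  have hne : y ≠ z := by rintro rfl; exact hz (Or.inl hy)
  refine ⟨hne, Set.disjoint_left.2 fun w h1 h2 => hz (Or.inr ⟨y, hy, mem_nbrs_of_mem hne h1 h2⟩)⟩

/-- Which vertices of an uncovered edge `z` are covered depends only on the active edges near `z`;
this makes all comparisons of depths local. -/
theorem near_of_not_covered {S : Set (Edge H)} {y z g : Edge H} {w : V} (hz : z ∉ coveredBy S)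
    (hy : y ∈ S) (hg : g = y ∨ g ∈ nbrs y) (hwg : w ∈ g.1) (hwz : w ∈ z.1) : Near y z := by
  rcases hg with rfl | hg
  · exact absurd hwz (Set.disjoint_left.1 (disjoint_of_not_covered hz hy).2 hwg)
  · refine ⟨g, hg, mem_nbrs_of_mem ?_ hwz hwg⟩
    rintro rfl
    exact hz (Or.inr ⟨y, hy, hg⟩)

/-- A version of the basic event of a node with the label `ℓ`, the edge `e`, and the set `W` of
vertices covered by deeper nodes, in which edges with the label `B` are required to be currently
bad. -/
def Event (k a : ℕ) (M : Memory V) (ℓ : Label) (e W : Set V) : Prop :=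
  match ℓ with
  | .M => M.record.Colored e ∧ Mono M.record.sample e
  -- Badness in the record alone could be lost later: a safe edge may still receive an accepted
  -- vertex of the other color.
  | .B => M.IsBad k a e
  | .Bin => M.record.IsUnsafe k a e ∧ Mono M.record.sample (M.record.acc e ∪ (M.record.trb e ∩ W)) ∧
      k ≤ (M.record.acc e ∪ (M.record.trb e ∩ W)).ncard + a
  | .Bout => M.record.IsUnsafe k a e ∧
      Mono M.record.sample (M.record.acc e ∪ (M.record.trb e \ W)) ∧
      k ≤ (M.record.acc e ∪ (M.record.trb e \ W)).ncard + a
  | .U => M.record.IsUnsafe k a e ∧ (M.record.trb e).ncard < 2 * a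
  | .E => True

theorem Event.congr {M : Memory V} {ℓ : Label} {e W W' : Set V} (h : Event k a M ℓ e W)
    (hW : ∀ w ∈ e, w ∈ W' ↔ w ∈ W) : Event k a M ℓ e W' := by
  have h1 : M.record.trb e ∩ W' = M.record.trb e ∩ W := by
    ext w; exact and_congr_right fun hw => hW w hw.1
  have h2 : M.record.trb e \ W' = M.record.trb e \ W := by
    ext w; exact and_congr_right fun hw => not_congr (hW w hw.1)
  cases ℓ <;> simp only [Event] at h ⊢
  · exact h
  · exact h
  · rw [h1]; exact h
  · rw [h2]; exact h
  · exact h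

theorem Event.later {M M' : Memory V} {ℓ : Label} {e : Edge H} {W : Set V}
    (h : Event k a M ℓ e.1 W) (hL : Later H k a M M') : Event k a M' ℓ e.1 W := by
  have hsub : ∀ W, M.record.acc e.1 ∪ (M.record.trb e.1 ∩ W) ⊆ e.1 := fun W =>
    Set.union_subset (fun _ h => h.1) fun _ h => h.1.1
  have hsub' : ∀ W, M.record.acc e.1 ∪ (M.record.trb e.1 \ W) ⊆ e.1 := fun W =>
    Set.union_subset (fun _ h => h.1) fun _ h => h.1.1
  cases ℓ <;> simp only [Event] at h ⊢
  · exact ⟨hL.record_colored h.1, (hL.record_mono_iff h.1 subset_rfl).2 h.2⟩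
  · exact hL.bad e h
  · rw [hL.record_acc_eq h.1.1, hL.record_trb_eq h.1.1, hL.record_mono_iff h.1.1 (hsub W)]
    exact ⟨hL.record_unsafe h.1, h.2⟩
  · rw [hL.record_acc_eq h.1.1, hL.record_trb_eq h.1.1, hL.record_mono_iff h.1.1 (hsub' W)]
    exact ⟨hL.record_unsafe h.1, h.2⟩
  · rw [hL.record_trb_eq h.1.1]
    exact ⟨hL.record_unsafe h.1, h.2⟩

/-- The edges `y` such that every other edge intersecting `y`, and `y` itself, belongs to `B` or is
settled. -/
def Tame (k a : ℕ) (M : Memory V) (B : Set (Edge H)) : Set (Edge H) :=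
  {y | ∀ c, c = y ∨ c ∈ nbrs y → c ∈ B ∨ M.Settled k a c.1}

theorem Tame.mono {M M' : Memory V} {B B' : Set (Edge H)} (hB : B ⊆ B')
    (hM : ∀ e : Edge H, M.Settled k a e.1 → M'.Settled k a e.1) :
    Tame k a M B ⊆ Tame k a M' B' :=
  fun _ hy c hc => (hy c hc).imp (fun h => hB h) (hM c)

/-- Two sets of edges with common labels and depths, and a number. -/
structure Duo (H : Hypergraph V) where
  lab : Edge H → Label
  dep : Edge H → ℕ
  L : Set (Edge H)
  A : Set (Edge H)
  pot : ℤ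

/-- The edges in `D.A` are those of the active nodes of a tree, and so are the edges in `D.L`, unless
`D.L` is empty. These two trees do not interact, the basic events hold, and after joining the trees by
a node of weight zero, the balance is at least `D.pot`. -/
structure Good (k a : ℕ) (M : Memory V) (B : Set (Edge H)) (D : Duo H) : Prop where
  -- An empty `D.L` counts as 2, which cancels the two units reserved for joining the trees.
  tree : ∃ β₁ β₂, ((D.L = ∅ ∧ β₁ = 2) ∨ (D.L.Nonempty ∧ HasTree D.lab D.dep D.L β₁)) ∧
    HasTree D.lab D.dep D.A β₂ ∧ D.pot ≤ β₁ + β₂ - 2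
  disjoint : Disjoint D.L D.A
  edges : ∀ x ∈ D.L ∪ D.A, ∀ y ∈ D.L ∪ D.A, x ≠ y → Disjoint x.1 y.1
  far : ∀ x ∈ D.L, ∀ y ∈ D.A, ¬ Near x y
  event : ∀ x ∈ D.L ∪ D.A, Event k a M (D.lab x) x.1
    (verts (coveredBy {y | y ∈ D.L ∪ D.A ∧ D.dep y < D.dep x}))
  tame : ∀ y ∈ D.L ∪ D.A, y ∈ Tame k a M B

/-- `D'` extends `D`. -/
structure Ext (D D' : Duo H) : Prop where
  A : D.A ⊆ D'.A
  all : D.L ∪ D.A ⊆ D'.L ∪ D'.A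
  L : D'.L = D.L ∨ D'.L = ∅
  pot : D.pot ≤ D'.pot

theorem Ext.refl (D : Duo H) : Ext D D := ⟨subset_rfl, subset_rfl, Or.inl rfl, le_rfl⟩

theorem Ext.trans {D D' D'' : Duo H} (h : Ext D D') (h' : Ext D' D'') : Ext D D'' where
  A := h.A.trans h'.A
  all := h.all.trans h'.all
  L := by
    rcases h'.L with h1 | h1
    · rw [h1]; exact h.L
    · exact Or.inr h1
  pot := h.pot.trans h'.pot

theorem Ext.cov_L {D D' : Duo H} (h : Ext D D') {c : Edge H} (hc : c ∉ coveredBy D.L) :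
    c ∉ coveredBy D'.L := by
  rcases h.L with h1 | h1
  · rwa [h1]
  · rw [h1, mem_coveredBy]; simp

theorem Ext.cov_A {D D' : Duo H} (h : Ext D D') : coveredBy D.A ⊆ coveredBy D'.A :=
  coveredBy_mono h.A

theorem Good.later {M M' : Memory V} {B B' : Set (Edge H)} {D : Duo H} (h : Good k a M B D)
    (hL : Later H k a M M') (hB : B ⊆ B') : Good k a M' B' D :=
  { h with
    event := fun x hx => (h.event x hx).later hL
    tame := fun y hy => Tame.mono hB (fun _ => hL.settled) (h.tame y hy) }

theorem Good.swap {M : Memory V} {B : Set (Edge H)} {D : Duo H} (h : Good k a M B D)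
    (hL : D.L.Nonempty) (hA : D.A.Nonempty) : Good k a M B ⟨D.lab, D.dep, D.A, D.L, D.pot⟩ where
  tree := by
    obtain ⟨β₁, β₂, h1, h2, h3⟩ := h.tree
    rcases h1 with ⟨h1, -⟩ | ⟨-, h1⟩
    · exact absurd h1 hL.ne_empty
    · exact ⟨β₂, β₁, Or.inr ⟨hA, h2⟩, h1, by simp only; omega⟩
  disjoint := h.disjoint.symm
  edges := by simp only [Set.union_comm D.A]; exact h.edges
  far x hx y hy hn := h.far y hy x hx hn.symm
  event := by simp only [Set.union_comm D.A]; exact h.event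
  tame := by simp only [Set.union_comm D.A]; exact h.tame

/-- If the trees can be joined, then we obtain a single tree. -/
theorem Good.merge {M : Memory V} {B : Set (Edge H)} {D : Duo H} (h : Good k a M B D)
    (hL : D.L.Nonempty)
    (hj : ∀ β₁ β₂, HasTree D.lab D.dep D.L β₁ → HasTree D.lab D.dep D.A β₂ →
      HasTree D.lab D.dep (D.L ∪ D.A) (β₁ + β₂ - 2)) :
    Good k a M B ⟨D.lab, D.dep, ∅, D.L ∪ D.A, D.pot⟩ ∧
      Ext D ⟨D.lab, D.dep, ∅, D.L ∪ D.A, D.pot⟩ where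
  left := by
    obtain ⟨β₁, β₂, h1, h2, h3⟩ := h.tree
    rcases h1 with ⟨h1, -⟩ | ⟨-, h1⟩
    · exact absurd h1 hL.ne_empty
    · refine ⟨⟨2, β₁ + β₂ - 2, Or.inl ⟨rfl, rfl⟩, hj _ _ h1 h2, by simp only; omega⟩, by simp, ?_,
        by simp, ?_, ?_⟩
      · simp only [Set.empty_union]; exact h.edges
      · simp only [Set.empty_union]; exact h.event
      · simp only [Set.empty_union]; exact h.tame
  right := ⟨Set.subset_union_right, by simp, Or.inr rfl, le_rfl⟩

theorem Good.merge_one {M : Memory V} {B : Set (Edge H)} {D : Duo H} (h : Good k a M B D)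
    {x y f : Edge H} (hx : x ∈ D.L) (hy : y ∈ D.A) (hfx : f ∈ nbrs x) (hfy : f ∈ nbrs y) :
    Good k a M B ⟨D.lab, D.dep, ∅, D.L ∪ D.A, D.pot⟩ ∧
      Ext D ⟨D.lab, D.dep, ∅, D.L ∪ D.A, D.pot⟩ :=
  h.merge ⟨x, hx⟩ fun _ _ h1 h2 => (h1.join_one h2 h.disjoint hx hy hfx hfy).weaken (by omega)

theorem Good.merge_two {M : Memory V} {B : Set (Edge H)} {D : Duo H} (h : Good k a M B D)
    {x y f g : Edge H} (hx : x ∈ D.L) (hy : y ∈ D.A) (hfx : f ∈ nbrs x) (hfg : g ∈ nbrs f)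
    (hgy : g ∈ nbrs y) :
    Good k a M B ⟨D.lab, D.dep, ∅, D.L ∪ D.A, D.pot⟩ ∧
      Ext D ⟨D.lab, D.dep, ∅, D.L ∪ D.A, D.pot⟩ :=
  h.merge ⟨x, hx⟩ fun _ _ h1 h2 => h1.join_two h2 h.disjoint hx hy hfx hfg hgy

-- Unless the label B is involved on both sides, every node near `z` is less deep than `z`. Hence
-- all covered vertices of `z` are covered by nodes below it, while `z` does not lie below any older
-- node near it. The event of a node labelled B ignores covered vertices, which explains the
-- exception.
open Classical in
theorem events_insert {M : Memory V} {lab : Edge H → Label} {dep : Edge H → ℕ} {T : Set (Edge H)}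
    {z : Edge H} {ℓ : Label} {d : ℕ}
    (hev : ∀ x ∈ T, Event k a M (lab x) x.1 (verts (coveredBy {y | y ∈ T ∧ dep y < dep x})))
    (hz : z ∉ coveredBy T) (hd : ∀ y ∈ T, Near y z → dep y < d ∨ (lab y = .B ∧ ℓ = .B))
    (hevz : Event k a M ℓ z.1 (verts (coveredBy T))) :
    ∀ x ∈ insert z T, Event k a M (Function.update lab z ℓ x) x.1
      (verts (coveredBy {y | y ∈ insert z T ∧
        Function.update dep z d y < Function.update dep z d x})) := by
  have hzT : z ∉ T := fun h => hz (Or.inl h)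
  have hne : ∀ y ∈ T, y ≠ z := by rintro y hy rfl; exact hzT hy
  rintro x (rfl | hx)
  · rw [Function.update_self]
    by_cases hB : ℓ = .B
    · subst hB; exact hevz
    refine hevz.congr fun w hw => ⟨?_, ?_⟩
    · rintro ⟨g, hg, hwg⟩
      refine ⟨g, coveredBy_mono ?_ hg, hwg⟩
      rintro y ⟨rfl | hy, h⟩
      · exact absurd h (lt_irrefl _)
      · exact hy
    · rintro ⟨g, hg, hwg⟩
      obtain ⟨y, hy, hgy⟩ := mem_coveredBy.1 hg
      refine ⟨g, mem_coveredBy.2 ⟨y, ⟨Or.inr hy, ?_⟩, hgy⟩, hwg⟩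
      rw [Function.update_self, Function.update_of_ne (hne y hy)]
      exact (hd y hy (near_of_not_covered hz hy hgy hwg hw)).resolve_right fun h => hB h.2
  · rw [Function.update_of_ne (hne x hx)]
    by_cases hB : lab x = .B
    · have := hev x hx
      rw [hB] at this ⊢
      exact this
    refine (hev x hx).congr fun w hw => ⟨?_, ?_⟩
    · rintro ⟨g, hg, hwg⟩
      obtain ⟨y, ⟨hy, hlt⟩, hgy⟩ := mem_coveredBy.1 hg
      rw [Function.update_of_ne (hne x hx)] at hlt
      rcases hy with rfl | hy
      · have hxy : x ∉ coveredBy {y} := by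
          rw [mem_coveredBy]
          rintro ⟨_, rfl, rfl | h⟩
          · exact hzT hx
          · exact hz (Or.inr ⟨x, hx, nbrs_symm h⟩)
        have := (hd x hx (near_of_not_covered hxy rfl hgy hwg hw).symm).resolve_right
          fun h => hB h.1
        rw [Function.update_self] at hlt
        omega
      · rw [Function.update_of_ne (hne y hy)] at hlt
        exact ⟨g, mem_coveredBy.2 ⟨y, ⟨hy, hlt⟩, hgy⟩, hwg⟩
    · rintro ⟨g, hg, hwg⟩
      obtain ⟨y, ⟨hy, hlt⟩, hgy⟩ := mem_coveredBy.1 hg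
      refine ⟨g, mem_coveredBy.2 ⟨y, ⟨Or.inr hy, ?_⟩, hgy⟩, hwg⟩
      rw [Function.update_of_ne (hne x hx), Function.update_of_ne (hne y hy)]
      exact hlt

theorem edges_insert {T : Set (Edge H)} {z : Edge H} (hz : z ∉ coveredBy T)
    (h : ∀ x ∈ T, ∀ y ∈ T, x ≠ y → Disjoint x.1 y.1) :
    ∀ x ∈ insert z T, ∀ y ∈ insert z T, x ≠ y → Disjoint x.1 y.1 := by
  rintro x (rfl | hx) y (rfl | hy) hne
  · exact absurd rfl hne
  · exact (disjoint_of_not_covered hz hy).2.symm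
  · exact (disjoint_of_not_covered hz hx).2
  · exact h x hx y hy hne

/-- The deepest node near `z` is the right place for attaching `z`, whose depth then exceeds that of
every node near it. -/
theorem exists_near_max [Finite V] {T : Set (Edge H)} (dep : Edge H → ℕ) {y z : Edge H} (hy : y ∈ T)
    (hyz : Near y z) : ∃ x ∈ T, Near x z ∧ ∀ y ∈ T, Near y z → dep y ≤ dep x := by
  obtain ⟨x, hx, hm⟩ := Set.exists_max_image {y | y ∈ T ∧ Near y z} dep (Set.toFinite _) ⟨y, hy, hyz⟩
  exact ⟨x, hx.1, hx.2, fun y hy hn => hm y ⟨hy, hn⟩⟩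

/-! ### Enlarging a good pair of trees -/

section

variable {M : Memory V} {B : Set (Edge H)} {D : Duo H} {z : Edge H} {ℓ : Label}

open Classical in
/-- A new node close to both trees joins them. -/
theorem Good.bridge [Finite V] (h : Good k a M B D) (hz : z ∉ coveredBy (D.L ∪ D.A))
    (hzB : z ∈ Tame k a M B) {x y : Edge H} (hx : x ∈ D.L) (hxz : Near x z) (hy : y ∈ D.A)
    (hyz : Near y z) (hw : 0 ≤ ℓ.weight)
    (hev : Event k a M ℓ z.1 (verts (coveredBy (D.L ∪ D.A)))) :
    ∃ D', Good k a M B D' ∧ Ext D D' ∧ z ∈ D'.A ∧ D'.L = ∅ := by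
  obtain ⟨x, hx, ⟨f, hfx, hfz⟩, hxm⟩ := exists_near_max D.dep hx hxz
  obtain ⟨y, hy, ⟨g, hgy, hgz⟩, hym⟩ := exists_near_max D.dep hy hyz
  have hzT : z ∉ D.L ∪ D.A := fun h => hz (Or.inl h)
  have hne : ∀ y ∈ D.L ∪ D.A, y ≠ z := by rintro y hy rfl; exact hzT hy
  -- Two more than the deeper attachment point, because an empty node lies in between.
  set d := max (D.dep x) (D.dep y) + 2 with hd
  refine ⟨⟨Function.update D.lab z ℓ, Function.update D.dep z d, ∅, insert z (D.L ∪ D.A), D.pot⟩,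
    ⟨?_, by simp, ?_, by simp, ?_, ?_⟩, ⟨?_, ?_, Or.inr rfl, le_rfl⟩, Or.inl rfl, rfl⟩
  · obtain ⟨β₁, β₂, ⟨h1, -⟩ | ⟨-, h1⟩, h2, h3⟩ := h.tree
    · rw [h1] at hx; exact hx.elim
    · refine ⟨2, β₁ + β₂ + ℓ.weight - 2, Or.inl ⟨rfl, rfl⟩, ?_, by simp only; omega⟩
      have hl : ∀ T ⊆ D.L ∪ D.A, ∀ e ∈ T, Function.update D.lab z ℓ e = D.lab e := fun T hT e he =>
        Function.update_of_ne (hne e (hT he)) _ _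
      have hdd : ∀ T ⊆ D.L ∪ D.A, ∀ e ∈ T, Function.update D.dep z d e = D.dep e := fun T hT e he =>
        Function.update_of_ne (hne e (hT he)) _ _
      have h1' := h1.congr (hl _ Set.subset_union_left) (hdd _ Set.subset_union_left) le_rfl
      have h2' := h2.congr (hl _ Set.subset_union_right) (hdd _ Set.subset_union_right) le_rfl
      have := h1'.bridge h2' h.disjoint hx hy hfx (nbrs_symm hfz) hgy (nbrs_symm hgz)
        (fun h => hzT (Or.inl h)) (fun h => hzT (Or.inr h))
        (by rw [Function.update_self]; rintro rfl; simp [Label.weight] at hw)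
        (by rw [Function.update_self, hdd _ Set.subset_union_left x hx,
          hdd _ Set.subset_union_right y hy])
      rwa [Function.update_self] at this
  · simp only [Set.empty_union]; exact edges_insert hz h.edges
  · simp only [Set.empty_union]
    refine events_insert h.event hz ?_ hev
    rintro u (hu | hu) hn
    · have := hxm u hu hn; left; omega
    · have := hym u hu hn; left; omega
  · rintro u (hu | rfl | hu)
    · exact hu.elim
    · exact hzB
    · exact h.tame u hu
  · exact fun u hu => Or.inr (Or.inr hu)
  · exact fun u hu => Or.inr (Or.inr hu)

-- The weight of `z` pays for the empty node between `z` and the deepest node of `D.A` near it. The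
-- other tree imposes no condition on the depth, as none of its nodes is near `z`.
open Classical in
theorem Good.attach_far [Finite V] (h : Good k a M B D) (hz : z ∉ coveredBy (D.L ∪ D.A))
    (hzB : z ∈ Tame k a M B) (hL : ∀ x ∈ D.L, ¬ Near x z) {y : Edge H} (hy : y ∈ D.A)
    (hyz : Near y z) (hw : 1 ≤ ℓ.weight)
    (hev : Event k a M ℓ z.1 (verts (coveredBy (D.L ∪ D.A)))) :
    ∃ D', Good k a M B D' ∧ D'.A = insert z D.A ∧ D'.L = D.L ∧ D'.pot = D.pot := by
  obtain ⟨y, hy, ⟨g, hgy, hgz⟩, hym⟩ := exists_near_max D.dep hy hyz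
  have hzT : z ∉ D.L ∪ D.A := fun h => hz (Or.inl h)
  have hne : ∀ y ∈ D.L ∪ D.A, y ≠ z := by rintro y hy rfl; exact hzT hy
  have hl : ∀ T ⊆ D.L ∪ D.A, ∀ e ∈ T, Function.update D.lab z ℓ e = D.lab e := fun T hT e he =>
    Function.update_of_ne (hne e (hT he)) _ _
  have hdd : ∀ T ⊆ D.L ∪ D.A, ∀ e ∈ T,
      Function.update D.dep z (D.dep y + 2) e = D.dep e := fun T hT e he =>
    Function.update_of_ne (hne e (hT he)) _ _
  refine ⟨⟨Function.update D.lab z ℓ, Function.update D.dep z (D.dep y + 2), D.L, insert z D.A,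
    D.pot⟩, ⟨?_, ?_, ?_, ?_, ?_, ?_⟩, rfl, rfl, rfl⟩
  · obtain ⟨β₁, β₂, h1, h2, h3⟩ := h.tree
    refine ⟨β₁, β₂ + ℓ.weight - 1, h1.imp_right fun h1 => ⟨h1.1, h1.2.congr
      (hl _ Set.subset_union_left) (hdd _ Set.subset_union_left) le_rfl⟩, ?_, by simp only; omega⟩
    have h2' := h2.congr (hl _ Set.subset_union_right) (hdd _ Set.subset_union_right) le_rfl
    have := h2'.attach hy hgy (nbrs_symm hgz) (fun h => hzT (Or.inr h))
      (by rw [Function.update_self]; rintro rfl; simp [Label.weight] at hw)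
      (by rw [Function.update_self, hdd _ Set.subset_union_right y hy])
    rwa [Function.update_self] at this
  · simp only [Set.disjoint_insert_right]
    exact ⟨fun h => hzT (Or.inl h), h.disjoint⟩
  · simp only [Set.union_insert]; exact edges_insert hz h.edges
  · rintro x hx u (rfl | hu)
    · exact hL x hx
    · exact h.far x hx u hu
  · simp only [Set.union_insert]
    refine events_insert h.event hz ?_ hev
    rintro u (hu | hu) hn
    · exact absurd hn (hL u hu)
    · have := hym u hu hn; left; omega
  · rintro u (hu | rfl | hu)
    · exact h.tame u (Or.inl hu)
    · exact hzB
    · exact h.tame u (Or.inr hu)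

/-- A new node is attached to a node of `D.A`. -/
theorem Good.attach [Finite V] (h : Good k a M B D) (hz : z ∉ coveredBy (D.L ∪ D.A))
    (hzB : z ∈ Tame k a M B) {y : Edge H} (hy : y ∈ D.A)
    (hyz : Near y z) (hw : 1 ≤ ℓ.weight)
    (hev : Event k a M ℓ z.1 (verts (coveredBy (D.L ∪ D.A)))) :
    ∃ D', Good k a M B D' ∧ Ext D D' ∧ z ∈ D'.A := by
  by_cases hL : ∃ x ∈ D.L, Near x z
  · obtain ⟨x, hx, hxz⟩ := hL
    obtain ⟨D', h1, h2, h3, -⟩ := h.bridge hz hzB hx hxz hy hyz (by omega) hev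
    exact ⟨D', h1, h2, h3⟩
  · push Not at hL
    obtain ⟨D', h1, h2, h3, h4⟩ := h.attach_far hz hzB hL hy hyz hw hev
    refine ⟨D', h1, ⟨?_, ?_, Or.inl h3, h4.ge⟩, ?_⟩
    · rw [h2]; exact Set.subset_insert _ _
    · rw [h2, h3]; exact Set.union_subset_union_right _ (Set.subset_insert _ _)
    · rw [h2]; exact Or.inl rfl

/-- A new node is attached to a node of `D.L`, and then joined with the node `y` of `D.A`. -/
theorem Good.attach_left [Finite V] (h : Good k a M B D) (hz : z ∉ coveredBy (D.L ∪ D.A))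
    (hzB : z ∈ Tame k a M B) (hA : ∀ y ∈ D.A, ¬ Near y z) {x : Edge H} (hx : x ∈ D.L)
    (hxz : Near x z) (hw : 1 ≤ ℓ.weight)
    (hev : Event k a M ℓ z.1 (verts (coveredBy (D.L ∪ D.A)))) {y f g : Edge H} (hy : y ∈ D.A)
    (hfy : f ∈ nbrs y) (hfg : g ∈ nbrs f) (hgz : g ∈ nbrs z) :
    ∃ D', Good k a M B D' ∧ Ext D D' ∧ z ∈ D'.A := by
  -- With the roles of the trees exchanged, `z` is attached and paid for as usual; the path from `y`
  -- through `f` and `g` to `z` then joins the trees at the expense of the two reserved units.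
  obtain ⟨D', h1, h2, h3, h4⟩ := (h.swap ⟨x, hx⟩ ⟨y, hy⟩).attach_far (ℓ := ℓ)
    (by simp only [Set.union_comm D.A]; exact hz) hzB hA hx hxz hw
    (by simp only [Set.union_comm D.A]; exact hev)
  simp only at h2 h3 h4
  obtain ⟨h5, h6⟩ := h1.merge_two (x := y) (y := z) (by rw [h3]; exact hy) (by rw [h2]; exact Or.inl rfl)
    hfy hfg hgz
  refine ⟨_, h5, ⟨?_, ?_, Or.inr rfl, ?_⟩, ?_⟩
  · simp only [h3]; exact Set.subset_union_left
  · simp only [h2, h3]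
    rintro u (hu | hu)
    · exact Or.inr (Or.inr (Or.inr hu))
    · exact Or.inr (Or.inl hu)
  · simp only [h4]; exact le_rfl
  · simp only [h2]; exact Or.inr (Or.inl rfl)

/-- If the uncovered elements of `S` can be covered one by one, then all of them can be covered. -/
theorem Good.saturate [Finite V] (h : Good k a M B D) {S : Set (Edge H)} {P : Duo H → Prop}
    (hP : P D)
    (hext : ∀ D D', P D → Ext D D' → P D')
    (hstep : ∀ D, Good k a M B D → P D → ¬ S ⊆ coveredBy D.A → ∃ D', Good k a M B D' ∧ Ext D D' ∧
      ∃ s ∈ S, s ∉ coveredBy D.A ∧ s ∈ D'.A) :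
    ∃ D', Good k a M B D' ∧ Ext D D' ∧ S ⊆ coveredBy D'.A := by
  induction hn : (S \ coveredBy D.A).ncard using Nat.strong_induction_on generalizing D with
  | _ n ih =>
    by_cases hS : S ⊆ coveredBy D.A
    · exact ⟨D, h, Ext.refl D, hS⟩
    · obtain ⟨D', h1, h2, s, hs, hs1, hs2⟩ := hstep D h hP hS
      obtain ⟨D'', h3, h4, h5⟩ := ih (S \ coveredBy D'.A).ncard (by
        rw [← hn]
        refine Set.ncard_lt_ncard (Set.ssubset_iff_of_subset ?_ |>.2 ⟨s, ⟨hs, hs1⟩, ?_⟩)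
          (Set.toFinite _)
        · exact Set.sdiff_subset_sdiff_right h2.cov_A
        · exact fun h => h.2 (Or.inl hs2)) h1 (hext _ _ hP h2) rfl
      exact ⟨D'', h3, h2.trans h4, h5⟩

/-- Bad edges intersected by an edge that intersects an active edge can be covered. -/
theorem Good.cover_nbrs [Finite V] (h : Good k a M B D) {g : Edge H}
    (hg : ∃ y ∈ D.A, y = g ∨ y ∈ nbrs g)
    {Y : Set (Edge H)} (hY : ∀ c ∈ Y, c ∈ nbrs g ∧ M.IsBad k a c.1 ∧ c ∈ Tame k a M B)
    (hL : ∀ c ∈ Y, c ∉ coveredBy D.L) :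
    ∃ D', Good k a M B D' ∧ Ext D D' ∧ Y ⊆ coveredBy D'.A := by
  refine h.saturate (P := fun D => (∃ y ∈ D.A, y = g ∨ y ∈ nbrs g) ∧ ∀ c ∈ Y, c ∉ coveredBy D.L)
    ⟨hg, hL⟩ ?_ ?_
  · rintro D D' ⟨⟨y, hy, hyg⟩, hL⟩ hE
    exact ⟨⟨y, hE.A hy, hyg⟩, fun c hc => hE.cov_L (hL c hc)⟩
  · rintro D h ⟨⟨y, hy, hyg⟩, hL⟩ hS
    obtain ⟨c, hc, hcA⟩ := Set.not_subset.1 hS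
    have hcT : c ∉ coveredBy (D.L ∪ D.A) := by
      rw [coveredBy_union]; rintro (h | h)
      · exact hL c hc h
      · exact hcA h
    obtain ⟨h1, h2, h3⟩ := hY c hc
    have hn : Near y c := by
      rcases hyg with rfl | hyg
      · exact absurd (Or.inr ⟨y, hy, h1⟩) hcA
      · exact ⟨g, nbrs_symm hyg, nbrs_symm h1⟩
    obtain ⟨D', g1, g2, g3⟩ := h.attach (ℓ := .B) hcT h3 hy hn (by simp [Label.weight]) h2
    exact ⟨D', g1, g2, c, hc, hcA, g3⟩

/-- Covering a set of bad edges that is connected to the covered ones. -/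
theorem Good.grow [Finite V] (h : Good k a M B D) {T₀ T : Set (Edge H)} (hF : Fed T₀ T)
    (hT₀ : T₀ ⊆ coveredBy D.A) (hT : ∀ c ∈ T, M.IsBad k a c.1 ∧ c ∈ Tame k a M B)
    (hL : ∀ c ∈ T, c ∉ coveredBy D.L) :
    ∃ D', Good k a M B D' ∧ Ext D D' ∧ T ⊆ coveredBy D'.A := by
  refine h.saturate (P := fun D => T₀ ⊆ coveredBy D.A ∧ ∀ c ∈ T, c ∉ coveredBy D.L)
    ⟨hT₀, hL⟩ ?_ ?_
  · rintro D D' ⟨h1, h2⟩ hE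
    exact ⟨h1.trans hE.cov_A, fun c hc => hE.cov_L (h2 c hc)⟩
  · rintro D h ⟨hT₀, hL⟩ hS
    -- Otherwise the covered edges would be closed under adjacency in `T`, and `hF` would show that
    -- all of `T` is covered.
    have : ∃ s ∈ coveredBy D.A, s ∈ T ∧ ∃ t ∈ T, t ∈ nbrs s ∧ t ∉ coveredBy D.A := by
      by_contra hc
      push Not at hc
      exact hS (hF _ hT₀ fun s hs hsT t ht hts => hc s hs hsT t ht hts)
    obtain ⟨s, hs, hsT, c, hc, hcs, hcA⟩ := this
    have hcT : c ∉ coveredBy (D.L ∪ D.A) := by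
      rw [coveredBy_union]; rintro (h | h)
      · exact hL c hc h
      · exact hcA h
    obtain ⟨h2, h3⟩ := hT c hc
    obtain ⟨y, hy, rfl | hys⟩ := mem_coveredBy.1 hs
    · exact absurd (Or.inr ⟨s, hy, hcs⟩) hcA
    obtain ⟨D', g1, g2, g3⟩ := h.attach (ℓ := .B) hcT h3 hy ⟨s, hys, nbrs_symm hcs⟩
      (by simp [Label.weight]) h2
    exact ⟨D', g1, g2, c, hc, hcA, g3⟩

/-- Covering bad edges on the other side of an unsafe edge `g`, which becomes active if this is
necessary. -/
theorem Good.cross [Finite V] (h : Good k a M B D) {B' : Set (Edge H)} (hS : Sound H k a B' M)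
    {g : Edge H}
    {X Y : Set (Edge H)} (hgB : g ∈ Tame k a M B) (hu : M.IsUnsafe k a g.1)
    (hun : M.Untouched g.1) (hX : ∀ x ∈ X, M.IsBad k a x.1)
    (hXc : ∀ x ∈ X, x ∈ nbrs g → x ∈ coveredBy D.A) (hXn : ∃ x ∈ X, x ∈ nbrs g)
    (hY : ∀ c ∈ Y, c ∈ nbrs g ∧ M.IsBad k a c.1 ∧ c ∈ Tame k a M B)
    (hYc : ∀ c ∈ Y, c ∉ coveredBy (D.L ∪ D.A))
    (hXY : ∀ c ∈ nbrs g, M.IsBad k a c.1 → c ∈ X ∨ c ∈ Y) (hw : 1 ≤ ℓ.weight)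
    (hev : ∀ W : Set V, (∀ w ∈ M.record.trb g.1, w ∈ W ↔ w ∈ verts X) →
      Event k a M ℓ g.1 W) :
    ∃ D', Good k a M B D' ∧ Ext D D' ∧ Y ⊆ coveredBy D'.A := by
  have hYL : ∀ c ∈ Y, c ∉ coveredBy D.L := fun c hc h =>
    hYc c hc (coveredBy_mono Set.subset_union_left h)
  have hfin : ∀ c ∈ Y, (∃ D', Good k a M B D' ∧ Ext D D' ∧ c ∈ D'.A) →
      ∃ D', Good k a M B D' ∧ Ext D D' ∧ Y ⊆ coveredBy D'.A := by
    rintro c hc ⟨D', h1, h2, h3⟩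
    obtain ⟨D'', h4, h5, h6⟩ := h1.cover_nbrs ⟨c, h3, Or.inr (hY c hc).1⟩ hY
      fun c hc => h2.cov_L (hYL c hc)
    exact ⟨D'', h4, h2.trans h5, h6⟩
  -- If an active edge of `D.A` is already near some `c ∈ Y`, then `c` itself is attached and `g`
  -- need not become active.
  by_cases hA : ∃ c ∈ Y, ∃ y ∈ D.A, Near y c
  · obtain ⟨c, hc, y, hy, hn⟩ := hA
    exact hfin c hc (h.attach (ℓ := .B) (hYc c hc) (hY c hc).2.2 hy hn (by simp [Label.weight])
      (hY c hc).2.1)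
  push Not at hA
  obtain ⟨b, hb, hbg⟩ := hXn
  obtain ⟨y, hy, hyb⟩ := mem_coveredBy.1 (hXc b hb hbg)
  rcases Y.eq_empty_or_nonempty with rfl | ⟨c₀, hc₀⟩
  · exact ⟨D, h, Ext.refl D, Set.empty_subset _⟩
  have hyb' : b ∈ nbrs y := by
    rcases hyb with rfl | hyb
    · exact absurd ⟨g, nbrs_symm hbg, nbrs_symm (hY c₀ hc₀).1⟩ (hA c₀ hc₀ b hy)
    · exact hyb
  -- Here it is the other tree that comes close to `Y`, and the path through `b` and `g` serves for
  -- joining both trees.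
  by_cases hL : ∃ c ∈ Y, ∃ x ∈ D.L, Near x c
  · obtain ⟨c, hc, x, hx, hn⟩ := hL
    exact hfin c hc (h.attach_left (ℓ := .B) (hYc c hc) (hY c hc).2.2 (hA c hc) hx hn
      (by simp [Label.weight]) (hY c hc).2.1 hy hyb' (nbrs_symm hbg) (nbrs_symm (hY c hc).1))
  push Not at hL
  have hN : ∀ c ∈ Y, ∀ y ∈ D.L ∪ D.A, ¬ Near y c := by
    rintro c hc y (hy | hy)
    · exact hL c hc y hy
    · exact hA c hc y hy
  have hg : g ∉ coveredBy (D.L ∪ D.A) := by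
    intro hg
    obtain ⟨x, hx, rfl | hgx⟩ := mem_coveredBy.1 hg
    · exact hYc c₀ hc₀ (Or.inr ⟨g, hx, (hY c₀ hc₀).1⟩)
    · exact hN c₀ hc₀ x hx ⟨g, hgx, nbrs_symm (hY c₀ hc₀).1⟩
  -- No active edge is near `Y`. Every troubled vertex of `g` lies in a bad neighbour from `X` or
  -- `Y`, so it is covered exactly when it lies in `verts X`, and the event of `g` can be checked
  -- with this set.
  obtain ⟨D', h1, h2, h3⟩ := h.attach (ℓ := ℓ) hg hgB hy ⟨b, hyb', hbg⟩ hw (by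
    refine hev _ fun w hw => ⟨?_, ?_⟩
    · rintro ⟨e, he, hwe⟩
      obtain ⟨c, hwc, hc⟩ := hS.troubled_bad w ((hun w hw.1).trans hw.2)
      have hcg : c ∈ nbrs g := by
        refine mem_nbrs_of_mem ?_ hw.1 hwc
        rintro rfl
        exact hu.2.2 hc
      rcases hXY c hcg hc with h | h
      · exact ⟨c, h, hwc⟩
      · obtain ⟨x, hx, hex⟩ := mem_coveredBy.1 he
        exact absurd (near_of_not_covered (hYc c h) hx hex hwe hwc) (hN c h x hx)
    · rintro ⟨e, he, hwe⟩
      refine ⟨e, coveredBy_mono Set.subset_union_right (hXc e he ?_), hwe⟩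
      refine mem_nbrs_of_mem ?_ hw.1 hwe
      rintro rfl
      exact hu.2.2 (hX g he))
  exact ⟨D', h1, h2, fun c hc => Or.inr ⟨g, h3, (hY c hc).1⟩⟩

end

/-! ### Starting a partial witness structure -/

/-- A single tree, or an empty set of edges. -/
structure Stem (k a : ℕ) (M : Memory V) (B : Set (Edge H)) (lab : Edge H → Label)
    (dep : Edge H → ℕ) (L : Set (Edge H)) (β : ℤ) : Prop where
  tree : (L = ∅ ∧ β = 2) ∨ (L.Nonempty ∧ HasTree lab dep L β)
  edges : ∀ x ∈ L, ∀ y ∈ L, x ≠ y → Disjoint x.1 y.1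
  event : ∀ x ∈ L, Event k a M (lab x) x.1 (verts (coveredBy {y | y ∈ L ∧ dep y < dep x}))
  tame : ∀ y ∈ L, y ∈ Tame k a M B

/-- `D` was obtained from a tree with the edges `L` and the balance `β`. -/
structure Started (L : Set (Edge H)) (β : ℤ) (D : Duo H) : Prop where
  left : D.L = L ∨ D.L = ∅
  all : L ⊆ D.L ∪ D.A
  pot : β ≤ D.pot

theorem Started.ext {L : Set (Edge H)} {β : ℤ} {D D' : Duo H} (h : Started L β D) (h' : Ext D D') :
    Started L β D' where
  left := by
    rcases h'.L with h1 | h1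
    · rw [h1]; exact h.left
    · exact Or.inr h1
  all := h.all.trans h'.all
  pot := h.pot.trans h'.pot

theorem Started.cov_L {L : Set (Edge H)} {β : ℤ} {D : Duo H} (h : Started L β D) {c : Edge H}
    (hc : c ∉ coveredBy L) : c ∉ coveredBy D.L := by
  rcases h.left with h1 | h1
  · rwa [h1]
  · rw [h1, mem_coveredBy]; simp

theorem stem_empty (M : Memory V) (B : Set (Edge H)) (lab : Edge H → Label) (dep : Edge H → ℕ) :
    Stem k a M B lab dep ∅ 2 :=
  ⟨Or.inl ⟨rfl, rfl⟩, by simp, by simp, by simp⟩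

theorem Good.stem {M : Memory V} {B : Set (Edge H)} {D : Duo H} (h : Good k a M B D)
    (hL : D.L = ∅) (hA : D.A.Nonempty) : Stem k a M B D.lab D.dep D.A D.pot where
  tree := by
    obtain ⟨β₁, β₂, ⟨-, h1⟩ | ⟨h1, -⟩, h2, h3⟩ := h.tree
    · exact Or.inr ⟨hA, h2.weaken (by omega)⟩
    · rw [hL] at h1; exact absurd h1 Set.not_nonempty_empty
  edges := by have := h.edges; rwa [hL, Set.empty_union] at this
  event := by have := h.event; rwa [hL, Set.empty_union] at this
  tame := by have := h.tame; rwa [hL, Set.empty_union] at this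

/-- Tameness confines covered bad edges to `B`; this is why bad edges discovered later are available
as new nodes. -/
theorem Good.not_covered {M : Memory V} {B : Set (Edge H)} {D : Duo H} (h : Good k a M B D)
    {c : Edge H} (hc : M.IsBad k a c.1) (hcB : c ∉ B) : c ∉ coveredBy (D.L ∪ D.A) := by
  intro hcov
  obtain ⟨y, hy, hcy⟩ := mem_coveredBy.1 hcov
  rcases h.tame y hy c hcy with h1 | h1
  · exact hcB h1
  · exact h1.2 hc

theorem not_mem_coveredBy_insert {T : Set (Edge H)} {c c' g : Edge H} (hc' : c' ∉ coveredBy T)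
    (hg : c ∈ nbrs g) (hd : Disjoint c.1 c'.1) : c' ∉ coveredBy (insert c T) := by
  rw [mem_coveredBy]
  rintro ⟨y, rfl | hy, h⟩
  · rcases h with rfl | h
    · obtain ⟨-, w, -, hw⟩ := hg
      exact Set.disjoint_left.1 hd hw hw
    · obtain ⟨-, w, h1, h2⟩ := h
      exact Set.disjoint_left.1 hd h1 h2
  · exact hc' (mem_coveredBy.2 ⟨y, hy, h⟩)

theorem HasTreeAt.congr {lab lab' : Edge H → Label} {dep dep' : Edge H → ℕ} {A : Set (Edge H)}
    {β : ℤ} {e : Edge H} {n : ℕ} (h : HasTreeAt lab dep A β e n) (hl : ∀ e ∈ A, lab' e = lab e)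
    (hd : ∀ e ∈ A, dep' e = dep e) : HasTreeAt lab' dep' A β e n := by
  obtain ⟨τ, d, h, hx⟩ := h
  exact ⟨τ, d, h.congr hl hd le_rfl, hx⟩

section

variable {M : Memory V} {B : Set (Edge H)} {D : Duo H} {z : Edge H} {ℓ : Label}
  {lab : Edge H → Label} {dep : Edge H → ℕ} {L : Set (Edge H)} {β : ℤ}

theorem Stem.good (h : Stem k a M B lab dep L β) (hL : L.Nonempty) :
    Good k a M B ⟨lab, dep, ∅, L, β⟩ ∧ Started L β ⟨lab, dep, ∅, L, β⟩ where
  left := by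
    refine ⟨?_, by simp, by simpa using h.edges, by simp, by simpa using h.event,
      by simpa using h.tame⟩
    rcases h.tree with ⟨h1, -⟩ | ⟨-, h1⟩
    · exact absurd h1 hL.ne_empty
    · exact ⟨2, β, Or.inl ⟨rfl, rfl⟩, h1, by simp only; omega⟩
  right := ⟨Or.inr rfl, by simp, le_rfl⟩

-- The summand `- 2` is the reserve for joining the new tree with the old one. For `L = ∅` and `β =
-- 2` no joint is needed, and the single node keeps its weight.
open Classical in
theorem Stem.start_far (h : Stem k a M B lab dep L β) (hz : z ∉ coveredBy L)
    (hzB : z ∈ Tame k a M B) (hL : ∀ x ∈ L, ¬ Near x z) (hl : ℓ ≠ .E)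
    (hev : ∀ W, Event k a M ℓ z.1 W) :
    ∃ D, Good k a M B D ∧ D.L = L ∧ D.A = {z} ∧ D.lab z = ℓ ∧ D.pot = β + ℓ.weight - 2 := by
  have hzL : z ∉ L := fun h => hz (Or.inl h)
  have hne : ∀ y ∈ L, y ≠ z := by rintro y hy rfl; exact hzL hy
  refine ⟨⟨Function.update lab z ℓ, Function.update dep z 0, L, {z}, β + ℓ.weight - 2⟩,
    ⟨?_, ?_, ?_, ?_, ?_, ?_⟩, rfl, rfl, Function.update_self _ _ _, rfl⟩
  · refine ⟨β, ℓ.weight, h.tree.imp_right fun h1 => ⟨h1.1, h1.2.congr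
      (fun e he => Function.update_of_ne (hne e he) _ _)
      (fun e he => Function.update_of_ne (hne e he) _ _) le_rfl⟩, ?_, by simp only; omega⟩
    have := hasTree_single (lab := Function.update lab z ℓ) (dep := Function.update dep z 0) (e := z)
      (by rwa [Function.update_self]) (by rw [Function.update_self])
    rwa [Function.update_self] at this
  · simpa using hzL
  · simp only [Set.union_singleton]; exact edges_insert hz h.edges
  · rintro x hx y rfl; exact hL x hx
  · simp only [Set.union_singleton]
    exact events_insert h.event hz (fun y hy hn => absurd hn (hL y hy)) (hev _)
  · rintro y (hy | rfl)
    · exact h.tame y hy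
    · exact hzB

/-- Starting with a monochromatic edge. -/
theorem Stem.start_mono [Finite V] (h : Stem k a M B lab dep L β) (hz : z ∉ coveredBy L)
    (hzB : z ∈ Tame k a M B) (hev : ∀ W, Event k a M .M z.1 W) :
    ∃ D, Good k a M B D ∧ Started L β D ∧ z ∈ D.A := by
  by_cases hL : ∃ x ∈ L, Near x z
  · obtain ⟨x, hx, hn⟩ := hL
    obtain ⟨h1, h2⟩ := h.good ⟨x, hx⟩
    obtain ⟨D, h3, h4, h5⟩ := h1.attach (ℓ := .M) (by simpa using hz) hzB hx hn
      (by simp [Label.weight]) (hev _)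
    exact ⟨D, h3, h2.ext h4, h5⟩
  · push Not at hL
    -- The weight 2 of the label M equals the reserve for the joint.
    obtain ⟨D, h1, h2, h3, -, h4⟩ := h.start_far hz hzB hL (by simp) hev
    refine ⟨D, h1, ⟨Or.inl h2, ?_, ?_⟩, ?_⟩
    · rw [h2]; exact Set.subset_union_left
    · simp only [Label.weight] at h4; omega
    · rw [h3]; rfl

open Classical in
/-- Two disjoint bad edges that intersect `g` become active. -/
theorem Good.attach_pair (h : Good k a M B D) {g c c' : Edge H} {n : ℕ} {m : ℤ}
    (hat : ∀ β, HasTree D.lab D.dep D.A β → HasTreeAt D.lab D.dep D.A (β - m) g n)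
    (hc : c ∈ nbrs g) (hc' : c' ∈ nbrs g) (hd : Disjoint c.1 c'.1)
    (hb : M.IsBad k a c.1) (hb' : M.IsBad k a c'.1) (ht : c ∈ Tame k a M B)
    (ht' : c' ∈ Tame k a M B) (hT : c ∉ coveredBy (D.L ∪ D.A)) (hT' : c' ∉ coveredBy (D.L ∪ D.A))
    (hL : ∀ x ∈ D.L, ¬ Near x c ∧ ¬ Near x c')
    (hA : ∀ y ∈ D.A, (Near y c ∨ Near y c') → D.lab y = .B) :
    ∃ D', Good k a M B D' ∧ D'.A = insert c' (insert c D.A) ∧ D'.L = D.L ∧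
      D'.pot = D.pot + 2 - m := by
  have hcT : c ∉ D.L ∪ D.A := fun h => hT (Or.inl h)
  have hT'' := not_mem_coveredBy_insert hT' hc hd
  have hcT' : c' ∉ insert c (D.L ∪ D.A) := fun h => hT'' (Or.inl h)
  have hne : ∀ y ∈ D.L ∪ D.A, y ≠ c := by rintro y hy rfl; exact hcT hy
  have hne' : ∀ y ∈ insert c (D.L ∪ D.A), y ≠ c' := by rintro y hy rfl; exact hcT' hy
  have hl : ∀ T ⊆ D.L ∪ D.A, ∀ e ∈ T,
      Function.update (Function.update D.lab c .B) c' .B e = D.lab e := fun T hT e he => by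
    rw [Function.update_of_ne (hne' e (Or.inr (hT he))), Function.update_of_ne (hne e (hT he))]
  have hdd : ∀ T ⊆ D.L ∪ D.A, ∀ e ∈ T,
      Function.update (Function.update D.dep c (n + 1)) c' (n + 1) e = D.dep e :=
    fun T hT e he => by
      rw [Function.update_of_ne (hne' e (Or.inr (hT he))), Function.update_of_ne (hne e (hT he))]
  have hlc : Function.update (Function.update D.lab c .B) c' .B c = .B := by
    rw [Function.update_of_ne (hne' c (Or.inl rfl)), Function.update_self]
  refine ⟨⟨Function.update (Function.update D.lab c .B) c' .B,
    Function.update (Function.update D.dep c (n + 1)) c' (n + 1), D.L, insert c' (insert c D.A),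
    D.pot + 2 - m⟩, ⟨?_, ?_, ?_, ?_, ?_, ?_⟩, rfl, rfl, rfl⟩
  · obtain ⟨β₁, β₂, h1, h2, h3⟩ := h.tree
    refine ⟨β₁, β₂ + 2 - m, h1.imp_right fun h1 => ⟨h1.1, h1.2.congr
      (hl _ Set.subset_union_left) (hdd _ Set.subset_union_left) le_rfl⟩, ?_, by simp only; omega⟩
    have h4 := (hat _ h2).congr (hl _ Set.subset_union_right) (hdd _ Set.subset_union_right)
    have h5 := h4.leaf_stay hc (fun h => hcT (Or.inr h)) (by rw [hlc]; simp)
      (by rw [Function.update_of_ne (hne' c (Or.inl rfl)), Function.update_self])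
    have h6 := h5.leaf hc' (fun h => hcT' (h.imp_right Or.inr))
      (by rw [Function.update_self]; simp) (by rw [Function.update_self])
    refine h6.hasTree.weaken ?_
    rw [hlc, Function.update_self]
    simp only [Label.weight]
    omega
  · simp only [Set.disjoint_insert_right]
    exact ⟨fun h => hcT' (Or.inr (Or.inl h)), fun h => hcT (Or.inl h), h.disjoint⟩
  · simp only [Set.union_insert]; exact edges_insert hT'' (edges_insert hT h.edges)
  · rintro x hx u (rfl | rfl | hu)
    · exact (hL x hx).2
    · exact (hL x hx).1
    · exact h.far x hx u hu
  · simp only [Set.union_insert]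
    -- The two new nodes have the same depth and are near each other through `g`, which is allowed
    -- because both are labelled B.
    refine events_insert (events_insert h.event hT ?_ hb) hT'' ?_ hb'
    · rintro u (hu | hu) hn
      · exact absurd hn (hL u hu).1
      · exact Or.inr ⟨hA u hu (Or.inl hn), rfl⟩
    · rintro u (rfl | hu | hu) hn
      · exact Or.inr ⟨Function.update_self _ _ _, rfl⟩
      · exact absurd hn (hL u hu).2
      · refine Or.inr ⟨?_, rfl⟩
        rw [Function.update_of_ne (hne u (Or.inr hu))]
        exact hA u hu (Or.inr hn)
  · rintro u (hu | rfl | rfl | hu)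
    · exact h.tame u (Or.inl hu)
    · exact ht'
    · exact ht
    · exact h.tame u (Or.inr hu)

/-- Starting with three disjoint bad edges that intersect `g`. -/
theorem Stem.start_star [Finite V] (h : Stem k a M B lab dep L β) {g c₁ c₂ b : Edge H}
    (hc : ∀ c, c = c₁ ∨ c = c₂ ∨ c = b →
      c ∈ nbrs g ∧ M.IsBad k a c.1 ∧ c ∈ Tame k a M B ∧ c ∉ coveredBy L)
    (h12 : Disjoint c₁.1 c₂.1) (h1b : Disjoint c₁.1 b.1) (h2b : Disjoint c₂.1 b.1) :
    ∃ D, Good k a M B D ∧ Started L β D ∧ ∃ y ∈ D.A, y = g ∨ y ∈ nbrs g := by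
  by_cases hL : ∃ c, (c = c₁ ∨ c = c₂ ∨ c = b) ∧ ∃ x ∈ L, Near x c
  · obtain ⟨c, hcc, x, hx, hn⟩ := hL
    obtain ⟨g1, g2, g3, g4⟩ := hc c hcc
    obtain ⟨h1, h2⟩ := h.good ⟨x, hx⟩
    obtain ⟨D, h3, h4, h5⟩ := h1.attach (ℓ := .B) (by simpa using g4) g3 hx hn
      (by simp [Label.weight]) g2
    exact ⟨D, h3, h2.ext h4, c, h5, Or.inr g1⟩
  · push Not at hL
    obtain ⟨p1, p2, p3, p4⟩ := hc c₁ (Or.inl rfl)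
    obtain ⟨q1, q2, q3, q4⟩ := hc c₂ (Or.inr (Or.inl rfl))
    obtain ⟨r1, r2, r3, r4⟩ := hc b (Or.inr (Or.inr rfl))
    obtain ⟨D, h1, h2, h3, h4, h5⟩ := h.start_far (ℓ := .B) p4 p3 (hL c₁ (Or.inl rfl)) (by simp)
      fun _ => p2
    -- Three nodes labelled B and the empty node `g` have total weight 2, the same as one
    -- monochromatic edge.
    obtain ⟨D', h6, h7, h8, h9⟩ := h1.attach_pair (g := g) (c := c₂) (c' := b) (m := 1)
      (n := D.dep c₁ + 1)
      (fun β hβ => (hβ.at_mem (by rw [h3]; rfl)).leafE (nbrs_symm p1)) q1 r1 h2b q2 r2 q3 r3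
      (by rw [h2, h3, Set.union_singleton]; exact not_mem_coveredBy_insert q4 p1 h12)
      (by rw [h2, h3, Set.union_singleton]; exact not_mem_coveredBy_insert r4 p1 h1b)
      (by rw [h2]; exact fun x hx => ⟨hL _ (by simp) x hx, hL _ (by simp) x hx⟩)
      (by rw [h3]; rintro y rfl -; exact h4)
    refine ⟨D', h6, ⟨Or.inl (h8.trans h2), ?_, ?_⟩, b, ?_, Or.inr r1⟩
    · rw [h8, h2]; exact Set.subset_union_left
    · simp only [Label.weight] at h5; omega
    · rw [h7]; exact Or.inl rfl

/-- Rule (r1): an unsafe edge intersecting a covered edge and two disjoint uncovered bad edges. -/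
theorem Good.attach_fork [Finite V] (h : Good k a M B D) (hL : D.L = ∅) {f b c₁ c₂ : Edge H}
    (hb : b ∈ coveredBy D.A) (hbf : b ∈ nbrs f)
    (hc : ∀ c, c = c₁ ∨ c = c₂ →
      c ∈ nbrs f ∧ M.IsBad k a c.1 ∧ c ∈ Tame k a M B ∧ c ∉ coveredBy D.A)
    (h12 : Disjoint c₁.1 c₂.1) :
    ∃ D', Good k a M B D' ∧ Ext D D' ∧ ∃ y ∈ D'.A, y = f ∨ y ∈ nbrs f := by
  have hcov : ∀ c, c ∉ coveredBy D.A → c ∉ coveredBy (D.L ∪ D.A) := by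
    intro c; rw [hL, Set.empty_union]; exact id
  by_cases hN : ∃ c, (c = c₁ ∨ c = c₂) ∧ ∃ x ∈ D.A, Near x c
  · obtain ⟨c, hcc, x, hx, hn⟩ := hN
    obtain ⟨g1, g2, g3, g4⟩ := hc c hcc
    obtain ⟨D', h3, h4, h5⟩ := h.attach (ℓ := .B) (hcov c g4) g3 hx hn
      (by simp [Label.weight]) g2
    exact ⟨D', h3, h4, c, h5, Or.inr g1⟩
  · push Not at hN
    obtain ⟨p1, p2, p3, p4⟩ := hc c₁ (Or.inl rfl)
    obtain ⟨q1, q2, q3, q4⟩ := hc c₂ (Or.inr rfl)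
    obtain ⟨y, hy, hyb⟩ := mem_coveredBy.1 hb
    have hyb : b ∈ nbrs y := by
      rcases hyb with rfl | hyb
      · exact absurd ⟨f, nbrs_symm hbf, nbrs_symm p1⟩ (hN c₁ (Or.inl rfl) b hy)
      · exact hyb
    -- The empty nodes at `b` and `f` cost two units, which the two bad edges repay.
    obtain ⟨D', h6, h7, h8, h9⟩ := h.attach_pair (g := f) (c := c₁) (c' := c₂) (m := 2)
      (n := D.dep y + 1 + 1)
      (fun β hβ => by
        have := ((hβ.at_mem hy).leafE hyb).leafE (nbrs_symm hbf)
        rwa [sub_sub] at this) p1 q1 h12 p2 q2 p3 q3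
      (hcov _ p4) (hcov _ q4) (by simp [hL])
      (by
        rintro y hy (hn | hn)
        · exact absurd hn (hN _ (Or.inl rfl) y hy)
        · exact absurd hn (hN _ (Or.inr rfl) y hy))
    refine ⟨D', h6, ⟨?_, ?_, Or.inl h8, by omega⟩, c₂, by rw [h7]; exact Or.inl rfl, Or.inr q1⟩
    · rw [h7]; exact (Set.subset_insert _ _).trans (Set.subset_insert _ _)
    · rw [h7, h8]
      exact Set.union_subset_union_right _ ((Set.subset_insert _ _).trans (Set.subset_insert _ _))

/-- Both trees are joined by an edge that intersects an edge covered by each of them. -/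
theorem Good.join_via [Finite V] (h : Good k a M B D) {f b c : Edge H}
    (hb : b ∈ coveredBy D.L) (hbf : b ∈ nbrs f) (hc : c ∈ coveredBy D.A) (hcf : c ∈ nbrs f)
    (hf : f ∈ Tame k a M B) (hev : ∀ W, Event k a M .U f.1 W) :
    ∃ D', Good k a M B D' ∧ Ext D D' ∧ D'.L = ∅ := by
  obtain ⟨x, hx, hbx⟩ := mem_coveredBy.1 hb
  obtain ⟨y, hy, hcy⟩ := mem_coveredBy.1 hc
  have hxy : ∀ x ∈ D.L, ∀ y ∈ D.A, y ∉ nbrs x := by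
    rintro x hx y hy ⟨hne, w, h1, h2⟩
    exact Set.disjoint_left.1 (h.edges x (Or.inl hx) y (Or.inr hy) hne) h1 h2
  -- If one of the trees covers `f`, at most two empty nodes suffice for the joint, and `f` need not
  -- become active.
  by_cases hfL : f ∈ coveredBy D.L
  · obtain ⟨x', hx', rfl | hfx⟩ := mem_coveredBy.1 hfL
    · rcases hcy with rfl | hcy
      · exact absurd hcf (hxy f hx' c hy)
      · obtain ⟨h1, h2⟩ := h.merge_one hx' hy hcf hcy
        exact ⟨_, h1, h2, rfl⟩
    · rcases hcy with rfl | hcy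
      · obtain ⟨h1, h2⟩ := h.merge_one hx' hy hfx (nbrs_symm hcf)
        exact ⟨_, h1, h2, rfl⟩
      · obtain ⟨h1, h2⟩ := h.merge_two hx' hy hfx hcf hcy
        exact ⟨_, h1, h2, rfl⟩
  by_cases hfA : f ∈ coveredBy D.A
  · obtain ⟨y', hy', rfl | hfy⟩ := mem_coveredBy.1 hfA
    · rcases hbx with rfl | hbx
      · exact absurd (nbrs_symm hbf) (hxy b hx f hy')
      · obtain ⟨h1, h2⟩ := h.merge_one hx hy' hbx hbf
        exact ⟨_, h1, h2, rfl⟩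
    · rcases hbx with rfl | hbx
      · obtain ⟨h1, h2⟩ := h.merge_one hx hy' (nbrs_symm hbf) hfy
        exact ⟨_, h1, h2, rfl⟩
      · obtain ⟨h1, h2⟩ := h.merge_two hx hy' hbx (nbrs_symm hbf) hfy
        exact ⟨_, h1, h2, rfl⟩
  have hbx : b ∈ nbrs x := by
    rcases hbx with rfl | hbx
    · exact absurd (Or.inr ⟨b, hx, nbrs_symm hbf⟩) hfL
    · exact hbx
  have hcy : c ∈ nbrs y := by
    rcases hcy with rfl | hcy
    · exact absurd (Or.inr ⟨c, hy, nbrs_symm hcf⟩) hfA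
    · exact hcy
  -- The label U has weight 0, so the empty nodes at `b` and `c` use exactly the reserved units.
  obtain ⟨D', h1, h2, -, h3⟩ := h.bridge (ℓ := .U)
    (by rw [coveredBy_union]; exact fun h => h.elim hfL hfA) hf hx ⟨b, hbx, hbf⟩ hy ⟨c, hcy, hcf⟩
    (by simp [Label.weight]) (hev _)
  exact ⟨D', h1, h2, h3⟩

end

/-! ### Basic events of untouched unsafe edges -/

theorem Memory.Untouched.acc_eq {M : Memory V} {e : Set V} (h : M.Untouched e) :
    M.record.acc e = M.acc e := by
  ext w; exact and_congr_right fun hw => by rw [h w hw]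

theorem Memory.Untouched.trb_eq {M : Memory V} {e : Set V} (h : M.Untouched e) :
    M.record.trb e = M.trb e := by
  ext w; exact and_congr_right fun hw => by rw [h w hw]

theorem Sound.mono_sample_iff {M : Memory V} {B : Set (Edge H)} (hS : Sound H k a B M) {e S : Set V}
    (h : M.Untouched e) (hSe : S ⊆ e) : Mono M.record.sample S ↔ Mono M.color S :=
  mono_congr fun w hw => (hS.color_eq w (h w (hSe hw))).symm

section

variable {M : Memory V} {B : Set (Edge H)} {f : Edge H} {X : Set (Edge H)}

theorem card_le_of_full (hun : IsUniform H k) (hf : M.Full f.1) {S : Set V}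
    (hS : (M.trb f.1 \ S).ncard < a) : k ≤ (M.acc f.1 ∪ (M.trb f.1 ∩ S)).ncard + a := by
  have h1 : f.1 = (M.acc f.1 ∪ (M.trb f.1 ∩ S)) ∪ (M.trb f.1 \ S) := by
    rw [Set.union_assoc, Set.inter_union_sdiff, hf.acc_union_trb]
  have h2 := Set.ncard_union_le (M.acc f.1 ∪ (M.trb f.1 ∩ S)) (M.trb f.1 \ S)
  rw [← h1, hun f] at h2
  omega

theorem Sound.event_inside [Finite V] (hS : Sound H k a B M) (hun : IsUniform H k)
    (hu : M.IsUnsafe k a f.1)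
    (ht : M.Untouched f.1) {W : Set V} (hm : Mono M.color (M.acc f.1 ∪ (M.trb f.1 ∩ W)))
    (hf : (M.trb f.1 \ W).ncard < a) : Event k a M .Bin f.1 W := by
  simp only [Event]
  rw [ht.acc_eq, ht.trb_eq, hS.mono_sample_iff ht
    (Set.union_subset (M.acc_subset _) fun _ h => h.1.1)]
  exact ⟨hS.unsafe_record hu, hm, card_le_of_full hun hu.1 hf⟩

theorem Sound.event_outside [Finite V] (hS : Sound H k a B M) (hun : IsUniform H k)
    (hu : M.IsUnsafe k a f.1)
    (ht : M.Untouched f.1) {W : Set V} (hm : Mono M.color (M.acc f.1 ∪ (M.trb f.1 \ W)))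
    (hf : (M.trb f.1 ∩ W).ncard < a) : Event k a M .Bout f.1 W := by
  simp only [Event]
  rw [ht.acc_eq, ht.trb_eq, hS.mono_sample_iff ht
    (Set.union_subset (M.acc_subset _) fun _ h => h.1.1)]
  refine ⟨hS.unsafe_record hu, hm, ?_⟩
  have := card_le_of_full (S := Wᶜ) hun hu.1 (by rwa [Set.sdiff_compl])
  rwa [← Set.sdiff_eq] at this

theorem Sound.event_mono (hS : Sound H k a B M) (hf : M.Full f.1)
    (ht : M.Untouched f.1) (hm : Mono M.color f.1) (W : Set V) : Event k a M .M f.1 W :=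
  ⟨fun w hw hu => hf w hw ((hS.mark_uncolored w).2 hu), (hS.mono_sample_iff ht subset_rfl).2 hm⟩

theorem Sound.event_few (hS : Sound H k a B M) (hu : M.IsUnsafe k a f.1)
    (ht : M.Untouched f.1) (h1 : FewInside a M B f) (h2 : FewOutside a M B f) (W : Set V) :
    Event k a M .U f.1 W := by
  refine ⟨hS.unsafe_record hu, ?_⟩
  rw [ht.trb_eq]
  unfold FewInside at h1
  unfold FewOutside at h2
  have := Set.ncard_union_le (M.trb f.1 ∩ verts B) (M.trb f.1 \ verts B)
  rw [Set.inter_union_sdiff] at this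
  omega

end

/-! ### Search areas -/

/-- A bad-component. -/
structure Comp (k a : ℕ) (M : Memory V) (C : Set (Edge H)) : Prop where
  bad : ∀ c ∈ C, M.IsBad k a c.1
  linked : ∀ s ∈ C, Fed {s} C
  tame : C ⊆ Tame k a M C

/-- The unsafe edge `g` may cause an activation of `C`, when approached from `P`. -/
structure Link (k a : ℕ) (M : Memory V) (g : Edge H) (P C : Set (Edge H)) : Prop where
  isUnsafe : M.IsUnsafe k a g.1
  untouched : M.Untouched g.1
  mono : Mono M.color (M.acc g.1 ∪ (M.trb g.1 ∩ verts P))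
  few : (M.trb g.1 \ verts P).ncard < a
  det : ∀ x ∈ nbrs g, M.Determined x.1
  bad_nbrs : ∀ x ∈ nbrs g, M.IsBad k a x.1 → x ∈ P ∪ C
  left : ∃ p ∈ P, p ∈ nbrs g
  right : ∃ c ∈ C, c ∈ nbrs g
  disj : ∀ p ∈ P, ∀ c ∈ C, Disjoint p.1 c.1

/-- Bad-components explored by consecutive activations. -/
inductive Region (k a : ℕ) (M : Memory V) : Set (Edge H) → Prop
  | base {C : Set (Edge H)} (h : Comp k a M C) : Region k a M C
  | link {S P C : Set (Edge H)} {g : Edge H} (h : Region k a M S) (hP : P ⊆ S) (hC : Comp k a M C)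
      (hg : Link k a M g P C) : Region k a M (S ∪ C)

section

variable {M M' : Memory V} {B B' S P C : Set (Edge H)} {g : Edge H}

theorem Comp.later (h : Comp k a M C) (hL : Later H k a M M') : Comp k a M' C :=
  ⟨fun c hc => hL.bad c (h.bad c hc), h.linked,
    fun _ hc => Tame.mono subset_rfl (fun _ => hL.settled) (h.tame hc)⟩

theorem Link.later (h : Link k a M g P C) (hL : Later H k a M M') : Link k a M' g P C := by
  have hf : M.Full g.1 := h.isUnsafe.1
  refine ⟨hL.isUnsafe h.isUnsafe, hL.untouched hf h.untouched, ?_, ?_,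
    fun x hx => hL.determined (h.det x hx), fun x hx hb => h.bad_nbrs x hx
      (hL.bad_of_determined (h.det x hx) hb), h.left, h.right, h.disj⟩
  · rw [hL.acc_eq hf, hL.trb_eq hf, hL.mono_iff hf
      (Set.union_subset (M.acc_subset _) fun _ h => h.1.1)]
    exact h.mono
  · rw [hL.trb_eq hf]; exact h.few

theorem Link.tame (h : Link k a M g P C) (hP : P ⊆ B) (hC : C ⊆ B) : g ∈ Tame k a M B := by
  rintro c (rfl | hc)
  · exact Or.inr h.isUnsafe.settled
  · by_cases hb : M.IsBad k a c.1
    · exact Or.inl ((h.bad_nbrs c hc hb).elim (fun h => hP h) fun h => hC h)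
    · exact Or.inr ⟨h.det c hc, hb⟩

theorem Region.later (h : Region k a M S) (hL : Later H k a M M') : Region k a M' S := by
  induction h with
  | base h => exact .base (h.later hL)
  | link h hP hC hg ih => exact .link ih hP (hC.later hL) (hg.later hL)

theorem Region.bad (h : Region k a M S) : ∀ c ∈ S, M.IsBad k a c.1 := by
  induction h with
  | base h => exact h.bad
  | link h hP hC hg ih => exact fun c hc => hc.elim (ih c) (hC.bad c)

theorem Region.tame (h : Region k a M S) : S ⊆ Tame k a M S := by
  induction h with
  | base h => exact h.tame
  | link h hP hC hg ih =>
    exact Set.union_subset (ih.trans (Tame.mono Set.subset_union_left fun _ h => h))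
      (hC.tame.trans (Tame.mono Set.subset_union_right fun _ h => h))

theorem Comp.cover [Finite V] (h : Comp k a M C) {D : Duo H} (hD : Good k a M B D) (hC : C ⊆ B)
    (hL : ∀ c ∈ C, c ∉ coveredBy D.L) (hA : ∃ c ∈ C, c ∈ coveredBy D.A) :
    ∃ D', Good k a M B D' ∧ Ext D D' ∧ C ⊆ coveredBy D'.A := by
  obtain ⟨c, hc, hcA⟩ := hA
  exact hD.grow (h.linked c hc) (Set.singleton_subset_iff.2 hcA)
    (fun c hc => ⟨h.bad c hc, Tame.mono hC (fun _ h => h) (h.tame hc)⟩) hL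

/-- If one edge of the region is covered, then all of them can be covered. -/
theorem Region.cover [Finite V] (h : Region k a M S) (hun : IsUniform H k) (hS : Sound H k a B' M)
    {D : Duo H} (hD : Good k a M B D) (hSB : S ⊆ B)
    (hL : ∀ s ∈ S, s ∉ coveredBy D.L) (hA : ∃ s ∈ S, s ∈ coveredBy D.A) :
    ∃ D', Good k a M B D' ∧ Ext D D' ∧ S ⊆ coveredBy D'.A := by
  induction h generalizing D with
  | base h => exact h.cover hD hSB hL hA
  | @link S P C g h hP hC hg ih =>
    have hSB' : S ⊆ B := Set.subset_union_left.trans hSB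
    have hCB : C ⊆ B := Set.subset_union_right.trans hSB
    have hgB : g ∈ Tame k a M B := hg.tame (hP.trans hSB') hCB
    have hPL : ∀ s ∈ S, s ∉ coveredBy D.L := fun s hs => hL s (Or.inl hs)
    have hCL : ∀ s ∈ C, s ∉ coveredBy D.L := fun s hs => hL s (Or.inr hs)
    have hSt : ∀ s ∈ S, s ∈ Tame k a M B := fun s hs => Tame.mono hSB' (fun _ h => h) (h.tame hs)
    have hCt : ∀ s ∈ C, s ∈ Tame k a M B := fun s hs => Tame.mono hCB (fun _ h => h) (hC.tame hs)
    obtain ⟨s, hs | hs, hsA⟩ := hA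
    · obtain ⟨D₁, h1, h2, h3⟩ := ih hD hSB' hPL ⟨s, hs, hsA⟩
      have hCL₁ : ∀ s ∈ C, s ∉ coveredBy D₁.L := fun s hs => h2.cov_L (hCL s hs)
      have hfin : ∀ D₂, Good k a M B D₂ → Ext D₁ D₂ → (∃ c ∈ C, c ∈ coveredBy D₂.A) →
          ∃ D', Good k a M B D' ∧ Ext D D' ∧ S ∪ C ⊆ coveredBy D'.A := by
        intro D₂ g1 g2 g3
        obtain ⟨D₃, g4, g5, g6⟩ := hC.cover g1 hCB (fun c hc => g2.cov_L (hCL₁ c hc)) g3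
        exact ⟨D₃, g4, h2.trans (g2.trans g5),
          Set.union_subset (h3.trans (g2.trans g5).cov_A) g6⟩
      by_cases hcA : ∃ c ∈ C, c ∈ coveredBy D₁.A
      · exact hfin D₁ h1 (Ext.refl _) hcA
      push Not at hcA
      obtain ⟨c, hc, hcg⟩ := hg.right
      -- On the way from `P` to `C`, the covered troubled vertices of `g` are those in `verts P`,
      -- which gives the label B_in.
      obtain ⟨D₂, g1, g2, g3⟩ := h1.cross (ℓ := .Bin) (X := P) (Y := C ∩ nbrs g) hS hgB hg.isUnsafe
        hg.untouched (fun x hx => h.bad x (hP hx)) (fun x hx _ => h3 (hP hx)) hg.left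
        (fun c hc => ⟨hc.2, hC.bad c hc.1, hCt c hc.1⟩)
        (fun c hc => by
          rw [coveredBy_union]; exact fun h => h.elim (hCL₁ c hc.1) (hcA c hc.1))
        (fun c hc hb => (hg.bad_nbrs c hc hb).imp_right fun h => ⟨h, hc⟩)
        (by simp [Label.weight])
        (fun W hW => by
          have hW' : ∀ w ∈ M.trb g.1, w ∈ W ↔ w ∈ verts P := by
            rw [← hg.untouched.trb_eq]; exact hW
          refine hS.event_inside hun hg.isUnsafe hg.untouched ?_ ?_
          · refine hg.mono.subset (Set.union_subset_union_right _ ?_)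
            exact fun w hw => ⟨hw.1, (hW' w hw.1).1 hw.2⟩
          · refine lt_of_le_of_lt (Set.ncard_le_ncard ?_ (Set.toFinite _)) hg.few
            exact fun w hw => ⟨hw.1, fun h => hw.2 ((hW' w hw.1).2 h)⟩)
      exact hfin D₂ g1 g2 ⟨c, hc, g3 ⟨hc, hcg⟩⟩
    · obtain ⟨D₁, h1, h2, h3⟩ := hC.cover hD hCB hCL ⟨s, hs, hsA⟩
      have hPL₁ : ∀ s ∈ S, s ∉ coveredBy D₁.L := fun s hs => h2.cov_L (hPL s hs)
      have hfin : ∀ D₂, Good k a M B D₂ → Ext D₁ D₂ → (∃ c ∈ S, c ∈ coveredBy D₂.A) →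
          ∃ D', Good k a M B D' ∧ Ext D D' ∧ S ∪ C ⊆ coveredBy D'.A := by
        intro D₂ g1 g2 g3
        obtain ⟨D₃, g4, g5, g6⟩ := ih g1 hSB' (fun c hc => g2.cov_L (hPL₁ c hc)) g3
        exact ⟨D₃, g4, h2.trans (g2.trans g5),
          Set.union_subset g6 (h3.trans (g2.trans g5).cov_A)⟩
      by_cases hcA : ∃ c ∈ S, c ∈ coveredBy D₁.A
      · exact hfin D₁ h1 (Ext.refl _) hcA
      push Not at hcA
      obtain ⟨p, hp, hpg⟩ := hg.left
      -- In the opposite direction the vertices in `verts C` are covered. Since `P` and `C` are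
      -- vertex-disjoint and contain all bad neighbours of `g`, the remaining troubled vertices are
      -- those in `verts P`, and the same monochromatic set now yields B_out.
      obtain ⟨D₂, g1, g2, g3⟩ := h1.cross (ℓ := .Bout) (X := C) (Y := P ∩ nbrs g) hS hgB hg.isUnsafe
        hg.untouched hC.bad (fun x hx _ => h3 hx) hg.right
        (fun c hc => ⟨hc.2, h.bad c (hP hc.1), hSt c (hP hc.1)⟩)
        (fun c hc => by
          rw [coveredBy_union]; exact fun h => h.elim (hPL₁ c (hP hc.1)) (hcA c (hP hc.1)))
        (fun c hc hb => (hg.bad_nbrs c hc hb).symm.imp_right fun h => ⟨h, hc⟩)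
        (by simp [Label.weight])
        (fun W hW => by
          have hW' : ∀ w ∈ M.trb g.1, w ∈ W ↔ w ∈ verts C := by
            rw [← hg.untouched.trb_eq]; exact hW
          refine hS.event_outside hun hg.isUnsafe hg.untouched ?_ ?_
          · refine hg.mono.subset (Set.union_subset_union_right _ ?_)
            rintro w ⟨hw, hwW⟩
            refine ⟨hw, ?_⟩
            obtain ⟨e, hwe, he⟩ := hS.troubled_bad w hw.2
            have heg : e ∈ nbrs g := by
              refine mem_nbrs_of_mem ?_ hw.1 hwe
              rintro rfl
              exact hg.isUnsafe.2.2 he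
            rcases hg.bad_nbrs e heg he with h | h
            · exact ⟨e, h, hwe⟩
            · exact absurd ((hW' w hw).2 ⟨e, h, hwe⟩) hwW
          · refine lt_of_le_of_lt (Set.ncard_le_ncard ?_ (Set.toFinite _)) hg.few
            rintro w ⟨hw, hwW⟩
            refine ⟨hw, fun ⟨p, hp, hwp⟩ => ?_⟩
            obtain ⟨c, hc, hwc⟩ := (hW' w hw).1 hwW
            exact Set.disjoint_left.1 (hg.disj p hp c hc) hwp hwc)
      exact hfin D₂ g1 g2 ⟨p, hP hp, g3 ⟨hp, hpg⟩⟩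

end

/-- An amortizing configuration was found in the region `R`, and this led to the search
area `T`. -/
inductive Gain (k a : ℕ) (M : Memory V) (R T : Set (Edge H)) : Prop
  | monoBad {m : Edge H} (hm : m ∈ R) (hev : ∀ W, Event k a M .M m.1 W) (hT : T ⊆ R) :
      Gain k a M R T
  | monoUnsafe {g b : Edge H} (hb : b ∈ R) (hbg : b ∈ nbrs g) (hev : ∀ W, Event k a M .M g.1 W)
      (hg : g ∈ Tame k a M T) (hF : Fed (R ∪ (nbrs g ∩ T)) T) : Gain k a M R T
  | star {g b c₁ c₂ : Edge H} (hb : b ∈ R) (hbg : b ∈ nbrs g) (h₁ : c₁ ∈ T) (hg₁ : c₁ ∈ nbrs g)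
      (h₂ : c₂ ∈ T) (hg₂ : c₂ ∈ nbrs g) (h12 : Disjoint c₁.1 c₂.1) (h1b : Disjoint c₁.1 b.1)
      (h2b : Disjoint c₂.1 b.1) (hF : Fed (R ∪ (nbrs g ∩ T)) T) : Gain k a M R T

theorem Gain.cover [Finite V] {M : Memory V} {B B' R T : Set (Edge H)} (h : Gain k a M R T)
    (hun : IsUniform H k) (hS : Sound H k a B' M) {lab : Edge H → Label} {dep : Edge H → ℕ}
    {L : Set (Edge H)} {β : ℤ} (hL : Stem k a M B lab dep L β) (hR : Region k a M R) (hRT : R ⊆ T)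
    (hT : ∀ t ∈ T, M.IsBad k a t.1) (hTt : T ⊆ Tame k a M T) (hTB : T ⊆ B)
    (hTL : ∀ t ∈ T, t ∉ coveredBy L) :
    ∃ D, Good k a M B D ∧ Started L β D ∧ T ⊆ coveredBy D.A := by
  have hTt' : ∀ t ∈ T, t ∈ Tame k a M B := fun t ht => Tame.mono hTB (fun _ h => h) (hTt ht)
  -- One active edge equal or adjacent to `g` is enough: it leads to the bad neighbours of `g`,
  -- among them `b`, from there to the whole region, and finally to the rest of `T`.
  have hfin : ∀ g b : Edge H, b ∈ R → b ∈ nbrs g → Fed (R ∪ (nbrs g ∩ T)) T →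
      (∃ D, Good k a M B D ∧ Started L β D ∧ ∃ y ∈ D.A, y = g ∨ y ∈ nbrs g) →
      ∃ D, Good k a M B D ∧ Started L β D ∧ T ⊆ coveredBy D.A := by
    rintro g b hb hbg hF ⟨D, h1, h2, h3⟩
    obtain ⟨D₁, h4, h5, h6⟩ := h1.cover_nbrs h3 (Y := nbrs g ∩ T)
      (fun c hc => ⟨hc.1, hT c hc.2, hTt' c hc.2⟩) fun c hc => h2.cov_L (hTL c hc.2)
    have h7 := h2.ext h5
    obtain ⟨D₂, h8, h9, h10⟩ := hR.cover hun hS h4 (hRT.trans hTB)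
      (fun s hs => h7.cov_L (hTL s (hRT hs))) ⟨b, hb, h6 ⟨hbg, hRT hb⟩⟩
    have h11 := h7.ext h9
    obtain ⟨D₃, h12, h13, h14⟩ := h8.grow hF (Set.union_subset h10 (h6.trans h9.cov_A))
      (fun c hc => ⟨hT c hc, hTt' c hc⟩) fun c hc => h11.cov_L (hTL c hc)
    exact ⟨D₃, h12, h11.ext h13, h14⟩
  cases h with
  | @monoBad m hm hev hTR =>
    obtain ⟨D, h1, h2, h3⟩ := hL.start_mono (hTL m (hRT hm)) (hTt' m (hRT hm)) hev
    obtain ⟨D₁, h4, h5, h6⟩ := hR.cover hun hS h1 (hRT.trans hTB)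
      (fun s hs => h2.cov_L (hTL s (hRT hs))) ⟨m, hm, Or.inl h3⟩
    exact ⟨D₁, h4, h2.ext h5, hTR.trans h6⟩
  | @monoUnsafe g b hb hbg hev hg hF =>
    refine hfin g b hb hbg hF ?_
    -- If the old tree covers `g`, then `g` cannot start a new tree; but in this case `b` is near
    -- the old tree and can be attached to it.
    by_cases hgL : g ∈ coveredBy L
    · obtain ⟨x, hx, rfl | hgx⟩ := mem_coveredBy.1 hgL
      · exact absurd (Or.inr ⟨g, hx, hbg⟩) (hTL b (hRT hb))
      · obtain ⟨h1, h2⟩ := hL.good ⟨x, hx⟩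
        obtain ⟨D, h3, h4, h5⟩ := h1.attach (ℓ := .B) (by simpa using hTL b (hRT hb))
          (hTt' b (hRT hb)) hx ⟨g, hgx, nbrs_symm hbg⟩ (by simp [Label.weight]) (hT b (hRT hb))
        exact ⟨D, h3, h2.ext h4, b, h5, Or.inr hbg⟩
    · obtain ⟨D, h1, h2, h3⟩ := hL.start_mono hgL (Tame.mono hTB (fun _ h => h) hg) hev
      exact ⟨D, h1, h2, g, h3, Or.inl rfl⟩
  | @star g b c₁ c₂ hb hbg h₁ hg₁ h₂ hg₂ h12 h1b h2b hF =>
    refine hfin g b hb hbg hF (hL.start_star ?_ h12 h1b h2b)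
    rintro c (rfl | rfl | rfl)
    · exact ⟨hg₁, hT _ h₁, hTt' _ h₁, hTL _ h₁⟩
    · exact ⟨hg₂, hT _ h₂, hTt' _ h₂, hTL _ h₂⟩
    · exact ⟨hbg, hT _ (hRT hb), hTt' _ (hRT hb), hTL _ (hRT hb)⟩

/-! ### Exploration of search areas -/

theorem disjoint_of_not_nbrs {e f : Edge H} (hne : e ≠ f) (h : f ∉ nbrs e) : Disjoint e.1 f.1 :=
  Set.disjoint_left.2 fun _ h1 h2 => h (mem_nbrs_of_mem hne h1 h2)

/-- In a set that is reached from pairwise intersecting edges, everything is reached from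
each element. -/
theorem Fed.of_meet {T₀ T : Set (Edge H)} (h : Fed T₀ T)
    (hm : ∀ x ∈ T₀, ∀ y ∈ T₀, x ≠ y → y ∈ nbrs x) (hT : T₀ ⊆ T) {s : Edge H} (hs : s ∈ T) :
    Fed {s} T := by
  intro Y hY hc
  by_cases hx : ∃ x ∈ T₀, x ∈ Y
  · obtain ⟨x, hx, hxY⟩ := hx
    refine h Y (fun y hy => ?_) hc
    by_cases hxy : x = y
    · rwa [← hxy]
    · exact hc x hxY (hT hx) y (hT hy) (hm x hx y hy hxy)
  · push Not at hx
    -- By symmetry of adjacency, the complement of `Y` is closed as well; containing `T₀`, it would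
    -- contain all of `T`, including `s`.
    have := h Yᶜ hx fun u hu huT t ht htu htY => hu (hc t htY ht u huT (nbrs_symm htu))
    exact absurd (hY rfl) (this hs)

/-- The state `W` of an exploration that was started with the explored edges `X₀` and the memory
`M₀`; `B` is the set of bad edges known before. -/
structure Area (k a : ℕ) (X₀ B : Set (Edge H)) (M₀ : Memory V) (W : Work H) : Prop where
  base : B ⊆ X₀
  closed : ∀ b ∈ B, nbrs b ⊆ X₀
  progress : Progress H k a M₀ W.mem
  sound : Sound H k a B W.mem
  explo : Explo k a W.mem W.explored (B ∪ W.bad) ∅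
  sub : X₀ ⊆ W.explored
  fresh : ∀ g ∈ W.bad, g ∉ X₀
  det : ∀ g ∈ W.bad, W.mem.Determined g.1
  uns : ∀ g ∈ W.uns, g ∉ X₀ ∧ g ∈ W.explored ∧ W.mem.IsUnsafe k a g.1 ∧ ∃ c ∈ W.bad, g ∈ nbrs c
  all : ∀ g ∈ W.explored, g ∉ X₀ → W.mem.IsUnsafe k a g.1 → g ∈ W.uns

/-! ### Areas explored beyond the known bad edges -/

section

variable {X₀ B : Set (Edge H)} {M₀ M : Memory V} {W W' W₁ : Work H} {g q f : Edge H}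

theorem Area.bad (h : Area k a X₀ B M₀ W) {t : Edge H} (ht : t ∈ W.bad) : W.mem.IsBad k a t.1 :=
  h.explo.bad t (Or.inl (Or.inr ht))

theorem Area.known (h : Area k a X₀ B M₀ W) {t : Edge H} (ht : t ∈ W.explored) :
    t ∈ B ∨ t ∈ W.bad ∨ W.mem.Settled k a t.1 := by
  rcases h.explo.known t ht with ((h1 | h1) | h1) | h1
  · exact Or.inl h1
  · exact Or.inr (Or.inl h1)
  · exact h1.elim
  · exact Or.inr (Or.inr h1)

theorem Area.tame (h : Area k a X₀ B M₀ W) : W.bad ⊆ Tame k a W.mem W.bad := by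
  rintro t ht c (rfl | hc)
  · exact Or.inl ht
  · rcases h.known (h.explo.nbrs t (Or.inr ht) hc) with h1 | h1
    · exact absurd (h.closed c h1 (nbrs_symm hc)) (h.fresh t ht)
    · exact h1

theorem Area.full (h : Area k a X₀ B M₀ W) {t : Edge H} (ht : t ∈ W.bad) : W.mem.Full t.1 :=
  (h.det t ht).full_of_not_safe (h.bad ht).2

/-- The edges of `B` and their neighbours belong to `X₀`, so an edge outside `X₀` avoids `verts B`
entirely. -/
theorem Area.not_mem_base (h : Area k a X₀ B M₀ W) (hg : g ∉ X₀) {w : V} (hw : w ∈ g.1) :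
    w ∉ verts B := by
  rintro ⟨b, hb, hwb⟩
  by_cases hbg : b = g
  · exact hg (hbg ▸ h.base hb)
  · exact hg (h.closed b hb (mem_nbrs_of_mem hbg hwb hw))

theorem Area.fewInside (h : Area k a X₀ B M₀ W) (ha : 0 < a) (hg : g ∉ X₀) (M : Memory V) :
    FewInside a M B g := by
  have : M.trb g.1 ∩ verts B = ∅ :=
    Set.eq_empty_of_forall_notMem fun w hw => h.not_mem_base hg hw.1.1 hw.2
  unfold FewInside
  rw [this, Set.ncard_empty]; exact ha

/-- A new edge has no troubled vertex in `verts B`, which excludes the third case of `unsafe_cases`.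
-/
theorem Area.untouched_or_inert (h : Area k a X₀ B M₀ W) (ha : 0 < a) (hg : g ∉ X₀)
    (hu : W.mem.IsUnsafe k a g.1) : W.mem.Untouched g.1 ∨ Inert k a W.mem g :=
  (h.sound.unsafe_cases g hu).imp_right fun h1 => h1.resolve_right fun h2 =>
    h2 (h.fewInside ha hg _)

theorem Area.inspect [Finite V] (h : Area k a X₀ B M₀ W) (hp : Progress H k a W.mem M) :
    Area k a X₀ B M₀ ⟨M, W.explored, W.bad, W.uns⟩ := by
  obtain ⟨h1, h2⟩ := hp.sound_later h.sound
  refine ⟨h.base, h.closed, h.progress.trans hp, h1, h.explo.later h2, h.sub, h.fresh,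
    fun g hg => h2.determined (h.det g hg), fun g hg => ?_, fun g hg hgX hu => ?_⟩
  · obtain ⟨g1, g2, g3, g4⟩ := h.uns g hg
    exact ⟨g1, g2, h2.isUnsafe g3, g4⟩
  · exact h.all g hg hgX (h.explo.unsafe_of_later h2 hg hu)

theorem Area.trace [Finite V] (h : Area k a X₀ B M₀ W) (hT : Trace k a ∅ W W')
    (hS : Sound H k a B W'.mem)
    (hE : Explo k a W'.mem W'.explored (B ∪ W'.bad) ∅) : Area k a X₀ B M₀ W' := by
  have hL := (hT.progress.sound_later h.sound).2
  refine ⟨h.base, h.closed, h.progress.trans hT.progress, hS, hE, h.sub.trans hT.explored,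
    fun g hg => ?_, fun g hg => ?_, fun g hg => ?_, fun g hg hgX hu => ?_⟩
  · rcases hT.bad_new g hg with h1 | h1 | h1
    · exact h.fresh g h1
    · exact h1.elim
    · exact fun h2 => h1.1 (h.sub h2)
  · rcases hT.bad_new g hg with h1 | h1 | h1
    · exact hL.determined (h.det g h1)
    · exact h1.elim
    · exact h1.2
  · rcases hT.uns_new g hg with h1 | ⟨h1, h2⟩
    · obtain ⟨g1, g2, g3, c, hc, g4⟩ := h.uns g h1
      exact ⟨g1, hT.explored g2, hL.isUnsafe g3, c, hT.bad hc, g4⟩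
    · exact ⟨fun h3 => h1 (h.sub h3), h2⟩
  · rcases hT.uns_all g hg with h1 | h1
    · exact hT.uns (h.all g h1 hgX (h.explo.unsafe_of_later hL h1 hu))
    · exact h1 hu

/-- The outcome `W₁` of expanding via `q`, starting from `W`, when the bad edges and surrounding
unsafe edges are collected anew. -/
structure Fresh (k a : ℕ) (B : Set (Edge H)) (q : Edge H) (W W₁ : Work H) : Prop where
  later : Later H k a W.mem W₁.mem
  not_explored : ∀ c ∈ W₁.bad, c ∉ W.explored
  nbrs : ∀ g ∈ nbrs q, g ∈ B ∨ g ∈ W.bad ∨ g ∈ W₁.bad ∨ W₁.mem.Settled k a g.1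
  fed : Fed (LocalColoring.nbrs q ∩ W₁.bad) W₁.bad
  tame : W₁.bad ⊆ Tame k a W₁.mem W₁.bad
  apart : ∀ p ∈ W.bad, ∀ c ∈ W₁.bad, Disjoint p.1 c.1
  uns : ∀ g ∈ W₁.uns, g ∉ W.explored ∧ W₁.mem.IsUnsafe k a g.1 ∧ ∃ c ∈ W₁.bad,
    g ∈ LocalColoring.nbrs c

/-- Everything that meets `W.bad` is explored already, so the bad edges collected anew are disjoint
from the old ones and form a closed set by themselves. -/
theorem ExpandFresh.area_fresh [Finite V] (hx : ExpandFresh k a q W W₁) (h : Area k a X₀ B M₀ W) :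
    Area k a X₀ B M₀ ⟨W₁.mem, W₁.explored, W.bad ∪ W₁.bad, W.uns ∪ W₁.uns⟩ ∧
      Fresh k a B q W W₁ := by
  have hx' : ExpandVia k a q ⟨W.mem, W.explored, ∅, ∅⟩ W₁ := hx
  obtain ⟨h1, h2, h3, h4, h5⟩ := hx'.spec (S₀ := B ∪ W.bad) h.sound
    (by simp only [Set.union_empty]; exact h.explo)
  have hL := (h3.progress.sound_later h.sound).2
  have hT : Trace k a ∅ W ⟨W₁.mem, W₁.explored, W.bad ∪ W₁.bad, W.uns ∪ W₁.uns⟩ := by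
    refine ⟨h3.progress, h3.explored, Set.subset_union_left, ?_, Set.subset_union_left, ?_, ?_⟩
    · rintro g (hg | hg)
      · exact Or.inl hg
      · exact Or.inr ((h3.bad_new g hg).resolve_left fun h => h.elim)
    · rintro g (hg | hg)
      · exact Or.inl hg
      · obtain ⟨g1, g2, g3, c, hc, g4⟩ := (h3.uns_new g hg).resolve_left fun h => h.elim
        exact Or.inr ⟨g1, g2, g3, c, Or.inr hc, g4⟩
    · exact fun g hg => (h3.uns_all g hg).imp_right fun h hu => Or.inr (h hu)
  have hA := h.trace hT h1 (by simp only [← Set.union_assoc]; exact h2)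
  have hne : ∀ c ∈ W₁.bad, c ∉ W.explored := fun c hc =>
    (((h3.bad_new c hc).resolve_left fun h => h.elim).resolve_left fun h => h.elim).1
  have hap : ∀ p ∈ W.bad, ∀ c ∈ W₁.bad, Disjoint p.1 c.1 := fun p hp c hc =>
    disjoint_of_not_nbrs (by rintro rfl; exact hne p hc (h.explo.sub (Or.inl (Or.inr hp))))
      fun hpc => hne c hc (h.explo.nbrs p (Or.inr hp) hpc)
  refine ⟨hA, hL, hne, fun g hg => ?_, ?_, ?_, hap, ?_⟩
  · rcases h4 g hg with ((h6 | h6) | h6) | h6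
    · exact Or.inl h6
    · exact Or.inr (Or.inl h6)
    · exact Or.inr (Or.inr (Or.inl h6))
    · exact Or.inr (Or.inr (Or.inr h6))
  · simpa using h5
  · intro c hc x hx
    rcases hA.tame (Or.inr hc) x hx with (h6 | h6) | h6
    · rcases hx with rfl | hx
      · exact Or.inl hc
      · obtain ⟨-, w, w1, w2⟩ := hx
        exact absurd w1 (Set.disjoint_left.1 (hap x h6 c hc) w2)
    · exact Or.inl h6
    · exact Or.inr h6
  · intro g hg
    obtain ⟨g1, g2, g3, g4⟩ := (h3.uns_new g hg).resolve_left fun h => h.elim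
    exact ⟨g1, g3, g4⟩

/-- The bad neighbours of `q` outside `P` pairwise intersect, so only one bad-component is reached,
and it is connected from each of its edges. -/
theorem Fresh.comp (h : Fresh k a B q W W₁) (hb : ∀ c ∈ W₁.bad, W₁.mem.IsBad k a c.1)
    {P : Set (Edge H)} (hd : ∀ x ∈ LocalColoring.nbrs q, W.mem.Determined x.1)
    (hm : ¬ W.mem.TwoDisjointBad k a q P) (hP : ∀ c ∈ W₁.bad, c ∉ P) :
    Comp k a W₁.mem W₁.bad := by
  refine ⟨hb, fun s hs => h.fed.of_meet ?_ Set.inter_subset_right hs, h.tame⟩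
  rintro x ⟨hx, hxC⟩ y ⟨hy, hyC⟩ hne
  by_contra hn
  exact hm (h.later.twoDisjointBad hd ⟨x, hx, y, hy, hP x hxC, hP y hyC, hb x hxC, hb y hyC,
    disjoint_of_not_nbrs hne hn⟩)

/-- The bad neighbours of `g` outside `A` pairwise intersect, and they will not be expanded. -/
structure Cleared (k a : ℕ) (M : Memory V) (A : Set (Edge H)) (g : Edge H) : Prop where
  meet : ¬ M.TwoDisjointBad k a g A
  inactive : ¬ Mono M.color (M.acc g.1 ∪ (M.trb g.1 ∩ verts A)) ∨ a ≤ (M.trb g.1 \ verts A).ncard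

/-- If all bad edges intersected by `g` belong to `S`, then the troubled vertices of `g` do so. -/
theorem Sound.union_eq {S : Set (Edge H)} (hS : Sound H k a B M) (hu : M.IsUnsafe k a g.1)
    (h : ∀ x ∈ nbrs g, M.IsBad k a x.1 → x ∈ S) : M.acc g.1 ∪ (M.trb g.1 ∩ verts S) = g.1 := by
  rw [Set.inter_eq_left.2, Memory.Full.acc_union_trb hu.1]
  intro w hw
  obtain ⟨e, hwe, he⟩ := hS.troubled_bad w hw.2
  exact ⟨e, h e (mem_nbrs_of_mem (by rintro rfl; exact hu.2.2 he) hw.1 hwe) he, hwe⟩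

theorem Cleared.of_nbrs [Finite V] {S : Set (Edge H)} (hS : Sound H k a B M)
    (hu : M.IsUnsafe k a g.1)
    (hm : ¬ Mono M.color g.1) (h : ∀ x ∈ nbrs g, M.IsBad k a x.1 → x ∈ S) : Cleared k a M S g := by
  refine ⟨?_, Or.inl (by rwa [hS.union_eq hu h])⟩
  rintro ⟨x, hx, -, -, hxS, -, hb, -⟩
  exact hxS (h x hx hb)

theorem Cleared.later (h : Cleared k a W.mem B g) (hL : Later H k a W.mem M)
    (hu : W.mem.IsUnsafe k a g.1) (hd : ∀ x ∈ nbrs g, W.mem.Determined x.1) :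
    Cleared k a M B g := by
  refine ⟨fun ht => h.meet (hL.twoDisjointBad hd ht), ?_⟩
  rw [hL.acc_eq hu.1, hL.trb_eq hu.1, hL.mono_iff hu.1
    (Set.union_subset (Memory.acc_subset _ _) fun _ h => h.1.1)]
  exact h.inactive

/-- If `T` contains a bad neighbour of `g` outside `S`, then by tameness it contains all of them, as
they pairwise intersect; then the set in `inactive` is the whole of `g`, which is not monochromatic.
Otherwise `verts T` contains no troubled vertex of `g` beyond those in `verts S`. -/
theorem Cleared.mono [Finite V] {S T : Set (Edge H)} (h : Cleared k a M S g) (hS : Sound H k a B M)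
    (hu : M.IsUnsafe k a g.1) (hm : ¬ Mono M.color g.1) (hST : S ⊆ T) (hT : T ⊆ Tame k a M T) :
    Cleared k a M T g := by
  by_cases hx : ∃ x ∈ nbrs g, M.IsBad k a x.1 ∧ x ∉ S ∧ x ∈ T
  · obtain ⟨x, hx, hxb, hxS, hxT⟩ := hx
    refine Cleared.of_nbrs hS hu hm fun y hy hyb => ?_
    by_cases hyS : y ∈ S
    · exact hST hyS
    by_cases hxy : y = x
    · rwa [hxy]
    rcases hT hxT y (Or.inr (by
      by_contra hn
      exact h.meet ⟨x, hx, y, hy, hxS, hyS, hxb, hyb, disjoint_of_not_nbrs (Ne.symm hxy) hn⟩)) with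
      h1 | h1
    · exact h1
    · exact absurd hyb h1.2
  · push Not at hx
    refine ⟨fun ⟨x, hx, y, hy, h1, h2, h3⟩ => h.meet ⟨x, hx, y, hy, fun h => h1 (hST h),
      fun h => h2 (hST h), h3⟩, h.inactive.imp ?_ fun h1 => h1.trans ?_⟩
    · exact fun h1 h2 => h1 (h2.subset (Set.union_subset_union_right _
        (Set.inter_subset_inter_right _ (verts_mono hST))))
    · refine Set.ncard_le_ncard ?_ (Set.toFinite _)
      rintro w ⟨hw, hwS⟩
      refine ⟨hw, fun _ => ?_⟩
      obtain ⟨e, hwe, he⟩ := hS.troubled_bad w hw.2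
      have heg : e ∈ nbrs g := mem_nbrs_of_mem (by rintro rfl; exact hu.2.2 he) hw.1 hwe
      have heS : e ∉ S := fun h => hwS ⟨e, h, hwe⟩
      rename_i hwT
      obtain ⟨t, ht, hwt⟩ := hwT
      by_cases hte : t = e
      · exact hx e heg he heS (hte ▸ ht)
      · rcases hT ht e (Or.inr (mem_nbrs_of_mem hte hwt hwe)) with h1 | h1
        · exact hx e heg he heS h1
        · exact h1.2 he

/-- An unsafe edge that waits for being processed by the search, after it was reached from `P`. -/
structure Pending (k a : ℕ) (M : Memory V) (g : Edge H) (P : Set (Edge H)) : Prop where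
  isUnsafe : M.IsUnsafe k a g.1
  untouched : M.Untouched g.1
  mono : Mono M.color (M.acc g.1 ∪ (M.trb g.1 ∩ verts P))
  few : (M.trb g.1 \ verts P).ncard < a
  det : ∀ x ∈ nbrs g, M.Determined x.1
  meet : ¬ M.TwoDisjointBad k a g P
  left : ∃ p ∈ P, p ∈ nbrs g

theorem Pending.later {P : Set (Edge H)} (h : Pending k a W.mem g P) (hL : Later H k a W.mem M) :
    Pending k a M g P := by
  have hf : W.mem.Full g.1 := h.isUnsafe.1
  refine ⟨hL.isUnsafe h.isUnsafe, hL.untouched hf h.untouched, ?_, ?_,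
    fun x hx => hL.determined (h.det x hx), fun ht => h.meet (hL.twoDisjointBad h.det ht), h.left⟩
  · rw [hL.acc_eq hf, hL.trb_eq hf, hL.mono_iff hf
      (Set.union_subset (Memory.acc_subset _ _) fun _ h => h.1.1)]
    exact h.mono
  · rw [hL.trb_eq hf]; exact h.few

/-- A bad neighbour of `q` found earlier and outside `P` would be disjoint from the new ones,
contrary to `meet`; so `P` and the new component contain all bad neighbours of `q`. -/
theorem Fresh.link [Finite V] {P : Set (Edge H)} (h : Fresh k a B q W W₁)
    (hb : ∀ c ∈ W₁.bad, W₁.mem.IsBad k a c.1) (hp : Pending k a W.mem q P) (hP : P ⊆ W.bad)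
    (hqB : ∀ b ∈ B, b ∉ LocalColoring.nbrs q) (hC : ∃ c ∈ W₁.bad, c ∈ LocalColoring.nbrs q)  :
    Link k a W₁.mem q P W₁.bad := by
  have hp' := hp.later h.later
  refine ⟨hp'.isUnsafe, hp'.untouched, hp'.mono, hp'.few, hp'.det, fun x hx hxb => ?_, hp'.left, hC,
    fun p hp c hc => h.apart p (hP hp) c hc⟩
  rcases h.nbrs x hx with h1 | h1 | h1 | h1
  · exact absurd hx (hqB x h1)
  · by_contra hn
    obtain ⟨c, hc, hcq⟩ := hC
    have hcP : c ∉ P := fun h2 => by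
      obtain ⟨-, w, -, hw⟩ := hcq
      exact Set.disjoint_left.1 (h.apart c (hP h2) c hc) hw hw
    exact hp'.meet ⟨x, hx, c, hcq, fun h => hn (Or.inl h), hcP, hxb, hb c hc, h.apart x h1 c hc⟩
  · exact Or.inr h1
  · exact absurd hxb h1.2

/-- The bad edges of a search area are connected with each other. -/
def Joined (k a : ℕ) (M : Memory V) (f : Edge H) (A : Set (Edge H)) : Prop :=
  Region k a M A ∧ ∃ c ∈ A, c ∈ nbrs f

/-- The invariant of the search from `f`; `Q` is the set of the unsafe edges to be processed. -/
structure Searching (k a : ℕ) (X₀ B : Set (Edge H)) (M₀ : Memory V) (f : Edge H)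
    (Q : Set (Edge H)) (W : Work H) : Prop where
  area : Area k a X₀ B M₀ W
  joined : W.bad = ∅ ∨ Joined k a W.mem f W.bad
  not_mono : ∀ e ∈ W.bad, ¬ Mono W.mem.color e.1
  checked : ∀ g ∈ W.uns, (∀ x ∈ nbrs g, W.mem.Determined x.1) ∧ ¬ Mono W.mem.color g.1 ∧
    (g ∈ Q ∨ Cleared k a W.mem W.bad g)
  pending : ∀ g ∈ Q, (g = f ∧ W.bad = ∅) ∨ (g ∉ X₀ ∧ ∃ P ⊆ W.bad, Pending k a W.mem g P)
  done : f ∈ Q ∨ ∀ g ∈ nbrs f, g ∈ B ∨ g ∈ W.bad ∨ W.mem.Settled k a g.1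

/-- The search from `f` found an amortizing configuration. -/
structure Found (k a : ℕ) (X₀ B : Set (Edge H)) (M₀ : Memory V) (f : Edge H) (W : Work H) :
    Prop where
  area : Area k a X₀ B M₀ W
  gain : ∃ R ⊆ W.bad, Joined k a W.mem f R ∧ Gain k a W.mem R W.bad
  done : ∀ g ∈ nbrs f, g ∈ B ∨ g ∈ W.bad ∨ W.mem.Settled k a g.1

/-- The assumptions on the edge `f` from which a search is started. -/
structure Target (k a : ℕ) (X₀ B : Set (Edge H)) (M₀ : Memory V) (f : Edge H) : Prop where
  mem : f ∈ X₀
  det : ∀ g ∈ nbrs f, M₀.Determined g.1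
  meet : ¬ M₀.TwoDisjointBad k a f B
  sound : Sound H k a B M₀

/-! ### One step of the search -/

section Step

variable {Q : Set (Edge H)}

/-- The expansion via `f` itself yields a single bad-component. Every other expansion reaches
nothing, or a component that the pending edge `q` links to the region found before. -/
theorem Searching.expand [Finite V] (h : Searching k a X₀ B M₀ f Q W) (hf : Target k a X₀ B M₀ f)
    (hq : q ∈ Q)
    (hx : ExpandFresh k a q W W₁) :
    (W.bad ∪ W₁.bad = ∅ ∨ Joined k a W₁.mem f (W.bad ∪ W₁.bad)) ∧
    (f = q ∨ ∀ g ∈ nbrs f, g ∈ B ∨ g ∈ W.bad ∨ W.mem.Settled k a g.1) ∧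
    ((q = f ∧ W.bad = ∅) ∨ q ∉ X₀) := by
  obtain ⟨hA, hF⟩ := hx.area_fresh h.area
  have hb : ∀ c ∈ W₁.bad, W₁.mem.IsBad k a c.1 := fun c hc => hA.bad (Or.inr hc)
  have hempty : (∀ c ∈ W₁.bad, c ∉ nbrs q) → W₁.bad = ∅ := fun hc => by
    refine Set.subset_empty_iff.1 (hF.fed ∅ ?_ (by simp))
    rintro x ⟨h1, h2⟩
    exact hc x h2 h1
  have hdone : f = q ∨ ∀ g ∈ nbrs f, g ∈ B ∨ g ∈ W.bad ∨ W.mem.Settled k a g.1 := by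
    rcases h.done with h1 | h1
    · rcases h.pending f h1 with ⟨-, h2⟩ | ⟨h2, -⟩
      · rcases h.pending q hq with ⟨h3, -⟩ | ⟨-, P, hP, h3⟩
        · exact Or.inl h3.symm
        · obtain ⟨p, hp, -⟩ := h3.left
          rw [h2] at hP
          exact (hP hp).elim
      · exact absurd hf.mem h2
    · exact Or.inr h1
  rcases h.pending q hq with ⟨rfl, h2⟩ | ⟨hqX, P, hP, h2⟩
  · refine ⟨?_, hdone, Or.inl ⟨rfl, h2⟩⟩
    rw [h2, Set.empty_union]
    by_cases hc : ∃ c ∈ W₁.bad, c ∈ nbrs q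
    · have hL := (h.area.progress.sound_later hf.sound).2
      exact Or.inr ⟨.base (hF.comp hb (P := B) (fun x hx => hL.determined (hf.det x hx))
        (fun ht => hf.meet (hL.twoDisjointBad hf.det ht))
        fun c hc hcB => hA.fresh c (Or.inr hc) (h.area.base hcB)), hc⟩
    · push Not at hc
      exact Or.inl (hempty hc)
  · refine ⟨?_, hdone, Or.inr hqX⟩
    have hJ : Joined k a W.mem f W.bad := h.joined.resolve_left fun h3 => by
      obtain ⟨p, hp, -⟩ := h2.left
      rw [h3] at hP
      exact hP hp
    have hL := hF.later
    by_cases hc : ∃ c ∈ W₁.bad, c ∈ nbrs q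
    · obtain ⟨c, hc', hcf⟩ := hJ.2
      refine Or.inr ⟨.link (hJ.1.later hL) hP (hF.comp hb h2.det h2.meet ?_)
        (hF.link hb h2 hP ?_ hc), c, Or.inl hc', hcf⟩
      · exact fun c hc hcP => hF.not_explored c hc (h.area.explo.sub (Or.inl (Or.inr (hP hcP))))
      · exact fun b hb hbq => hqX (h.area.closed b hb (nbrs_symm hbq))
    · push Not at hc
      rw [hempty hc, Set.union_empty]
      exact Or.inr ⟨hJ.1.later hL, hJ.2⟩

theorem Searching.found_mono [Finite V] (h : Searching k a X₀ B M₀ f Q W)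
    (hf : Target k a X₀ B M₀ f)
    (hq : q ∈ Q) (hx : ExpandFresh k a q W W₁) (hg : g ∈ W₁.bad) (hm : Mono W₁.mem.color g.1) :
    Found k a X₀ B M₀ f ⟨W₁.mem, W₁.explored, W.bad ∪ W₁.bad, W.uns ∪ W₁.uns⟩ := by
  obtain ⟨h1, h2, -⟩ := h.expand hf hq hx
  obtain ⟨hA, hF⟩ := hx.area_fresh h.area
  have hg' : g ∈ W.bad ∪ W₁.bad := Or.inr hg
  refine ⟨hA, ⟨_, subset_rfl, h1.resolve_left fun h => ?_, .monoBad hg' ?_ subset_rfl⟩, ?_⟩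
  · rw [h] at hg'; exact hg'
  · exact hA.sound.event_mono (hA.full hg') (hA.sound.bad_untouched g (hA.bad hg')) hm
  · intro x hxf
    rcases h2 with rfl | h2
    · rcases hF.nbrs x hxf with h3 | h3 | h3 | h3
      · exact Or.inl h3
      · exact Or.inr (Or.inl (Or.inl h3))
      · exact Or.inr (Or.inl (Or.inr h3))
      · exact Or.inr (Or.inr h3)
    · rcases h2 x hxf with h3 | h3 | h3
      · exact Or.inl h3
      · exact Or.inr (Or.inl (Or.inl h3))
      · exact Or.inr (Or.inr (hF.later.settled h3))

theorem Searching.found_via [Finite V] (h : Searching k a X₀ B M₀ f Q W) (hf : Target k a X₀ B M₀ f)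
    (ha : 0 < a) (hq : q ∈ Q) (hx : ExpandFresh k a q W W₁) (hp : Progress H k a W₁.mem M)
    (hg : g ∈ W₁.uns) (h₂ : Mono M.color g.1 ∨ M.TwoDisjointBad k a g W₁.bad)
    (hv : ExpandVia k a g ⟨M, W₁.explored, W.bad ∪ W₁.bad, W.uns ∪ W₁.uns⟩ W') :
    Found k a X₀ B M₀ f W' := by
  obtain ⟨h1, h2, -⟩ := h.expand hf hq hx
  obtain ⟨hA, hF⟩ := hx.area_fresh h.area
  have hA₁ := hA.inspect hp
  have hL₁ := (hp.sound_later hA.sound).2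
  obtain ⟨s1, s2, s3, s4, s5⟩ := hv.spec (S₀ := B) hA₁.sound hA₁.explo
  have hL₂ := (s3.progress.sound_later hA₁.sound).2
  have hA₂ := hA₁.trace s3 s1 s2
  simp only at hL₂
  obtain ⟨g1, g2, b, hb, g3⟩ := hF.uns g hg
  have hgX : g ∉ X₀ := fun h3 => g1 (h.area.sub h3)
  have hgB : ∀ x ∈ B, x ∉ nbrs g := fun x hxB hxg => hgX (h.area.closed x hxB (nbrs_symm hxg))
  have hu : W'.mem.IsUnsafe k a g.1 := hL₂.isUnsafe (hL₁.isUnsafe g2)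
  have hb' : b ∈ W.bad ∪ W₁.bad := Or.inr hb
  have hJ := h1.resolve_left fun h => by rw [h] at hb'; exact hb'
  have hJ' : Joined k a W'.mem f (W.bad ∪ W₁.bad) := ⟨(hJ.1.later hL₁).later hL₂, hJ.2⟩
  have s5' : Fed (W.bad ∪ W₁.bad ∪ (nbrs g ∩ W'.bad)) W'.bad := s5
  refine ⟨hA₂, ⟨_, s3.bad, hJ', ?_⟩, ?_⟩
  · rcases h₂ with hm | ⟨c₁, hc₁, c₂, hc₂, n1, n2, b1, b2, hd⟩
    · have hm' : Mono W'.mem.color g.1 := (hL₂.mono_iff (hL₁.isUnsafe g2).1 subset_rfl).2 hm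
      refine .monoUnsafe hb' (nbrs_symm g3) (hA₂.sound.event_mono hu.1 ?_ hm') ?_ s5'
      · exact (hA₂.untouched_or_inert ha hgX hu).resolve_right fun hi => hi.not_mono hm'
      · rintro c (rfl | hc)
        · exact Or.inr hu.settled
        · rcases s4 c hc with (h3 | h3) | h3
          · exact absurd hc (hgB c h3)
          · exact Or.inl h3
          · exact Or.inr h3
    · have hT : ∀ c ∈ nbrs g, M.IsBad k a c.1 → c ∈ W'.bad := by
        intro c hc hcb
        rcases s4 c hc with (h3 | h3) | h3
        · exact absurd hc (hgB c h3)
        · exact h3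
        · exact absurd (hL₂.bad c hcb) h3.2
      -- The set `W₁.bad` contains all bad edges intersecting `b`, so the two bad edges outside it
      -- are disjoint from `b`, the third edge of the star.
      have hD : ∀ c ∈ nbrs g, c ∉ W₁.bad → M.IsBad k a c.1 → Disjoint c.1 b.1 := by
        intro c hc hcn hcb
        refine (disjoint_of_not_nbrs (by rintro rfl; exact hcn hb) fun hcb' => ?_).symm
        rcases hF.tame hb c (Or.inr hcb') with h3 | h3
        · exact hcn h3
        · exact (hL₁.settled h3).2 hcb
      exact .star hb' (nbrs_symm g3) (hT c₁ hc₁ b1) hc₁ (hT c₂ hc₂ b2) hc₂ hd (hD c₁ hc₁ n1 b1)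
        (hD c₂ hc₂ n2 b2) s5'
  · intro x hxf
    rcases h2 with rfl | h2
    · rcases hF.nbrs x hxf with h3 | h3 | h3 | h3
      · exact Or.inl h3
      · exact Or.inr (Or.inl (s3.bad (Or.inl h3)))
      · exact Or.inr (Or.inl (s3.bad (Or.inr h3)))
      · exact Or.inr (Or.inr (hL₂.settled (hL₁.settled h3)))
    · rcases h2 x hxf with h3 | h3 | h3
      · exact Or.inl h3
      · exact Or.inr (Or.inl (s3.bad (Or.inl h3)))
      · exact Or.inr (Or.inr (hL₂.settled (hL₁.settled (hF.later.settled h3))))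

theorem Searching.next [Finite V] (h : Searching k a X₀ B M₀ f Q W) (hf : Target k a X₀ B M₀ f)
    (ha : 0 < a) (hq : q ∈ Q) (hx : ExpandFresh k a q W W₁) (hp : Progress H k a W₁.mem M)
    (h₁ : ∀ e ∈ W₁.bad, ¬ Mono W₁.mem.color e.1) (hd : Inspected W₁.uns M)
    (h₂ : ∀ g ∈ W₁.uns, ¬ Mono M.color g.1 ∧ ¬ M.TwoDisjointBad k a g W₁.bad) :
    Searching k a X₀ B M₀ f ((Q \ {q}) ∪ activating a M W₁.bad W₁.uns)
      ⟨M, W₁.explored, W.bad ∪ W₁.bad, W.uns ∪ W₁.uns⟩ := by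
  obtain ⟨h1, h2, -⟩ := h.expand hf hq hx
  obtain ⟨hA, hF⟩ := hx.area_fresh h.area
  have hA₁ := hA.inspect hp
  have hL₁ := (hp.sound_later hA.sound).2
  have hL := hF.later.trans hL₁
  have hCt : W₁.bad ⊆ Tame k a M W₁.bad :=
    hF.tame.trans (Tame.mono subset_rfl fun _ => hL₁.settled)
  refine ⟨hA₁, h1.imp_right fun h => ⟨h.1.later hL₁, h.2⟩, ?_, ?_, ?_, ?_⟩
  · rintro e (he | he) hm
    · exact h.not_mono e he ((hL.mono_iff (h.area.full he) subset_rfl).1 hm)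
    · exact h₁ e he ((hL₁.mono_iff (hA.full (Or.inr he)) subset_rfl).1 hm)
  · rintro g (hg | hg)
    · obtain ⟨g1, g2, g3⟩ := h.checked g hg
      obtain ⟨u1, -, u3, -⟩ := h.area.uns g hg
      have hu : M.IsUnsafe k a g.1 := hL.isUnsafe u3
      have hm : ¬ Mono M.color g.1 := fun hm => g2 ((hL.mono_iff u3.1 subset_rfl).1 hm)
      refine ⟨fun x hx => hL.determined (g1 x hx), hm, ?_⟩
      rcases g3 with g3 | g3
      · by_cases hgq : g = q
        · subst hgq
          -- After the expansion via `g`, all its bad neighbours belong to the area.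
          refine Or.inr (Cleared.of_nbrs hA₁.sound hu hm fun x hx hxb => ?_)
          rcases hF.nbrs x hx with h3 | h3 | h3 | h3
          · exact absurd (h.area.closed x h3 (nbrs_symm hx)) u1
          · exact Or.inl h3
          · exact Or.inr h3
          · exact absurd hxb (hL₁.settled h3).2
        · exact Or.inl (Or.inl ⟨g3, hgq⟩)
      · exact Or.inr ((g3.later hL u3 g1).mono hA₁.sound hu hm Set.subset_union_left hA₁.tame)
    · obtain ⟨u1, u2, u3⟩ := hF.uns g hg
      have hu : M.IsUnsafe k a g.1 := hL₁.isUnsafe u2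
      refine ⟨fun x hx => hd g hg x hx, (h₂ g hg).1, ?_⟩
      by_cases hact : Mono M.color (M.acc g.1 ∪ (M.trb g.1 ∩ verts W₁.bad)) ∧
          (M.trb g.1 \ verts W₁.bad).ncard < a
      · exact Or.inl (Or.inr ⟨hg, hact⟩)
      · have hcl : Cleared k a M W₁.bad g := ⟨(h₂ g hg).2, by
          rw [not_and_or, not_lt] at hact; exact hact⟩
        exact Or.inr (hcl.mono hA₁.sound hu (h₂ g hg).1 Set.subset_union_right hA₁.tame)
  · rintro g (⟨hg, hgq⟩ | ⟨hg, hm, hfew⟩)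
    · rcases h.pending g hg with ⟨rfl, h4⟩ | ⟨h4, P, hP, h5⟩
      · rcases h.pending q hq with ⟨h5, -⟩ | ⟨-, P, hP, h5⟩
        · exact absurd h5.symm hgq
        · obtain ⟨p, hp, -⟩ := h5.left
          rw [h4] at hP
          exact (hP hp).elim
      · exact Or.inr ⟨h4, P, hP.trans Set.subset_union_left, h5.later hL⟩
    · obtain ⟨u1, u2, c, hc, u3⟩ := hF.uns g hg
      have hu : M.IsUnsafe k a g.1 := hL₁.isUnsafe u2
      have hgX : g ∉ X₀ := fun h3 => u1 (h.area.sub h3)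
      refine Or.inr ⟨hgX, W₁.bad, Set.subset_union_right, hu, ?_, hm, hfew,
        fun x hx => hd g hg x hx, (h₂ g hg).2, c, hc, nbrs_symm u3⟩
      -- If `g` were inert, all its bad neighbours would be in the component of `c`, and the
      -- monochromatic set in `hm` would be the whole of `g`, contrary to `h₂`.
      refine (hA₁.untouched_or_inert ha hgX hu).resolve_right fun hi => ?_
      have hcb : M.IsBad k a c.1 := hA₁.bad (Or.inr hc)
      rw [hA₁.sound.union_eq hu] at hm
      · exact (h₂ g hg).1 hm
      · intro x hx hxb
        by_cases hxc : c = x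
        · exact hxc ▸ hc
        refine (hCt hc x (Or.inr ?_)).resolve_right fun h => h.2 hxb
        by_contra hn
        exact hi.meet ⟨c, nbrs_symm u3, x, hx, Set.notMem_empty _, Set.notMem_empty _, hcb, hxb,
          disjoint_of_not_nbrs hxc hn⟩
  · right
    intro x hxf
    rcases h2 with rfl | h2
    · rcases hF.nbrs x hxf with h3 | h3 | h3 | h3
      · exact Or.inl h3
      · exact Or.inr (Or.inl (Or.inl h3))
      · exact Or.inr (Or.inl (Or.inr h3))
      · exact Or.inr (Or.inr (hL₁.settled h3))
    · rcases h2 x hxf with h3 | h3 | h3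
      · exact Or.inl h3
      · exact Or.inr (Or.inl (Or.inl h3))
      · exact Or.inr (Or.inr (hL.settled h3))

end Step

theorem SearchLoop.spec [Finite V] {Q : Set (Edge H)} {b : Bool} (hs : SearchLoop k a Q W W' b)
    (h : Searching k a X₀ B M₀ f Q W) (hf : Target k a X₀ B M₀ f) (ha : 0 < a) :
    (b = true → Found k a X₀ B M₀ f W') ∧ (b = false → Searching k a X₀ B M₀ f ∅ W') := by
  induction hs with
  | exhausted W => exact ⟨by simp, fun _ => h⟩
  | monoBad hq hx hg h₁ => exact ⟨fun _ => h.found_mono hf hq hx hg h₁, by simp⟩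
  | viaUnsafe hq hx h₁ hi hg h₂ hv =>
    exact ⟨fun _ => h.found_via hf ha hq hx hi.progress hg h₂ hv, by simp⟩
  | next hq hx h₁ hi hd h₂ hs ih => exact ih (h.next hf ha hq hx hi.progress h₁ hd h₂)

theorem Search.spec [Finite V] {b : Bool} (hs : Search k a f W W' b)
    (hE : Explo k a W.mem W.explored W.bad ∅)
    (hf : Target k a W.explored W.bad W.mem f) (ha : 0 < a) :
    (b = true → Found k a W.explored W.bad W.mem f W') ∧
      (b = false → Searching k a W.explored W.bad W.mem f ∅ W') := by
  refine SearchLoop.spec hs ⟨⟨?_, hE.nbrs, Relation.ReflTransGen.refl, hf.sound, ?_, subset_rfl,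
    by simp, by simp, by simp, ?_⟩, Or.inl rfl, by simp, by simp, ?_, Or.inl rfl⟩ hf ha
  · exact Set.subset_union_left.trans hE.sub
  · simp only [Set.union_empty]; exact hE
  · exact fun g hg hn => absurd hg hn
  · rintro g rfl; exact Or.inl ⟨rfl, rfl⟩

end

/-! ### Accepting and changing the colors of troubled vertices -/

/-- The troubled vertices in `V(S)` receive the colors given by `c`, and are accepted. -/
noncomputable def Memory.recolor (M : Memory V) (S : Set (Edge H)) (c : V → Bool) : Memory V :=
  { M.accept (verts S) with color := c }

/-- The colors of the vertices of `e` are not changed by recoloring `V(S)`. -/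
def Memory.Apart (M : Memory V) (S : Set (Edge H)) (e : Set V) : Prop :=
  ∀ w ∈ e, w ∉ M.trb (verts S)

theorem Memory.recolor_status_of_mem {M : Memory V} {S : Set (Edge H)} {c : V → Bool} {w : V}
    (hw : w ∈ M.trb (verts S)) : (M.recolor S c).status w = Status.accepted := if_pos hw

theorem Memory.recolor_status {M : Memory V} {S : Set (Edge H)} {c : V → Bool} {w : V}
    (hw : w ∉ M.trb (verts S)) : (M.recolor S c).status w = M.status w := if_neg hw

/-- The colors given by `c` can be used for recoloring the bad edges in `S`. -/
structure Recoloring (k a : ℕ) (M : Memory V) (S : Set (Edge H)) (c : V → Bool) : Prop where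
  bad : ∀ e ∈ S, M.IsBad k a e.1
  tame : S ⊆ Tame k a M S
  color : ∀ v, v ∉ M.trb (verts S) → c v = M.color v
  safe : ∀ e ∈ S, (M.recolor S c).IsSafe e.1

/-! ### Effect of recoloring a closed set of bad edges -/

namespace Recoloring

variable {M : Memory V} {S B : Set (Edge H)} {c : V → Bool}

theorem status_uncolored {w : V} :
    (M.recolor S c).status w = Status.uncolored ↔ M.status w = Status.uncolored := by
  by_cases hw : w ∈ M.trb (verts S)
  · rw [Memory.recolor_status_of_mem hw, hw.2]; simp
  · rw [Memory.recolor_status hw]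

theorem acc_eq (e : Set V) : (M.recolor S c).acc e = M.acc e ∪ (M.trb e ∩ verts S) := by
  ext w
  by_cases hw : w ∈ M.trb (verts S)
  · have h1 := Memory.recolor_status_of_mem (c := c) hw
    exact ⟨fun h => Or.inr ⟨⟨h.1, hw.2⟩, hw.1⟩, fun h => ⟨h.elim (fun h => h.1) fun h => h.1.1, h1⟩⟩
  · have h1 := Memory.recolor_status (c := c) hw
    refine ⟨fun h => Or.inl ⟨h.1, h1 ▸ h.2⟩, ?_⟩
    rintro (h | h)
    · exact ⟨h.1, h1.trans h.2⟩
    · exact absurd ⟨h.2, h.1.2⟩ hw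

theorem trb_eq (e : Set V) : (M.recolor S c).trb e = M.trb e \ verts S := by
  ext w
  by_cases hw : w ∈ M.trb (verts S)
  · have h1 := Memory.recolor_status_of_mem (c := c) hw
    exact ⟨fun h => absurd (h.2.symm.trans h1) (by simp), fun h => absurd hw.1 h.2⟩
  · have h1 := Memory.recolor_status (c := c) hw
    refine ⟨fun h => ⟨⟨h.1, h1 ▸ h.2⟩, fun h2 => hw ⟨h2, h1 ▸ h.2⟩⟩, fun h => ⟨h.1.1, h1.trans h.1.2⟩⟩

theorem trb_inter_eq_of_apart {e : Set V} (he : M.Apart S e) : M.trb e ∩ verts S = ∅ :=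
  Set.eq_empty_of_forall_notMem fun w hw => he w hw.1.1 ⟨hw.2, hw.1.2⟩

theorem acc_eq_of_apart {e : Set V} (he : M.Apart S e) : (M.recolor S c).acc e = M.acc e := by
  rw [acc_eq, trb_inter_eq_of_apart he, Set.union_empty]

theorem trb_eq_of_apart {e : Set V} (he : M.Apart S e) : (M.recolor S c).trb e = M.trb e := by
  rw [trb_eq, sdiff_eq_left]
  exact Set.disjoint_iff_inter_eq_empty.2 (trb_inter_eq_of_apart he)

theorem full_iff {e : Set V} : (M.recolor S c).Full e ↔ M.Full e :=
  forall₂_congr fun _ _ => not_congr status_uncolored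

theorem mono_iff_of_apart (h : Recoloring k a M S c) {e T : Set V} (he : M.Apart S e) (hT : T ⊆ e) :
    Mono (M.recolor S c).color T ↔ Mono M.color T :=
  mono_congr fun w hw => h.color w (he w (hT hw))

theorem isSafe (h : Recoloring k a M S c) {e : Set V} (he : M.IsSafe e) :
    (M.recolor S c).IsSafe e := by
  intro hm
  refine he ((hm.subset (T := (M.recolor S c).acc e) ?_).congr fun w hw => (h.color w ?_).symm)
  · rw [acc_eq]; exact Set.subset_union_left
  · rintro ⟨-, hw'⟩
    rw [hw.2] at hw'; cases hw'

theorem safe_iff_of_apart (h : Recoloring k a M S c) {e : Set V} (he : M.Apart S e) :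
    (M.recolor S c).IsSafe e ↔ M.IsSafe e := by
  unfold Memory.IsSafe
  rw [acc_eq_of_apart he, h.mono_iff_of_apart he (M.acc_subset e)]

theorem bad_of_bad (h : Recoloring k a M S c) {e : Set V} (he : (M.recolor S c).IsBad k a e) :
    M.IsBad k a e :=
  ⟨he.1, fun hs => he.2 (h.isSafe hs)⟩

theorem not_mem_of_bad (h : Recoloring k a M S c) {e : Edge H}
    (he : (M.recolor S c).IsBad k a e.1) : e ∉ S :=
  fun heS => he.2 (h.safe e heS)

/-- By tameness, a bad edge that meets an edge of `S` belongs to `S`. -/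
theorem apart_of_bad (h : Recoloring k a M S c) {e : Edge H} (he : M.IsBad k a e.1) (heS : e ∉ S) :
    M.Apart S e.1 := by
  rintro w hw ⟨⟨s, hs, hws⟩, -⟩
  by_cases hse : s = e
  · exact heS (hse ▸ hs)
  · rcases h.tame hs e (Or.inr (mem_nbrs_of_mem hse hws hw)) with h1 | h1
    · exact heS h1
    · exact h1.2 he

theorem isBad (h : Recoloring k a M S c) {e : Edge H} (he : M.IsBad k a e.1) (heS : e ∉ S) :
    (M.recolor S c).IsBad k a e.1 :=
  ⟨he.1, fun hs => he.2 ((h.safe_iff_of_apart (h.apart_of_bad he heS)).1 hs)⟩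

theorem determined (h : Recoloring k a M S c) {e : Set V} (he : M.Determined e) :
    (M.recolor S c).Determined e :=
  he.imp h.isSafe full_iff.2

theorem settled (h : Recoloring k a M S c) {e : Set V} (he : M.Settled k a e) :
    (M.recolor S c).Settled k a e :=
  ⟨h.determined he.1, fun hb => he.2 (h.bad_of_bad hb)⟩

theorem isUnsafe_of_recolor (h : Recoloring k a M S c) {e : Edge H}
    (he : (M.recolor S c).IsUnsafe k a e.1) :
    M.IsUnsafe k a e.1 :=
  ⟨full_iff.1 he.1, fun hs => he.2.1 (h.isSafe hs), fun hb => he.2.2 (h.isBad hb fun heS =>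
    he.2.1 (h.safe e heS))⟩

theorem isUnsafe_of_apart (h : Recoloring k a M S c) {e : Set V} (he : M.IsUnsafe k a e)
    (hS : M.Apart S e) :
    (M.recolor S c).IsUnsafe k a e :=
  ⟨full_iff.2 he.1, fun hs => he.2.1 ((h.safe_iff_of_apart hS).1 hs),
    fun hb => he.2.2 (h.bad_of_bad hb)⟩

/-- Edges of `S` are safe after recoloring, so they need not be excluded by `T'`. -/
theorem not_twoDisjointBad (h : Recoloring k a M S c) {f : Edge H} {T T' : Set (Edge H)}
    (hT : ¬ M.TwoDisjointBad k a f T)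
    (hTT' : T ⊆ T' ∪ S) : ¬ (M.recolor S c).TwoDisjointBad k a f T' := by
  rintro ⟨x, hx, y, hy, h1, h2, h3, h4, h5⟩
  exact hT ⟨x, hx, y, hy, fun h' => (hTT' h').elim h1 (h.not_mem_of_bad h3),
    fun h' => (hTT' h').elim h2 (h.not_mem_of_bad h4), h.bad_of_bad h3, h.bad_of_bad h4, h5⟩

theorem inert_of_apart (h : Recoloring k a M S c) {f : Edge H} (hf : Inert k a M f)
    (hS : M.Apart S f.1) :
    Inert k a (M.recolor S c) f where
  determined g hg := h.determined (hf.determined g hg)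
  meet := h.not_twoDisjointBad hf.meet (Set.empty_subset _)
  not_mono hm := hf.not_mono ((h.mono_iff_of_apart hS subset_rfl).1 hm)
  many := by rw [trb_eq_of_apart hS]; exact hf.many

theorem untouched_of_apart {e : Set V} (he : M.Untouched e) (hS : M.Apart S e) :
    (M.recolor S c).Untouched e :=
  fun w hw => (Memory.recolor_status (hS w hw)).trans (he w hw)

/-- Only unsafe edges that meet recolored vertices require an argument depending on the situation,
supplied by `hu`. A newly touched edge is determined because it is safe now, or adjacent to `S` and
hence settled. -/
theorem sound (h : Recoloring k a M S c) (hS : Sound H k a B M) {B' : Set (Edge H)}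
    (hu : ∀ f : Edge H, M.IsUnsafe k a f.1 → (M.recolor S c).IsUnsafe k a f.1 → ¬ M.Apart S f.1 →
      Inert k a (M.recolor S c) f ∨ ¬ FewInside a (M.recolor S c) B' f)
    (hB : ∀ f : Edge H, M.Apart S f.1 → ¬ FewInside a M B f →
      ¬ FewInside a (M.recolor S c) B' f) : Sound H k a B' (M.recolor S c) where
  mark_uncolored w := status_uncolored.trans (hS.mark_uncolored w)
  accepted_of_mark w hw := by
    by_cases hwS : w ∈ M.trb (verts S)
    · exact Memory.recolor_status_of_mem hwS
    · exact (Memory.recolor_status hwS).trans (hS.accepted_of_mark w hw)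
  color_eq w hw := by
    by_cases hwS : w ∈ M.trb (verts S)
    · rw [Memory.recolor_status_of_mem hwS] at hw
      have := (hS.accepted_of_mark w hw.symm).symm.trans hwS.2
      cases this
    · rw [Memory.recolor_status hwS] at hw
      exact (h.color w hwS).trans (hS.color_eq w hw)
  troubled_bad w hw := by
    have hwS : w ∉ M.trb (verts S) := fun hwS => by
      rw [Memory.recolor_status_of_mem hwS] at hw; cases hw
    rw [Memory.recolor_status hwS] at hw
    obtain ⟨e, hwe, he⟩ := hS.troubled_bad w hw
    exact ⟨e, hwe, h.isBad he fun heS => hwS ⟨⟨e, heS, hwe⟩, hw⟩⟩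
  acc_card e he := hS.acc_card e fun hs => he (h.isSafe hs)
  bad_untouched e he := untouched_of_apart (hS.bad_untouched e (h.bad_of_bad he))
    (h.apart_of_bad (h.bad_of_bad he) (h.not_mem_of_bad he))
  touched_determined e he := by
    by_cases hA : M.Apart S e.1
    · exact h.determined (hS.touched_determined e fun ht => he (untouched_of_apart ht hA))
    · unfold Memory.Apart at hA
      push Not at hA
      obtain ⟨w, hw, ⟨s, hs, hws⟩, -⟩ := hA
      by_cases heS : e ∈ S
      · exact Or.inl (h.safe e heS)
      · have hse : s ≠ e := by rintro rfl; exact heS hs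
        exact h.determined ((h.tame hs e (Or.inr (mem_nbrs_of_mem hse hws hw))).resolve_left heS).1
  unsafe_cases f hf := by
    have hf' := h.isUnsafe_of_recolor hf
    by_cases hA : M.Apart S f.1
    · rcases hS.unsafe_cases f hf' with h1 | h1 | h1
      · exact Or.inl (untouched_of_apart h1 hA)
      · exact Or.inr (Or.inl (h.inert_of_apart h1 hA))
      · exact Or.inr (Or.inr (hB f hA h1))
    · exact Or.inr (hu f hf' hf hA)

end Recoloring

/-! ### Building a final component -/

theorem Explo.tame {M : Memory V} {X B : Set (Edge H)} (h : Explo k a M X B ∅) :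
    B ⊆ Tame k a M B := by
  rintro t ht c (rfl | hc)
  · exact Or.inl ht
  · simpa using h.known c (h.nbrs t ht hc)

theorem Ext.left_empty {D D' : Duo H} (h : Ext D D') (hD : D.L = ∅) : D'.L = ∅ :=
  h.L.elim (fun h => h.trans hD) id

theorem not_mem_coveredBy_empty (c : Edge H) : c ∉ coveredBy (∅ : Set (Edge H)) := by
  rw [mem_coveredBy]; simp

section

variable {M : Memory V} {B S : Set (Edge H)} {f x y : Edge H}

/-- If the bad neighbours of `f` outside `B` pairwise intersect, then they belong to the same
bad-component. -/
theorem mem_of_meet (hm : ¬ M.TwoDisjointBad k a f B) (hS : S ⊆ Tame k a M S) (hxS : x ∈ S)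
    (hx : x ∈ nbrs f) (hxb : M.IsBad k a x.1) (hxB : x ∉ B) (hy : y ∈ nbrs f)
    (hyb : M.IsBad k a y.1) (hyB : y ∉ B) : y ∈ S := by
  by_cases hxy : y = x
  · rwa [hxy]
  refine (hS hxS y (Or.inr ?_)).resolve_right fun h => h.2 hyb
  by_contra hn
  exact hm ⟨x, hx, y, hy, hxB, hyB, hxb, hyb, disjoint_of_not_nbrs (Ne.symm hxy) hn⟩

theorem Inert.nbrs_mem (h : Inert k a M f) (hS : S ⊆ Tame k a M S) (hxS : x ∈ S)
    (hx : x ∈ nbrs f) (hxb : M.IsBad k a x.1) : ∀ y ∈ nbrs f, M.IsBad k a y.1 → y ∈ S :=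
  fun _ hy hyb => mem_of_meet h.meet hS hxS hx hxb (Set.notMem_empty _) hy hyb
    (Set.notMem_empty _)

theorem Sound.trb_subset (hS : Sound H k a B M) (hu : M.IsUnsafe k a f.1)
    (h : ∀ x ∈ nbrs f, M.IsBad k a x.1 → x ∈ S) : M.trb f.1 ⊆ verts S := by
  intro w hw
  obtain ⟨e, hwe, he⟩ := hS.troubled_bad w hw.2
  exact ⟨e, h e (mem_nbrs_of_mem (by rintro rfl; exact hu.2.2 he) hw.1 hwe) he, hwe⟩

/-- All troubled vertices of `f` lie in bad neighbours, hence in `verts B`. There are at least `a`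
of them: an untouched unsafe edge has fewer than `k - a` accepted vertices, and an inert edge
satisfies this by definition. -/
theorem Sound.not_fewInside (hS : Sound H k a B M) (hun : IsUniform H k)
    (hu : M.IsUnsafe k a f.1) (h : ∀ x ∈ nbrs f, M.IsBad k a x.1 → x ∈ B) :
    ¬ FewInside a M B f := by
  intro hf
  have hf' := hf
  unfold FewInside at hf
  rw [Set.inter_eq_left.2 (hS.trb_subset hu h)] at hf
  rcases hS.unsafe_cases f hu with h1 | h1 | h1
  · have h2 := (hS.unsafe_record hu).2.1
    rw [h1.acc_eq] at h2
    have h3 := Set.ncard_union_le (M.acc f.1) (M.trb f.1)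
    rw [Memory.Full.acc_union_trb hu.1, hun f] at h3
    omega
  · exact absurd h1.many (not_le.2 hf)
  · exact h1 hf'

end

/-- The rules (r1) and (r2) do not apply to `f`. -/
structure Hold (k a : ℕ) (M : Memory V) (B : Set (Edge H)) (f : Edge H) : Prop where
  det : ∀ g ∈ nbrs f, M.Determined g.1
  meet : ¬ M.TwoDisjointBad k a f B
  not_mono : ¬ Mono M.color (f.1 \ M.trb (verts B))

/-- The possible states of an explored unsafe edge while a final component is being built. -/
def Handled (k a : ℕ) (M : Memory V) (B U Us : Set (Edge H)) (f : Edge H) : Prop :=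
  f ∈ U ∨ ¬ FewInside a M B f ∨ (Hold k a M B f ∧ (f ∈ Us ∨ ¬ FewOutside a M B f)) ∨ Inert k a M f

/-- The properties of the edges from `U_s`. -/
structure Deferred (k a : ℕ) (M : Memory V) (B : Set (Edge H)) (f : Edge H) : Prop where
  det : ∀ g ∈ nbrs f, M.Determined g.1
  meet : ¬ M.TwoDisjointBad k a f B
  -- The second alternative describes edges whose bad neighbours outside `B` were accepted by an
  -- earlier search.
  cases : (M.IsUnsafe k a f.1 ∧ FewOutside a M B f) ∨ ∀ x ∈ nbrs f, M.IsBad k a x.1 → x ∈ B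

/-- The invariant of the construction of a final component for the vertex `v`. -/
structure Building (k a : ℕ) (v : V) (W : Work H) (Us : Set (Edge H)) : Prop where
  sound : Sound H k a W.bad W.mem
  explo : Explo k a W.mem W.explored W.bad ∅
  uns : ∀ f ∈ W.uns, f ∈ W.explored ∧ W.mem.IsUnsafe k a f.1 ∧ ∃ b ∈ W.bad, f ∈ nbrs b
  deferred : ∀ f ∈ Us, f ∈ W.explored ∧ (∃ b ∈ W.bad, f ∈ nbrs b) ∧ Deferred k a W.mem W.bad f
  handled : ∀ f ∈ W.explored, W.mem.IsUnsafe k a f.1 → Handled k a W.mem W.bad W.uns Us f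
  witness : ∃ D, Good k a W.mem W.bad D ∧ D.L = ∅ ∧ 0 ≤ D.pot ∧ W.bad ⊆ coveredBy D.A
  troubled : W.mem.status v = Status.troubled
  origin : ∃ e ∈ W.bad, v ∈ e.1
  -- The initial edge, chosen because it contains `v`, is expanded without being determined.
  det : ∀ b ∈ W.bad, W.mem.Determined b.1 ∨ v ∈ b.1

section

variable {M M' : Memory V} {B B' U Us U' Us' : Set (Edge H)} {f g : Edge H} {v : V}
  {W W' A : Work H}

theorem Hold.later (h : Hold k a M B f) (hL : Later H k a M M') (hf : M.Full f.1) :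
    Hold k a M' B f where
  det g hg := hL.determined (h.det g hg)
  meet ht := h.meet (hL.twoDisjointBad h.det ht)
  not_mono := by
    rw [hL.trb_diff_sub hf, hL.mono_iff hf Set.sdiff_subset]; exact h.not_mono

theorem Handled.later (h : Handled k a M B U Us f) (hL : Later H k a M M') (hf : M.Full f.1) :
    Handled k a M' B U Us f := by
  unfold Handled
  rw [hL.fewInside_iff hf, hL.fewOutside_iff hf]
  rcases h with h | h | h | h
  · exact Or.inl h
  · exact Or.inr (Or.inl h)
  · exact Or.inr (Or.inr (Or.inl ⟨h.1.later hL hf, h.2⟩))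
  · exact Or.inr (Or.inr (Or.inr (h.later hL hf)))

theorem Deferred.later (h : Deferred k a M B f) (hL : Later H k a M M') :
    Deferred k a M' B f where
  det g hg := hL.determined (h.det g hg)
  meet ht := h.meet (hL.twoDisjointBad h.det ht)
  cases := by
    rcases h.cases with ⟨h1, h2⟩ | h1
    · exact Or.inl ⟨hL.isUnsafe h1, (hL.fewOutside_iff h1.1).2 h2⟩
    · exact Or.inr fun x hx hb => h1 x hx (hL.bad_of_determined (h.det x hx) hb)

theorem Building.progress [Finite V] (h : Building k a v W Us) (hp : Progress H k a W.mem M) :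
    Building k a v ⟨M, W.explored, W.bad, W.uns⟩ Us := by
  obtain ⟨hS, hL⟩ := hp.sound_later h.sound
  refine ⟨hS, h.explo.later hL, fun f hf => ?_, fun f hf => ?_, fun f hf hu => ?_, ?_, ?_, h.origin,
    fun b hb => (h.det b hb).imp_left hL.determined⟩
  · obtain ⟨h1, h2, h3⟩ := h.uns f hf
    exact ⟨h1, hL.isUnsafe h2, h3⟩
  · obtain ⟨h1, h2, h3⟩ := h.deferred f hf
    exact ⟨h1, h2, h3.later hL⟩
  · have hu' := h.explo.unsafe_of_later hL hf hu
    exact (h.handled f hf hu').later hL hu'.1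
  · obtain ⟨D, h1, h2⟩ := h.witness
    exact ⟨D, h1.later hL subset_rfl, h2⟩
  · exact (hL.status v (by rw [h.troubled]; simp)).trans h.troubled

theorem Building.adjust (h : Building k a v W Us) (hU : U' ⊆ W.uns) (hU' : W.uns \ {f} ⊆ U')
    (hUs : Us \ {f} ⊆ Us')
    (hd : ∀ g ∈ Us', g ∈ Us ∨ (g = f ∧ f ∈ W.uns ∧ Deferred k a W.mem W.bad f))
    (hf : W.mem.IsUnsafe k a f.1 → Handled k a W.mem W.bad U' Us' f) :
    Building k a v ⟨W.mem, W.explored, W.bad, U'⟩ Us' := by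
  refine ⟨h.sound, h.explo, fun f hf => h.uns f (hU hf), fun g hg => ?_, fun g hg hu => ?_,
    h.witness, h.troubled, h.origin, h.det⟩
  · rcases hd g hg with h1 | ⟨rfl, h1, h2⟩
    · exact h.deferred g h1
    · obtain ⟨h3, -, h4⟩ := h.uns g h1
      exact ⟨h3, h4, h2⟩
  · by_cases hgf : g = f
    · subst hgf; exact hf hu
    · rcases h.handled g hg hu with h1 | h1 | ⟨h1, h2⟩ | h1
      · exact Or.inl (hU' ⟨h1, hgf⟩)
      · exact Or.inr (Or.inl h1)
      · exact Or.inr (Or.inr (Or.inl ⟨h1, h2.imp_left fun h => hUs ⟨h, hgf⟩⟩))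
      · exact Or.inr (Or.inr (Or.inr h1))

/-- The bad neighbours outside `B` of an edge on hold pairwise intersect. As soon as one of them
enters `B'`, all do, and the edge has many troubled vertices inside; otherwise `B'` covers no
further vertex of it. -/
theorem Handled.grow [Finite V] (h : Handled k a M B U Us f) (hun : IsUniform H k)
    (hS : Sound H k a B' M)
    (hB : B ⊆ B') (ht : B' ⊆ Tame k a M B') (hb : ∀ b ∈ B', M.IsBad k a b.1)
    (hu : M.IsUnsafe k a f.1) : Handled k a M B' U Us f := by
  rcases h with h | h | ⟨h, h'⟩ | h
  · exact Or.inl h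
  · exact Or.inr (Or.inl fun h2 => h (h2.anti hB))
  · by_cases hx : ∃ x ∈ nbrs f, x ∈ B' ∧ x ∉ B
    · obtain ⟨x, hx, hxB', hxB⟩ := hx
      refine Or.inr (Or.inl (hS.not_fewInside hun hu fun y hy hyb => ?_))
      by_cases hyB : y ∈ B
      · exact hB hyB
      · exact mem_of_meet h.meet ht hxB' hx (hb x hxB') hxB hy hyb hyB
    · push Not at hx
      have hv : ∀ w ∈ f.1, w ∈ verts B' ↔ w ∈ verts B := by
        refine fun w hw => ⟨fun ⟨e, he, hwe⟩ => ⟨e, hx e ?_ he, hwe⟩, fun h => verts_mono hB h⟩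
        exact mem_nbrs_of_mem (by rintro rfl; exact hu.2.2 (hb _ he)) hw hwe
      refine Or.inr (Or.inr (Or.inl ⟨⟨h.det, ?_, ?_⟩, h'.imp_right ?_⟩))
      · exact fun ⟨x, hx, y, hy, h1, h2, h3⟩ => h.meet ⟨x, hx, y, hy, fun h => h1 (hB h),
          fun h => h2 (hB h), h3⟩
      · have : f.1 \ M.trb (verts B') = f.1 \ M.trb (verts B) := by
          ext w
          exact and_congr_right fun hw => not_congr (and_congr_left fun _ => hv w hw)
        rw [this]; exact h.not_mono
      · have : M.trb f.1 \ verts B' = M.trb f.1 \ verts B := by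
          ext w
          exact and_congr_right fun hw => not_congr (hv w hw.1)
        unfold FewOutside
        rw [this]; exact id
  · exact Or.inr (Or.inr (Or.inr h))

/-- The set of bad edges of the final component is enlarged, in such a way that it contains all bad
neighbours of `f`. -/
theorem Building.extend [Finite V] (h : Building k a v W Us) (hun : IsUniform H k)
    (hL : Later H k a W.mem W'.mem) (hS : Sound H k a W'.bad W'.mem)
    (hE : Explo k a W'.mem W'.explored W'.bad ∅) (hB : W.bad ⊆ W'.bad)
    (hX : W.explored ⊆ W'.explored)
    (hU : ∀ f ∈ W'.uns, f ∈ W'.explored ∧ W'.mem.IsUnsafe k a f.1 ∧ ∃ b ∈ W'.bad, f ∈ nbrs b)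
    (hU' : W.uns \ {f} ⊆ W'.uns)
    (hall : ∀ g ∈ W'.explored, g ∈ W.explored ∨ (W'.mem.IsUnsafe k a g.1 → g ∈ W'.uns))
    (hUs : Us' ⊆ Us) (hUs' : Us \ {f} ⊆ Us')
    (hf : ∀ x ∈ nbrs f, W'.mem.IsBad k a x.1 → x ∈ W'.bad)
    (hdet : ∀ b ∈ W'.bad, b ∈ W.bad ∨ W'.mem.Determined b.1)
    (hw : ∃ D, Good k a W'.mem W'.bad D ∧ D.L = ∅ ∧ 0 ≤ D.pot ∧ W'.bad ⊆ coveredBy D.A) :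
    Building k a v W' Us' := by
  refine ⟨hS, hE, hU, fun g hg => ?_, fun g hg hu => ?_, hw, ?_, ?_, fun b hb => ?_⟩
  · obtain ⟨h1, ⟨b, hb, h2⟩, h3⟩ := h.deferred g (hUs hg)
    have h4 := h3.later hL
    refine ⟨hX h1, ⟨b, hB hb, h2⟩, h4.det, ?_, ?_⟩
    · exact fun ⟨x, hx, y, hy, h1, h2, h3⟩ => h4.meet ⟨x, hx, y, hy, fun h => h1 (hB h),
        fun h => h2 (hB h), h3⟩
    · exact h4.cases.imp (fun h => ⟨h.1, h.2.mono hB⟩) fun h x hx hxb => hB (h x hx hxb)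
  · rcases hall g hg with h1 | h1
    · have hu' := h.explo.unsafe_of_later hL h1 hu
      rcases ((h.handled g h1 hu').later hL hu'.1).grow hun hS hB hE.tame
        (fun b hb => hE.bad b (Or.inl hb)) hu with h2 | h2 | ⟨h2, h3⟩ | h2
      · by_cases hgf : g = f
        · subst hgf; exact Or.inr (Or.inl (hS.not_fewInside hun hu hf))
        · exact Or.inl (hU' ⟨h2, hgf⟩)
      · exact Or.inr (Or.inl h2)
      · by_cases hgf : g = f
        · subst hgf; exact Or.inr (Or.inl (hS.not_fewInside hun hu hf))
        · exact Or.inr (Or.inr (Or.inl ⟨h2, h3.imp_left fun h => hUs' ⟨h, hgf⟩⟩))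
      · exact Or.inr (Or.inr (Or.inr h2))
    · exact Or.inl (h1 hu)
  · exact (hL.status v (by rw [h.troubled]; simp)).trans h.troubled
  · obtain ⟨e, he, hve⟩ := h.origin
    exact ⟨e, hB he, hve⟩
  · rcases hdet b hb with h1 | h1
    · exact (h.det b h1).imp_left hL.determined
    · exact Or.inl h1

theorem Building.start [Finite V] {M₀ : Memory V} (hS : Sound H k a ∅ M₀) {e : Edge H}
    (hv : v ∈ e.1)
    (hs : M₀.status v = Status.troubled) (he : M₀.IsBad k a e.1)
    (h : ExpandBad k a e ⟨M₀, ∅, ∅, ∅⟩ W) : Building k a v W ∅ := by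
  obtain ⟨s1, s2, s3, s4, s5, s6⟩ := h.spec (S₀ := ∅) hS he
    ⟨by simp, by simp, by simp, by simp⟩
  rw [Set.empty_union] at s2
  have hL := (s4.progress.sound_later hS).2
  refine ⟨s1.mono (Set.empty_subset _), s2, fun f hf => ?_, by simp, fun f hf hu => ?_, ?_, ?_,
    ⟨e, s5, hv⟩, fun b hb => ?_⟩
  · obtain ⟨-, h1⟩ := (s4.uns_new f hf).resolve_left fun h => h.elim
    exact h1
  · rcases s4.uns_all f hf with (rfl | h1) | h1
    · exact absurd (hL.bad f he) hu.2.2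
    · exact h1.elim
    · exact Or.inl (h1 hu)
  -- A single node labelled B, without a second tree, has potential 1.
  · obtain ⟨D, h1, h2, h3, -, h4⟩ := (stem_empty (k := k) (a := a) W.mem W.bad (fun _ => .B)
      fun _ => 0).start_far (z := e) (ℓ := .B) (not_mem_coveredBy_empty e) (s2.tame s5) (by simp)
      (by simp) (fun _ => s2.bad e (Or.inl s5))
    obtain ⟨D', h5, h6, h7⟩ := h1.grow s6 (by rw [h3]; rintro x (rfl | hx)
                                              · exact Or.inl rfl
                                              · exact hx.elim)
      (fun c hc => ⟨s2.bad c (Or.inl hc), s2.tame hc⟩)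
      (by rw [h2]; exact fun c _ => not_mem_coveredBy_empty c)
    refine ⟨D', h5, h6.left_empty h2, le_trans ?_ h6.pot, h7⟩
    rw [h4]; simp [Label.weight]
  · exact (hL.status v (by simp only; rw [hs]; simp)).trans hs
  · rcases s3 b hb with h1 | rfl | h1
    · exact h1.elim
    · exact Or.inr hv
    · exact Or.inl h1.2

theorem Building.expand [Finite V] (h : Building k a v W Us) (hun : IsUniform H k) (hf : f ∈ W.uns)
    (ht : FewInside a W.mem W.bad f) (hr : ExpandRule k a W.mem W.bad f)
    (hv : ExpandVia k a f ⟨W.mem, W.explored, W.bad, W.uns \ {f}⟩ W') : Building k a v W' Us := by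
  obtain ⟨s1, s2, s3, s4, s5⟩ := hv.spec (S₀ := ∅) h.sound
    (by rw [Set.empty_union]; exact h.explo)
  rw [Set.empty_union] at s2
  have hL := (s3.progress.sound_later h.sound).2
  have s5' : Fed (W.bad ∪ (nbrs f ∩ W'.bad)) W'.bad := s5
  have hB : W.bad ⊆ W'.bad := s3.bad
  simp only at hL
  obtain ⟨hfX, hfu, b, hb, hbf⟩ := h.uns f hf
  have hfu' := hL.isUnsafe hfu
  have hmem : ∀ x ∈ nbrs f, W'.mem.IsBad k a x.1 → x ∈ W'.bad := fun x hx hxb =>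
    ((s4 x hx).resolve_right fun h => h.2 hxb).resolve_left fun h => h.elim
  refine h.extend (f := f) hun hL (s1.mono hB) s2 hB s3.explored (fun g hg => ?_) s3.uns s3.uns_all
    subset_rfl Set.sdiff_subset hmem (fun b hb => ?_) ?_
  · rcases s3.uns_new g hg with h1 | ⟨-, h1⟩
    · obtain ⟨h2, h3, c, hc, h4⟩ := h.uns g h1.1
      exact ⟨s3.explored h2, hL.isUnsafe h3, c, hB hc, h4⟩
    · exact h1
  · rcases s3.bad_new b hb with h1 | h1 | h1
    · exact Or.inl h1
    · exact h1.elim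
    · exact Or.inr h1.2
  obtain ⟨D, d1, d2, d3, d4⟩ := h.witness
  -- Tameness with respect to the old set `W.bad` shows that the bad edges found now are uncovered,
  -- while `d6` admits them as nodes.
  have d5 := d1.later hL subset_rfl
  have d6 := d1.later hL hB
  have hcov : ∀ c, c ∉ coveredBy D.L := fun c => by rw [d2]; exact not_mem_coveredBy_empty c
  have hfin : ∀ D₁, Good k a W'.mem W'.bad D₁ → Ext D D₁ → nbrs f ∩ W'.bad ⊆ coveredBy D₁.A →
      ∃ D, Good k a W'.mem W'.bad D ∧ D.L = ∅ ∧ 0 ≤ D.pot ∧ W'.bad ⊆ coveredBy D.A := by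
    intro D₁ h1 h2 h3
    obtain ⟨D₂, h4, h5, h6⟩ := h1.grow s5' (Set.union_subset (d4.trans h2.cov_A) h3)
      (fun c hc => ⟨s2.bad c (Or.inl hc), s2.tame hc⟩) fun c _ => h2.cov_L (hcov c)
    exact ⟨D₂, h4, (h2.trans h5).left_empty d2, d3.trans (h2.trans h5).pot, h6⟩
  rcases hr with ⟨c₁, hc₁, c₂, hc₂, n1, n2, b1, b2, hd⟩ | hm
  · have hc : ∀ c ∈ nbrs f, c ∉ W.bad → W.mem.IsBad k a c.1 → c ∈ nbrs f ∧
        W'.mem.IsBad k a c.1 ∧ c ∈ Tame k a W'.mem W'.bad ∧ c ∉ coveredBy D.A := by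
      intro c hc hcB hcb
      have hcb' := hL.bad c hcb
      refine ⟨hc, hcb', s2.tame (hmem c hc hcb'), fun h => d5.not_covered hcb' hcB ?_⟩
      exact coveredBy_mono Set.subset_union_right h
    obtain ⟨D₁, h1, h2, h3⟩ := d6.attach_fork (f := f) (c₁ := c₁) (c₂ := c₂) d2 (d4 hb)
      (nbrs_symm hbf) (by
        rintro c (rfl | rfl)
        · exact hc _ hc₁ n1 b1
        · exact hc _ hc₂ n2 b2) hd
    obtain ⟨D₂, h4, h5, h6⟩ := h1.cover_nbrs h3 (Y := nbrs f ∩ W'.bad)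
      (fun c hc => ⟨hc.1, s2.bad c (Or.inl hc.2), s2.tame hc.2⟩) fun c _ => h2.cov_L (hcov c)
    exact hfin D₂ h4 (h2.trans h5) h6
  -- An inert edge with one bad neighbour in the component has all of them there, and so at least
  -- `a` troubled vertices inside, contrary to `ht`.
  · have hun' : W.mem.Untouched f.1 := by
      rcases h.sound.unsafe_cases f hfu with h1 | h1 | h1
      · exact h1
      · exact absurd ht (h.sound.not_fewInside hun hfu (h1.nbrs_mem h.explo.tame hb
          (nbrs_symm hbf) (h.explo.bad b (Or.inl hb))))
      · exact absurd ht h1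
    obtain ⟨D₁, h1, h2, h3⟩ := d6.cross (ℓ := .Bout) (g := f) (X := W.bad)
      (Y := (nbrs f ∩ W'.bad) \ W.bad) s1 (by
        rintro c (rfl | hc)
        · exact Or.inr hfu'.settled
        · exact (s4 c hc).imp_left fun h => h.resolve_left fun h => h.elim)
      hfu' (hL.untouched hfu.1 hun') (fun x hx => s2.bad x (Or.inl (hB hx)))
      (fun x hx _ => d4 hx) ⟨b, hb, nbrs_symm hbf⟩
      (fun c hc => ⟨hc.1.1, s2.bad c (Or.inl hc.1.2), s2.tame hc.1.2⟩)
      (fun c hc => d5.not_covered (s2.bad c (Or.inl hc.1.2)) hc.2)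
      (fun c hc hcb => by
        by_cases hcB : c ∈ W.bad
        · exact Or.inl hcB
        · exact Or.inr ⟨⟨hc, hmem c hc hcb⟩, hcB⟩)
      (by simp [Label.weight])
      (fun X hX => by
        have hX' : ∀ w ∈ W.mem.trb f.1, w ∈ X ↔ w ∈ verts W.bad := by
          rw [← hun'.trb_eq, ← hL.record_trb_eq (hL.colored_of_full hfu.1)]; exact hX
        -- The event is verified in the memory in which (r2) was tested, and then carried over to
        -- the end of the expansion.
        refine (h.sound.event_outside hun hfu hun' ?_ ?_).later hL
        · refine hm.subset ?_
          rintro w (hw | ⟨hw, hwX⟩)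
          · refine ⟨hw.1, fun hw' => ?_⟩
            have := hw.2.symm.trans hw'.2
            cases this
          · exact ⟨hw.1, fun hw' => hwX ((hX' w hw).2 hw'.1)⟩
        · refine lt_of_le_of_lt (Set.ncard_le_ncard ?_ (Set.toFinite _)) ht
          exact fun w hw => ⟨hw.1, (hX' w hw.1).1 hw.2⟩)
    refine hfin D₁ h1 h2 fun c hc => ?_
    by_cases hcB : c ∈ W.bad
    · exact h2.cov_A (d4 hcB)
    · exact h3 ⟨hc, hcB⟩

theorem Building.target (h : Building k a v W Us) (hf : f ∈ Us) :
    Target k a W.explored W.bad W.mem f :=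
  let ⟨h1, _, h2⟩ := h.deferred f hf
  ⟨h1, h2.det, h2.meet, h.sound⟩

/-- The amortizing configuration starts a second tree and pays for the joint. Unless the trees have
merged on the way, they are joined through `f`, which has fewer than `2 * a` troubled vertices:
fewer than `a` inside and fewer than `a` outside `verts W.bad`. -/
theorem Building.found [Finite V] (h : Building k a v W Us) (hun : IsUniform H k) (hU : W.uns = ∅)
    (hf : f ∈ Us) (ht : FewInside a W.mem W.bad f)
    (hA : Found k a W.explored W.bad W.mem f A) :
    Building k a v ⟨A.mem, A.explored, W.bad ∪ A.bad, W.uns ∪ A.uns⟩ (Us \ {f}) := by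
  have hL := (hA.area.progress.sound_later h.sound).2
  have hB : W.bad ⊆ W.bad ∪ A.bad := Set.subset_union_left
  have hE := hA.area.explo
  have hnB : ∀ c ∈ A.bad, c ∉ W.bad := fun c hc hcB => hA.area.fresh c hc (h.explo.sub (Or.inl hcB))
  refine h.extend (f := f) hun hL (hA.area.sound.mono hB) hE hB hA.area.sub (fun g hg => ?_) ?_
    (fun g hg => ?_) Set.sdiff_subset subset_rfl (fun x hx hxb => ?_) (fun b hb => ?_) ?_
  · rw [hU] at hg
    obtain ⟨-, h2, h3, c, hc, h4⟩ := hA.area.uns g (hg.resolve_left fun h => h.elim)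
    exact ⟨h2, h3, c, Or.inr hc, h4⟩
  · rw [hU]; exact fun x hx => hx.1.elim
  · by_cases hgX : g ∈ W.explored
    · exact Or.inl hgX
    · exact Or.inr fun hu => Or.inr (hA.area.all g hg hgX hu)
  · rcases hA.done x hx with h1 | h1 | h1
    · exact Or.inl h1
    · exact Or.inr h1
    · exact absurd hxb h1.2
  · exact hb.imp_right (hA.area.det b)
  obtain ⟨D, d1, d2, d3, d4⟩ := h.witness
  have d5 := d1.later hL subset_rfl
  have d6 := d1.later hL hB
  obtain ⟨R, hR, ⟨hR', c, hc, hcf⟩, hG⟩ := hA.gain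
  obtain ⟨hfX, ⟨b, hb, hbf⟩, hfD⟩ := h.deferred f hf
  have hcb : A.mem.IsBad k a c.1 := hR'.bad c hc
  have hAne : D.A.Nonempty := by
    obtain ⟨y, hy, -⟩ := mem_coveredBy.1 (d4 hb)
    exact ⟨y, hy⟩
  -- The search has reached a bad neighbour `c` of `f` outside `W.bad`, so the second alternative in
  -- `Deferred` fails.
  obtain ⟨hfu, hfo⟩ := hfD.cases.resolve_right fun h1 =>
    hnB c (hR hc) (h1 c hcf (hL.bad_of_determined (hfD.det c hcf) hcb))
  have hun' : W.mem.Untouched f.1 := by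
    rcases h.sound.unsafe_cases f hfu with h1 | h1 | h1
    · exact h1
    · exact absurd ht (h.sound.not_fewInside hun hfu (h1.nbrs_mem h.explo.tame hb
        (nbrs_symm hbf) (h.explo.bad b (Or.inl hb))))
    · exact absurd ht h1
  obtain ⟨D₁, h1, h2, h3⟩ := hG.cover (B := W.bad ∪ A.bad) hun hA.area.sound (d6.stem d2 hAne) hR'
    hR (fun t ht => hA.area.bad ht) hA.area.tame Set.subset_union_right
    (fun t ht htc => d5.not_covered (hA.area.bad ht) (hnB t ht)
      (coveredBy_mono Set.subset_union_right htc))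
  have hfin : ∀ D₂, Good k a A.mem (W.bad ∪ A.bad) D₂ → Ext D₁ D₂ → D₂.L = ∅ →
      ∃ D, Good k a A.mem (W.bad ∪ A.bad) D ∧ D.L = ∅ ∧ 0 ≤ D.pot ∧
        W.bad ∪ A.bad ⊆ coveredBy D.A := by
    intro D₂ g1 g2 g3
    have g4 := h2.ext g2
    refine ⟨D₂, g1, g3, d3.trans g4.pot, Set.union_subset (d4.trans (coveredBy_mono ?_))
      (h3.trans g2.cov_A)⟩
    have := g4.all
    rwa [g3, Set.empty_union] at this
  rcases h2.left with hl | hl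
  · obtain ⟨D₂, g1, g2, g3⟩ := h1.join_via (f := f) (b := b) (c := c) (by rw [hl]; exact d4 hb)
      (nbrs_symm hbf) (h3 (hR hc)) hcf (by
        rintro x (rfl | hx)
        · exact Or.inr (hL.settled hfu.settled)
        · rcases hA.done x hx with h1 | h1 | h1
          · exact Or.inl (Or.inl h1)
          · exact Or.inl (Or.inr h1)
          · exact Or.inr h1)
      fun X => (h.sound.event_few hfu hun' ht hfo X).later hL
    exact hfin D₂ g1 g2 g3
  · exact hfin D₁ h1 (Ext.refl _) hl

end

/-! ### Activation exclusion and the final coloring -/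

section

variable {M₂ : Memory V} {Us : Set (Edge H)} {f : Edge H} {v : V} {W A : Work H}

theorem Searching.recoloring {X₀ B Q : Set (Edge H)} {M₀ : Memory V}
    (h : Searching k a X₀ B M₀ f Q A) : Recoloring k a A.mem A.bad A.mem.color where
  bad _ he := h.area.bad he
  tame := h.area.tame
  color _ _ := rfl
  safe e he hm := by
    have h1 : A.mem.trb e.1 ⊆ verts A.bad := fun w hw => ⟨e, he, hw.1⟩
    rw [Recoloring.acc_eq, Set.inter_eq_left.2 h1, (h.area.full he).acc_union_trb] at hm
    exact h.not_mono e he hm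

theorem Building.excluded [Finite V] (h : Building k a v W Us) (hun : IsUniform H k)
    (hU : W.uns = ∅)
    (hf : f ∈ Us) (hA : Searching k a W.explored W.bad W.mem f ∅ A) :
    Building k a v ⟨A.mem.recolor A.bad A.mem.color, A.explored, W.bad, W.uns⟩ (Us \ {f}) := by
  have hR := hA.recoloring
  have hM := h.progress hA.area.progress
  have hnB : ∀ c ∈ A.bad, c ∉ W.bad := fun c hc hcB => hA.area.fresh c hc (h.explo.sub (Or.inl hcB))
  have hvB : ∀ w ∈ verts W.bad, w ∉ verts A.bad := fun w hw ⟨c, hc, hwc⟩ =>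
    hA.area.not_mem_base (hA.area.fresh c hc) hwc hw
  have htrb : ∀ e : Set V, (A.mem.recolor A.bad A.mem.color).trb e ∩ verts W.bad =
      A.mem.trb e ∩ verts W.bad := by
    intro e
    rw [Recoloring.trb_eq]
    ext w
    exact ⟨fun hw => ⟨hw.1.1, hw.2⟩, fun hw => ⟨⟨hw.1, hvB w hw.2⟩, hw.2⟩⟩
  have htrb' : (A.mem.recolor A.bad A.mem.color).trb (verts W.bad) = A.mem.trb (verts W.bad) := by
    rw [Recoloring.trb_eq, sdiff_eq_left, Set.disjoint_left]
    exact fun w hw => hvB w hw.1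
  have hfew : ∀ g, FewInside a (A.mem.recolor A.bad A.mem.color) W.bad g ↔
      FewInside a A.mem W.bad g := fun g => by unfold FewInside; rw [htrb]
  -- If a cleared edge is still unsafe after the acceptance, its accepted part is monochromatic;
  -- hence it was cleared because `a` troubled vertices remain, and it is inert.
  have hnew : ∀ g ∈ A.explored, g ∉ W.explored →
      (A.mem.recolor A.bad A.mem.color).IsUnsafe k a g.1 →
      Inert k a (A.mem.recolor A.bad A.mem.color) g := by
    intro g hg hgX hu
    have hu' := hR.isUnsafe_of_recolor hu
    obtain ⟨h1, h2, h3⟩ := hA.checked g (hA.area.all g hg hgX hu')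
    have h3 := h3.resolve_left fun h => h.elim
    refine ⟨fun x hx => hR.determined (h1 x hx),
      hR.not_twoDisjointBad h3.meet (by rw [Set.empty_union]), h2, ?_⟩
    rw [Recoloring.trb_eq]
    refine h3.inactive.resolve_left fun hm => hm ?_
    rw [← Recoloring.acc_eq (c := A.mem.color)]
    exact not_not.1 hu.2.1
  -- An edge on hold that meets the area has all its bad neighbours outside `W.bad` in the area. If
  -- it stayed unsafe, everything outside its troubled vertices in `verts W.bad` would be accepted
  -- with one color, although (r2) does not apply to it.
  have hold : ∀ g ∈ W.explored, (A.mem.recolor A.bad A.mem.color).IsUnsafe k a g.1 →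
      ¬ A.mem.Apart A.bad g.1 → ¬ FewInside a (A.mem.recolor A.bad A.mem.color) W.bad g := by
    intro g hg hu hap
    have hu' := hR.isUnsafe_of_recolor hu
    have hm : Mono A.mem.color (A.mem.acc g.1 ∪ (A.mem.trb g.1 ∩ verts A.bad)) := by
      rw [← Recoloring.acc_eq (c := A.mem.color)]
      exact not_not.1 hu.2.1
    unfold Memory.Apart at hap
    push Not at hap
    obtain ⟨w, hw, ⟨s, hs, hws⟩, -⟩ := hap
    have hsg : s ∈ nbrs g := by
      refine mem_nbrs_of_mem ?_ hw hws
      rintro rfl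
      exact hA.area.fresh _ hs hg
    rw [hfew]
    rcases hM.handled g hg hu' with h1 | h1 | ⟨h1, -⟩ | h1
    · simp only [hU] at h1; exact h1.elim
    · exact h1
    · refine absurd (hm.subset ?_) h1.not_mono
      rintro x ⟨hx, hxB⟩
      by_cases hxt : x ∈ A.mem.trb g.1
      · refine Or.inr ⟨hxt, ?_⟩
        obtain ⟨e, hxe, he⟩ := hM.sound.troubled_bad x hxt.2
        refine ⟨e, ?_, hxe⟩
        have heg : e ∈ nbrs g := mem_nbrs_of_mem (by rintro rfl; exact hu'.2.2 he) hx hxe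
        exact mem_of_meet h1.meet hA.area.tame hs hsg (hA.area.bad hs) (hnB s hs) heg he
          fun heB => hxB ⟨⟨e, heB, hxe⟩, hxt.2⟩
      · rw [← Memory.Full.acc_union_trb hu'.1] at hx
        exact Or.inl (hx.resolve_right hxt)
    · rw [hM.sound.union_eq hu' (h1.nbrs_mem hA.area.tame hs hsg (hA.area.bad hs))] at hm
      exact absurd hm h1.not_mono
  have hS : Sound H k a W.bad (A.mem.recolor A.bad A.mem.color) := by
    refine hR.sound hM.sound (fun g hu hu' hap => ?_) fun g _ hg => by rwa [hfew]
    by_cases hgX : g ∈ W.explored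
    · exact Or.inr (hold g hgX hu' hap)
    · refine Or.inl (hnew g ?_ hgX hu')
      unfold Memory.Apart at hap
      push Not at hap
      obtain ⟨w, hw, ⟨s, hs, hws⟩, -⟩ := hap
      refine hA.area.explo.nbrs s (Or.inr hs) (mem_nbrs_of_mem ?_ hws hw)
      rintro rfl
      exact hu.2.2 (hA.area.bad hs)
  have hbadB : ∀ b ∈ W.bad, (A.mem.recolor A.bad A.mem.color).IsBad k a b.1 := fun b hb =>
    hR.isBad (hM.explo.bad b (Or.inl hb)) fun hbA => hnB b hbA hb
  refine ⟨hS, ⟨?_, ?_, fun b hb => (h.explo.nbrs b hb).trans hA.area.sub, fun g hg => ?_⟩, ?_,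
    fun g hg => ?_, fun g hg hu => ?_, ?_, ?_, h.origin, fun b hb => ?_⟩
  · exact h.explo.sub.trans hA.area.sub
  · rintro b (hb | hb)
    · exact hbadB b hb
    · exact hb.elim
  · rcases hA.area.known hg with h1 | h1 | h1
    · exact Or.inl (Or.inl h1)
    · exact Or.inr ⟨hR.determined (hA.area.det g h1), fun hb => hR.not_mem_of_bad hb h1⟩
    · exact Or.inr (hR.settled h1)
  · simp [hU]
  · obtain ⟨h1, h2, h3⟩ := hM.deferred g hg.1
    refine ⟨hA.area.sub h1, h2, fun x hx => hR.determined (h3.det x hx),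
      hR.not_twoDisjointBad h3.meet Set.subset_union_left, ?_⟩
    by_cases hap : A.mem.Apart A.bad g.1
    · refine h3.cases.imp (fun h => ⟨hR.isUnsafe_of_apart h.1 hap, ?_⟩)
        fun h x hx hb => h x hx (hR.bad_of_bad hb)
      unfold FewOutside
      rw [Recoloring.trb_eq_of_apart hap]; exact h.2
    · right
      intro x hx hxb
      unfold Memory.Apart at hap
      push Not at hap
      obtain ⟨w, hw, ⟨s, hs, hws⟩, -⟩ := hap
      by_contra hxB
      refine hR.not_mem_of_bad hxb (mem_of_meet h3.meet hA.area.tame hs ?_ (hA.area.bad hs)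
        (hnB s hs) hx (hR.bad_of_bad hxb) hxB)
      refine mem_nbrs_of_mem ?_ hw hws
      rintro rfl
      exact hA.area.fresh _ hs h1
  · by_cases hgX : g ∈ W.explored
    · by_cases hgf : g = f
      · subst hgf
        refine Or.inr (Or.inl (hS.not_fewInside hun hu fun x hx hxb => ?_))
        rcases hA.done.resolve_left (fun h => h.elim) x hx with h1 | h1 | h1
        · exact h1
        · exact absurd h1 (hR.not_mem_of_bad hxb)
        · exact absurd (hR.bad_of_bad hxb) h1.2
      by_cases hap : A.mem.Apart A.bad g.1
      · have hu' := hR.isUnsafe_of_recolor hu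
        rcases hM.handled g hgX hu' with h1 | h1 | ⟨h1, h2⟩ | h1
        · exact Or.inl h1
        · exact Or.inr (Or.inl fun h2 => h1 ((hfew g).1 h2))
        · refine Or.inr (Or.inr (Or.inl ⟨⟨fun x hx => hR.determined (h1.det x hx),
            hR.not_twoDisjointBad h1.meet Set.subset_union_left, ?_⟩, h2.imp (fun h => ⟨h, hgf⟩) ?_⟩))
          · rw [htrb']; exact h1.not_mono
          · unfold FewOutside
            rw [Recoloring.trb_eq_of_apart hap]; exact id
        · exact Or.inr (Or.inr (Or.inr (hR.inert_of_apart h1 hap)))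
      · exact Or.inr (Or.inl (hold g hgX hu hap))
    · exact Or.inr (Or.inr (Or.inr (hnew g hg hgX hu)))
  -- Only events with the label B look at the current state. By tameness their edges belong to
  -- `W.bad`, whose badness survives the acceptance.
  · obtain ⟨D, d1, d2⟩ := hM.witness
    refine ⟨D, { d1 with event := fun x hx => ?_, tame := fun y hy c hc => ?_ }, d2⟩
    · have h1 := d1.event x hx
      cases hl : D.lab x <;> rw [hl] at h1 <;> try exact h1
      have h2 : A.mem.IsBad k a x.1 := h1
      exact hbadB x ((d1.tame x hx x (Or.inl rfl)).resolve_right fun h => h.2 h2)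
    · exact (d1.tame y hy c hc).imp_right hR.settled
  · obtain ⟨e, he, hve⟩ := h.origin
    exact (Memory.recolor_status fun hv => hvB v ⟨e, he, hve⟩ hv.1).trans hM.troubled
  · exact (hM.det b hb).imp_left hR.determined

/-- Every bad edge of the component has a troubled vertex, so the condition on nonempty
intersections applies to it: it contains `v`, or it is completely colored with at most `k - a`
accepted vertices. -/
theorem Building.recoloring [Finite V] (h : Building k a v W Us) (hun : IsUniform H k) (ha : 0 < a)
    {c : V → Bool} (hc : ∀ v, v ∉ W.mem.trb (verts W.bad) → c v = W.mem.color v)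
    (hB : ∀ e ∈ W.bad, (e.1 ∩ W.mem.trb (verts W.bad)).Nonempty →
      ¬ Mono c (e.1 ∩ W.mem.trb (verts W.bad))) : Recoloring k a W.mem W.bad c where
  bad e he := h.explo.bad e (Or.inl he)
  tame := h.explo.tame
  color := hc
  safe e he := by
    have hb := h.explo.bad e (Or.inl he)
    refine fun hm => hB e he ?_ (hm.subset ?_)
    · by_cases hv : v ∈ e.1
      · exact ⟨v, hv, ⟨e, he, hv⟩, h.troubled⟩
      · have hfull := ((h.det e he).resolve_right hv).full_of_not_safe hb.2
        have h1 := h.sound.acc_card e hb.2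
        rw [(h.sound.bad_untouched e hb).acc_eq] at h1
        have h2 := Set.ncard_union_le (W.mem.acc e.1) (W.mem.trb e.1)
        rw [hfull.acc_union_trb, hun e] at h2
        have h3 : 0 < (W.mem.trb e.1).ncard := by omega
        obtain ⟨w, hw⟩ := (Set.ncard_pos (Set.toFinite _)).1 h3
        exact ⟨w, hw.1, ⟨e, he, hw.1⟩, hw.2⟩
    · rw [Recoloring.acc_eq]
      exact fun w hw => Or.inr ⟨⟨hw.1, hw.2.2⟩, hw.2.1⟩

/-- Unsafe edges with many troubled vertices in the component become safe by the choice of colors.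
Any other unsafe edge that meets the component is on hold; as no edge is deferred any more, at least
`a` of its troubled vertices are outside, and it becomes inert. -/
theorem Building.finalColoring [Finite V] (h : Building k a v W ∅) (hun : IsUniform H k)
    (ha : 0 < a)
    (hU : W.uns = ∅) (hc : FinalColoring k a W.bad W.mem M₂) : Sound H k a ∅ M₂ := by
  obtain ⟨c, hc1, hc2, hc3, rfl⟩ := hc
  have hR := h.recoloring hun ha hc1 hc2
  change Sound H k a ∅ (W.mem.recolor W.bad c)
  refine hR.sound h.sound (fun f hu hu' hap => ?_) fun f hap hf => ?_
  · unfold Memory.Apart at hap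
    push Not at hap
    obtain ⟨w, hw, ⟨b, hb, hwb⟩, hwt⟩ := hap
    have hbb := h.explo.bad b (Or.inl hb)
    have hbf : b ∈ nbrs f := by
      refine mem_nbrs_of_mem ?_ hw hwb
      rintro rfl
      exact hu.2.2 hbb
    have hm : Mono c (W.mem.acc f.1 ∪ (W.mem.trb f.1 ∩ verts W.bad)) := by
      rw [← Recoloring.acc_eq (c := c)]
      exact not_not.1 hu'.2.1
    have hfew : FewInside a W.mem W.bad f := by
      by_contra hn
      refine hc3 f hu hn ⟨w, hw, ⟨b, hb, hwb⟩, hwt⟩ (hm.subset ?_)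
      exact fun x hx => Or.inr ⟨⟨hx.1, hx.2.2⟩, hx.2.1⟩
    rcases h.handled f (h.explo.nbrs b hb (nbrs_symm hbf)) hu with h1 | h1 | ⟨h1, h2⟩ | h1
    · rw [hU] at h1; exact h1.elim
    · exact absurd hfew h1
    · refine Or.inl ⟨fun x hx => hR.determined (h1.det x hx),
        hR.not_twoDisjointBad h1.meet (by rw [Set.empty_union]), fun hm => ?_, ?_⟩
      · refine h1.not_mono ((hm.subset Set.sdiff_subset).congr fun x hx => (hc1 x hx.2).symm)
      · rw [Recoloring.trb_eq]
        exact not_lt.1 (h2.resolve_left fun h => h.elim)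
    · exact absurd hfew (h.sound.not_fewInside hun hu (h1.nbrs_mem h.explo.tame hb hbf hbb))
  · exfalso
    apply hf
    unfold FewInside
    rw [Recoloring.trb_inter_eq_of_apart hap, Set.ncard_empty]; exact ha

theorem BuildState.building [Finite V] {M₀ : Memory V} (h : BuildState k a M₀ v W Us)
    (hun : IsUniform H k)
    (ha : 0 < a) (hS : Sound H k a ∅ M₀) (hs : M₀.status v = Status.troubled) :
    Building k a v W Us := by
  induction h with
  | start hv he h => exact Building.start hS hv hs he h
  | @trim f W Us h hf ht ih =>
    exact ih.adjust Set.sdiff_subset subset_rfl Set.sdiff_subset (fun g hg => Or.inl hg)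
      fun _ => Or.inr (Or.inl ht)
  | @expand f W W' Us M h hf ht hi hr hv ih =>
    have hL := (hi.progress.sound_later ih.sound).2
    exact (ih.progress hi.progress).expand hun hf
      ((hL.fewInside_iff (ih.uns f hf).2.1.1).2 ht) hr hv
  | @defer f W Us M h hf ht hi hd hr ho ih =>
    have hM := ih.progress hi.progress
    unfold ExpandRule at hr
    push Not at hr
    have hd' : ∀ g ∈ nbrs f, M.Determined g.1 := fun g hg => hd f rfl g hg
    exact hM.adjust (f := f) Set.sdiff_subset subset_rfl
      (Set.sdiff_subset.trans (Set.subset_insert _ _))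
      (by
        rintro g (rfl | hg)
        · exact Or.inr ⟨rfl, hf, hd', hr.1, Or.inl ⟨(hM.uns _ hf).2.1, ho⟩⟩
        · exact Or.inl hg)
      fun _ => Or.inr (Or.inr (Or.inl ⟨⟨hd', hr.1, hr.2⟩, Or.inl (Or.inl rfl)⟩))
  | @drop f W Us M h hf ht hi hd hr ho ih =>
    have hM := ih.progress hi.progress
    unfold ExpandRule at hr
    push Not at hr
    exact hM.adjust (f := f) Set.sdiff_subset subset_rfl Set.sdiff_subset (fun g hg => Or.inl hg)
      fun _ => Or.inr (Or.inr (Or.inl ⟨⟨fun g hg => hd f rfl g hg, hr.1, hr.2⟩, Or.inr ho⟩))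
  | @trimDeferred f W Us h hU hf ht ih =>
    exact ih.adjust (f := f) subset_rfl Set.sdiff_subset subset_rfl (fun g hg => Or.inl hg.1)
      fun _ => Or.inr (Or.inl ht)
  | searchFound h hU hf ht hs ih =>
    exact ih.found hun hU hf ht ((hs.spec ih.explo (ih.target hf) ha).1 rfl)
  | searchExcluded h hU hf ht hs ih =>
    exact ih.excluded hun hU hf ((hs.spec ih.explo (ih.target hf) ha).2 rfl)

theorem Touch.sound [Finite V] {M M₁ : Memory V} (h : Touch H k a M v M₁) (hS : Sound H k a ∅ M) :
    Sound H k a ∅ M₁ := by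
  rcases h with ⟨h1, c, rfl⟩ | ⟨-, rfl⟩
  · exact hS.step h1 c
  · exact hS

theorem sound_initial (hak : a ≤ k) :
    Sound H k a ∅ (Memory.initial V) where
  mark_uncolored w := Iff.rfl
  accepted_of_mark w hw := hw
  color_eq w _ := rfl
  troubled_bad w hw := by cases hw
  acc_card e _ := by
    have : (Memory.initial V).record.acc e.1 = ∅ :=
      Set.eq_empty_of_forall_notMem fun w hw => by cases hw.2
    rw [this, Set.ncard_empty]; omega
  bad_untouched e _ w _ := rfl
  touched_determined e he := absurd (fun w _ => rfl) he
  unsafe_cases f _ := Or.inl fun w _ => rfl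

theorem Reachable.sound [Finite V] {M : Memory V} (h : Reachable H k a M) (hun : IsUniform H k)
    (ha : 0 < a) (hak : a ≤ k) : Sound H k a ∅ M := by
  induction h with
  | init => exact sound_initial hak
  | accepted h hv ht hs ih => exact ht.sound ih
  | troubled h hv ht hs hb hU hc ih =>
    exact (hb.building hun ha (ht.sound ih) hs).finalColoring hun ha hU hc

end

/-! ### Witness structures for components -/

section

variable {M : Memory V} {B C : Set (Edge H)} {D : Duo H}

theorem ncard_le_of_subset_coveredBy [Finite V] {A : Set (Edge H)} (h : C ⊆ coveredBy A) :
    C.ncard ≤ A.ncard * (maxEdgeDegree H + 1) := by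
  classical
  have := Fintype.ofFinite (Edge H)
  have h1 : C ⊆ (A.toFinset.biUnion fun y => (insert y (nbrs y)).toFinset : Finset (Edge H)) := by
    intro c hc
    obtain ⟨y, hy, hcy⟩ := mem_coveredBy.1 (h hc)
    simp only [Finset.coe_biUnion, Set.mem_iUnion, Set.coe_toFinset]
    exact ⟨y, hy, hcy⟩
  refine (Set.ncard_le_ncard h1 (Set.toFinite _)).trans ?_
  rw [Set.ncard_coe_finset, Set.ncard_eq_toFinset_card']
  refine Finset.card_biUnion_le_card_mul _ _ _ fun y _ => ?_
  rw [← Set.ncard_eq_toFinset_card']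
  refine (Set.ncard_insert_le _ _).trans (Nat.add_le_add_right ?_ 1)
  exact le_ciSup (f := fun f : Edge H => (nbrs f).ncard) (Set.finite_range _).bddAbove y

theorem Good.exists_witnessStructure [Finite V] (h : Good k a M B D) (hL : D.L = ∅) (hp : 0 ≤ D.pot)
    (hC : C ⊆ coveredBy D.A) :
    ∃ τ : WitnessStructure H, τ.Proper ∧ τ.Satisfied k a M.record ∧
      C.ncard ≤ τ.size * (maxEdgeDegree H + 1) := by
  obtain ⟨β₁, β₂, h1, ⟨τ, d, h2⟩, h3⟩ := h.tree
  have hβ : 0 ≤ β₂ := by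
    rcases h1 with ⟨-, h1⟩ | ⟨h1, -⟩
    · omega
    · rw [hL] at h1; exact absurd h1 Set.not_nonempty_empty
  have hdep : ∀ x, τ.Active x → τ.depth x = D.dep (τ.hom x) := fun x hx =>
    (h2.isDepth.depth_eq x).trans (h2.mem x hx).2.2
  have hbelow : ∀ n, τ.activeBelow n = {y | y ∈ D.L ∪ D.A ∧ D.dep y < n} := by
    intro n
    ext e
    constructor
    · rintro ⟨x, hx, hxn, rfl⟩
      exact ⟨Or.inr (h2.mem x hx).1, by rwa [← hdep x hx]⟩
    · rintro ⟨he, hen⟩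
      rw [hL, Set.empty_union] at he
      obtain ⟨x, hx, rfl⟩ := h2.surj e he
      exact ⟨x, hx, by rwa [hdep x hx], rfl⟩
  refine ⟨τ, ⟨hβ.trans h2.balance, fun x y hx hy hne => ?_⟩, fun x hx => ?_, ?_⟩
  · have hxy : τ.hom x ≠ τ.hom y := fun h => hne (h2.inj x y hx hy h)
    exact ⟨hxy, h.edges _ (Or.inr (h2.mem x hx).1) _ (Or.inr (h2.mem y hy).1) hxy⟩
  · have hev := h.event _ (Or.inr (h2.mem x hx).1)
    rw [← hdep x hx, ← hbelow, ← (h2.mem x hx).2.1] at hev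
    unfold WitnessStructure.BasicEvent
    cases hl : τ.label x <;> rw [hl] at hev <;> try exact hev
    exact hev.1
  · refine (ncard_le_of_subset_coveredBy hC).trans (Nat.mul_le_mul_right _ ?_)
    have := τ.finite
    have hA : D.A ⊆ τ.hom '' Set.univ := fun e he => by
      obtain ⟨x, -, hx⟩ := h2.surj e he
      exact ⟨x, trivial, hx⟩
    refine (Set.ncard_le_ncard hA (Set.toFinite _)).trans ((Set.ncard_image_le Set.finite_univ).trans ?_)
    rw [Set.ncard_univ]; exact le_rfl

/-- Here there is no older tree, so the empty stem is used and the reserve for a joint is not spent.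
-/
theorem Found.exists_good [Finite V] {X₀ : Set (Edge H)} {M₀ : Memory V} {f : Edge H} {A : Work H}
    (hA : Found k a X₀ B M₀ f A) (hun : IsUniform H k) :
    ∃ D, Good k a A.mem A.bad D ∧ D.L = ∅ ∧ 0 ≤ D.pot ∧ A.bad ⊆ coveredBy D.A := by
  obtain ⟨R, hR, hJ, hG⟩ := hA.gain
  obtain ⟨D, h1, h2, h3⟩ := hG.cover hun hA.area.sound
    (stem_empty A.mem A.bad (fun _ => .B) fun _ => 0) hJ.1 hR (fun t ht => hA.area.bad ht)
    hA.area.tame subset_rfl fun t _ => not_mem_coveredBy_empty t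
  exact ⟨D, h1, h2.left.elim id id, by linarith [h2.pot], h3⟩

theorem Region.exists_good [Finite V] {S B' : Set (Edge H)} (h : Region k a M S) (hS : S.Nonempty)
    (hun : IsUniform H k) (hM : Sound H k a B' M) :
    ∃ D, Good k a M S D ∧ D.L = ∅ ∧ 0 ≤ D.pot ∧ S ⊆ coveredBy D.A := by
  obtain ⟨c, hc⟩ := hS
  obtain ⟨D, h1, h2, h3, -, h4⟩ := (stem_empty (k := k) (a := a) M S (fun _ => .B)
    fun _ => 0).start_far (z := c) (ℓ := .B) (not_mem_coveredBy_empty c) (h.tame hc) (by simp)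
    (by simp) (fun _ => h.bad c hc)
  obtain ⟨D', h5, h6, h7⟩ := h.cover hun hM h1 subset_rfl
    (fun s _ => by rw [h2]; exact not_mem_coveredBy_empty s)
    ⟨c, hc, by rw [h3]; exact Or.inl rfl⟩
  refine ⟨D', h5, h6.left_empty h2, le_trans ?_ h6.pot, h7⟩
  rw [h4]; simp [Label.weight]

theorem Builds.exists_good [Finite V] {M₁ : Memory V} {v : V} (h : Builds k a M₁ v C M)
    (hun : IsUniform H k) (ha : 0 < a) (hS : Sound H k a ∅ M₁)
    (hs : M₁.status v = Status.troubled) :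
    ∃ B D, Good k a M B D ∧ D.L = ∅ ∧ 0 ≤ D.pot ∧ C ⊆ coveredBy D.A := by
  cases h with
  | finalComponent h hU => exact ⟨_, (h.building hun ha hS hs).witness⟩
  | @searchArea f W A Us b h hU hf ht hA =>
    have hW := h.building hun ha hS hs
    obtain ⟨h1, h2⟩ := hA.spec hW.explo (hW.target hf) ha
    cases b with
    | true => exact ⟨_, (h1 rfl).exists_good hun⟩
    | false =>
      have hA' := h2 rfl
      -- For an empty search area any proper satisfied structure will do, and the component under
      -- construction provides one.
      rcases hA'.joined with h3 | ⟨h3, c, hc, -⟩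
      · obtain ⟨D, d1, d2, d3, -⟩ := (hW.progress hA'.area.progress).witness
        exact ⟨_, D, d1, d2, d3, by rw [h3]; exact Set.empty_subset _⟩
      · exact ⟨_, h3.exists_good ⟨c, hc⟩ hun hA'.area.sound⟩

theorem ComponentBuilt.exists_witnessStructure [Finite V] (h : ComponentBuilt H k a C M)
    (hun : IsUniform H k) (ha : 0 < a) (hak : a ≤ k) :
    ∃ τ : WitnessStructure H, τ.Proper ∧ τ.Satisfied k a M.record ∧
      C.ncard ≤ τ.size * (maxEdgeDegree H + 1) := by
  obtain ⟨M₀, M₁, v, hM₀, -, ht, hs, hb⟩ := h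
  obtain ⟨B, D, h1, h2, h3, h4⟩ := hb.exists_good hun ha (ht.sound (hM₀.sound hun ha hak)) hs
  exact h1.exists_witnessStructure h2 h3 h4

end

end LocalColoring

theorem mainTheorem5 {V : Type*} [Finite V] (H : Hypergraph V) (k a : ℕ) (α : ℝ)
    (hunif : LocalColoring.IsUniform H k)
    (hα : α ≤ 1 / 3)
    (ha : (a : ℝ) = α * k)
    (hLLL : 2 * Real.exp 1 * ((LocalColoring.maxEdgeDegree H : ℝ) + 1) < (2 : ℝ) ^ (α * k))
    (hΔ : (LocalColoring.maxEdgeDegree H : ℝ) ≤ 1 / 192 * (2 : ℝ) ^ ((k : ℝ) / 3))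
    (C : Set (LocalColoring.Edge H)) (M : LocalColoring.Memory V)
    (hC : LocalColoring.ComponentBuilt H k a C M) :
    ∃ τ : LocalColoring.WitnessStructure H,
      τ.Proper ∧ τ.Satisfied k a M.record ∧
        (C.ncard : ℝ) / ((LocalColoring.maxEdgeDegree H : ℝ) + 1) ≤ (τ.size : ℝ) := by
  have hpos : (0 : ℝ) < (LocalColoring.maxEdgeDegree H : ℝ) + 1 := by positivity
  have ha' : 0 < a := by
    -- For `a = 0` the hypothesis `hLLL` would read `2 e (Δ + 1) < 1`.
    rw [Nat.pos_iff_ne_zero]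
    rintro rfl
    rw [← ha, Nat.cast_zero, Real.rpow_zero] at hLLL
    have h1 : 1 ≤ Real.exp 1 := Real.one_le_exp zero_le_one
    have h2 : (0 : ℝ) ≤ LocalColoring.maxEdgeDegree H := Nat.cast_nonneg _
    nlinarith
  have hak : a ≤ k := by
    have hk : (0 : ℝ) ≤ k := Nat.cast_nonneg _
    have : (a : ℝ) ≤ k := by rw [ha]; nlinarith
    exact_mod_cast this
  obtain ⟨τ, h1, h2, h3⟩ := hC.exists_witnessStructure hunif ha' hak
  refine ⟨τ, h1, h2, ?_⟩
  rw [div_le_iff₀ hpos]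
  exact_mod_cast h3
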